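/- Let $\mathbb S^1$ be the unit circle with the normalised measure $d\theta/2\pi$, $(f\mid g)=\frac1{2\pi}\int_0^{2\pi} f\bar g\,d\theta$, let $L^2_+$ be the space of $f\in L^2(\mathbb S^1)$ with $\hat f(k)=0$ for all $k<0$, $\Pi$ the projector onto nonnegative frequencies, $\|f\|_{H^s}^2=\sum_k(1+k^2)^s|\hat f(k)|^2$ and $H^s_+=H^s(\mathbb S^1)\cap L^2_+$. For $u\in H^{1/2}_+$ let $K_u$ be the antilinear operator on $L^2_+$ given by $K_uh=T_z^*\Pi(u\bar h)$, where $T_z^*$ is the adjoint of multiplication by $z=e^{i\theta}$ on $L^2_+$ (the backward shift of Fourier coefficients), and let $\mathcal L(1)=\{u\in H^{1/2}_+:\operatorname{rk}K_u=1\}$ with the topology of $H^{1/2}_+$. For $\alpha\in\mathbb R$ put $$Q(u)=\|u\|_{L^2}^2,\qquad M(u)=\sum_k k|\hat u(k)|^2,\qquad E_\alpha(u)=\tfrac14\|u\|_{L^4}^4+\tfrac\alpha2|(u\mid1)|^2 .$$ **Theorem.** Let $\alpha>0$, $u_0\in\mathcal L(1)$, and let $u\in C(\mathbb R;H^{1/2}_+)$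 be the solution of $$i\partial_tu=\Pi(|u|^2u)+\alpha(u\mid1),\qquad u(0)=u_0 .$$ Then for all $t\in\mathbb R$ $$u(t)=b(t)+\frac{c(t)z}{1-p(t)z},\qquad b(t),c(t),p(t)\in\mathbb C,\quad c(t)\neq0,\quad |p(t)|<1 .$$ Write $b=b(0)$, $c=c(0)$, $p=p(0)$ for the coordinates of $u_0$, and $Q=Q(u_0)$, $M=M(u_0)$, $E_\alpha=E_\alpha(u_0)$. 1. If the trajectory $\{u(t):t\in\mathbb R\}$ is not relatively compact in $\mathcal L(1)$ (that is, not contained in a compact subset of $\mathcal L(1)$), then $$\left|b+\frac{\bar p\,c}{1-|p|^2}\right|=\sqrt\alpha .\tag{$*$}$$ Moreover, whether or not the trajectory is relatively compact, $(*)$ is equivalent to $$E_\alpha=\tfrac14Q^2+\tfrac\alpha2Q .$$ 2. If $(*)$ holds, then $t\mapsto\log|c(t)|$ is differentiable and, for all $t\in\mathbb R$, $$\left(\frac{d\log|c|}{dt}\right)^2=-4\alpha\sqrt M\,|c|+4QM-(\alpha-M-Q)^2 ,$$ and for every $s>\frac12$ the solution stays in $H^s_+$ and $$\|u(t)\|_{H^s}\simeq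 e^{C|t|}\qquad(|t|\to\infty)$$ with a constant $C>0$ that depends only on $\alpha$, $s$, $Q$ and $M$; that is, there are $m,m',T>0$ with $m\,e^{C|t|}\le\|u(t)\|_{H^s}\le m'e^{C|t|}$ for $|t|\ge T$. -/

import Mathlib

open MeasureTheory AddCircle Filter Topology Asymptotics
open scoped ComplexConjugate

noncomputable section

namespace Szego

/-- The length `2π` of the circle is positive. -/
instance factTwoPiPos : Fact (0 < 2 * Real.pi) := ⟨Real.two_pi_pos⟩

/-- The circle `𝕊¹`, parametrised by the angle `θ ∈ ℝ / 2πℤ`. -/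
abbrev S1 : Type := AddCircle (2 * Real.pi)

/-- The normalised measure `dθ / 2π`. -/
abbrev dθ : Measure S1 := haarAddCircle

/-- The boundary variable `z = e^{iθ}`. -/
def z (θ : S1) : ℂ := fourier 1 θ

/-- `L²(𝕊¹)` for the measure `dθ / 2π`. -/
abbrev L2 : Type := Lp ℂ 2 dθ

/-- The `k`-th Fourier coefficient of `f ∈ L²(𝕊¹)`. -/
def coef (f : L2) (k : ℤ) : ℂ := fourierCoeff (f : S1 → ℂ) k

theorem coef_eq_repr (f : L2) (k : ℤ) : coef f k = fourierBasis.repr f k :=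
  (fourierBasis_repr f k).symm

theorem coef_add (f g : L2) (k : ℤ) : coef (f + g) k = coef f k + coef g k := by
  simp [coef_eq_repr]

theorem coef_smul (a : ℂ) (f : L2) (k : ℤ) : coef (a • f) k = a * coef f k := by
  simp [coef_eq_repr]

theorem coef_zero (k : ℤ) : coef 0 k = 0 := by
  simp [coef_eq_repr]

theorem coef_injective {f g : L2} (h : ∀ k, coef f k = coef g k) : f = g := by
  apply fourierBasis.repr.injective
  ext k
  simpa [coef_eq_repr] using h k

/-- The Hardy space `L²₊(𝕊¹)`: no negative frequencies. -/
def L2plus : Submodule ℂ L2 where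
  carrier := {f | ∀ k : ℤ, k < 0 → coef f k = 0}
  zero_mem' := fun k _ => coef_zero k
  add_mem' := by
    intro f g hf hg k hk
    rw [coef_add, hf k hk, hg k hk, add_zero]
  smul_mem' := by
    intro a f hf k hk
    rw [coef_smul, hf k hk, mul_zero]

/-- The sequence `((1 + k²)^{s/2} f̂(k))ₖ`, whose `ℓ²` norm is the `H^s` norm of `f`. -/
def weighted (s : ℝ) (f : L2) (k : ℤ) : ℂ := (((1 + (k : ℝ) ^ 2) ^ (s / 2) : ℝ) : ℂ) * coef f k

/-- `f ∈ H^s(𝕊¹)` (for `s ≥ 0`). -/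
def MemHs (s : ℝ) (f : L2) : Prop := Memℓp (weighted s f) 2

/-- The Sobolev norm `‖f‖_{H^s} = (∑ₖ (1 + k²)^s |f̂(k)|²)^{1/2}`. -/
def hsNorm (s : ℝ) (f : L2) : ℝ := √(∑' k : ℤ, (1 + (k : ℝ) ^ 2) ^ s * ‖coef f k‖ ^ 2)

/-- `H^s₊(𝕊¹) = H^s(𝕊¹) ∩ L²₊(𝕊¹)` (for `s ≥ 0`), as a subspace of `L²(𝕊¹)`. -/
def hsPlusSubmodule (s : ℝ) : Submodule ℂ L2 where
  carrier := {f | f ∈ L2plus ∧ MemHs s f}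
  zero_mem' := by
    refine ⟨zero_mem _, ?_⟩
    have h : weighted s 0 = 0 := by
      funext k
      simp [weighted, coef_zero]
    change Memℓp (weighted s 0) 2
    rw [h]
    exact zero_memℓp
  add_mem' := by
    intro f g hf hg
    refine ⟨add_mem hf.1 hg.1, ?_⟩
    have h : weighted s (f + g) = weighted s f + weighted s g := by
      funext k
      simp [weighted, coef_add, mul_add]
    unfold MemHs
    rw [h]
    exact hf.2.add hg.2
  smul_mem' := by
    intro a f hf
    refine ⟨Submodule.smul_mem _ a hf.1, ?_⟩
    have h : weighted s (a • f) = a • weighted s f := by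
      funext k
      simp only [weighted, coef_smul, Pi.smul_apply, smul_eq_mul]
      ring
    unfold MemHs
    rw [h]
    exact hf.2.const_smul a

/-- `H^s₊(𝕊¹)` as a space of its own; it carries the `H^s` norm, not that of `L²`. -/
def HPlus (s : ℝ) : Type := hsPlusSubmodule s

namespace HPlus

instance (s : ℝ) : AddCommGroup (HPlus s) := inferInstanceAs (AddCommGroup (hsPlusSubmodule s))

instance (s : ℝ) : Module ℂ (HPlus s) := inferInstanceAs (Module ℂ (hsPlusSubmodule s))

/-- The underlying element of `L²(𝕊¹)`. -/
def val {s : ℝ} (f : HPlus s) : L2 := Subtype.val (p := (· ∈ hsPlusSubmodule s)) f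

theorem val_mem {s : ℝ} (f : HPlus s) : f.val ∈ L2plus ∧ MemHs s f.val :=
  Subtype.property (p := (· ∈ hsPlusSubmodule s)) f

theorem val_add {s : ℝ} (f g : HPlus s) : (f + g).val = f.val + g.val := rfl

theorem val_injective {s : ℝ} : Function.Injective (val (s := s)) := Subtype.val_injective

/-- The map `f ↦ ((1 + k²)^{s/2} f̂(k))ₖ` from `H^s₊` to `ℓ²(ℤ)`. -/
def toSeq (s : ℝ) : HPlus s →+ lp (fun _ : ℤ => ℂ) 2 where
  toFun f := ⟨weighted s f.val, f.val_mem.2⟩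
  map_zero' := by
    ext k
    change weighted s 0 k = 0
    simp [weighted, coef_zero]
  map_add' := by
    intro f g
    ext k
    change weighted s (f.val + g.val) k = weighted s f.val k + weighted s g.val k
    simp [weighted, coef_add, mul_add]

theorem toSeq_injective (s : ℝ) : Function.Injective (toSeq s) := by
  intro f g h
  apply val_injective
  apply coef_injective
  intro k
  have hk : weighted s f.val k = weighted s g.val k :=
    congrArg (fun x : lp (fun _ : ℤ => ℂ) 2 => (x : ℤ → ℂ) k) h
  have hpos : (0 : ℝ) < (1 + (k : ℝ) ^ 2) ^ (s / 2) := by positivity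
  exact mul_left_cancel₀ (by exact_mod_cast hpos.ne') hk

/-- The `H^s` norm on `H^s₊`; all topological notions on `H^s₊` refer to it. -/
instance (s : ℝ) : NormedAddCommGroup (HPlus s) :=
  NormedAddCommGroup.induced (HPlus s) (lp (fun _ : ℤ => ℂ) 2) (toSeq s) (toSeq_injective s)

theorem norm_eq_hsNorm {s : ℝ} (f : HPlus s) : ‖f‖ = hsNorm s f.val := by
  change ‖toSeq s f‖ = _
  rw [lp.norm_eq_tsum_rpow (by simp), hsNorm, Real.sqrt_eq_rpow]
  simp only [ENNReal.toReal_ofNat]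
  congr 1
  refine tsum_congr fun k => ?_
  change ‖weighted s f.val k‖ ^ (2 : ℝ) = _
  have hpos : (0 : ℝ) < 1 + (k : ℝ) ^ 2 := by positivity
  rw [weighted, norm_mul, Complex.norm_real, Real.norm_of_nonneg (by positivity),
    Real.rpow_two, mul_pow, ← Real.rpow_natCast, ← Real.rpow_mul hpos.le]
  norm_num

end HPlus

/-- The Szegő projector: `Π f` has the Fourier coefficients `f̂(k)` for `k ≥ 0` and no others.
It is recorded by the sequence of these coefficients. -/
def szegoProj (f : S1 → ℂ) (k : ℕ) : ℂ := fourierCoeff f k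

theorem integrable_mul_conj (u h : L2) : Integrable (fun θ => u θ * conj (h θ)) dθ :=
  (Lp.memLp u).integrable_mul (Lp.memLp h).star

/-- The antilinear Hankel operator `H_u h = Π(u h̄)`, `h ∈ L²₊`, with values given by their
Fourier coefficients. For `u ∈ H^{1/2}₊` these values lie in `L²₊`, so that the rank of the
operator does not depend on this way of writing its values. -/
def hankel (u : L2) : L2plus →ₛₗ[starRingEnd ℂ] (ℕ → ℂ) where
  toFun h := szegoProj fun θ => u θ * conj ((h : L2) θ)
  map_add' := by
    intro g h
    funext k
    have e : (fun θ => u θ * conj (((g + h : L2plus) : L2) θ)) =ᵐ[dθ]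
        (fun θ => u θ * conj ((g : L2) θ)) + fun θ => u θ * conj ((h : L2) θ) := by
      filter_upwards [Lp.coeFn_add (g : L2) (h : L2)] with θ hθ
      rw [Submodule.coe_add, hθ]
      simp [mul_add]
    simp only [szegoProj, Pi.add_apply]
    rw [fourierCoeff_congr_ae e,
      fourierCoeff.add (integrable_mul_conj u g) (integrable_mul_conj u h)]
    simp
  map_smul' := by
    intro a h
    funext k
    have e : (fun θ => u θ * conj (((a • h : L2plus) : L2) θ)) =ᵐ[dθ]
        fun θ => conj a * (u θ * conj ((h : L2) θ)) := by
      filter_upwards [Lp.coeFn_smul a (h : L2)] with θ hθ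
      rw [Submodule.coe_smul, hθ]
      simp only [Pi.smul_apply, smul_eq_mul, map_mul]
      ring
    simp only [szegoProj, Pi.smul_apply, smul_eq_mul]
    rw [fourierCoeff_congr_ae e, fourierCoeff.const_mul]

/-- `T_z^*`, the backward shift of Fourier coefficients on functions with nonnegative
frequencies. -/
def shiftAdj : (ℕ → ℂ) →ₗ[ℂ] (ℕ → ℂ) where
  toFun a k := a (k + 1)
  map_add' _ _ := rfl
  map_smul' _ _ := rfl

/-- The shifted Hankel operator `K_u = T_z^* H_u`. -/
def shiftedHankel (u : L2) : L2plus →ₛₗ[starRingEnd ℂ] (ℕ → ℂ) := shiftAdj.comp (hankel u)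

/-- `𝓛(k) = {u ∈ H^{1/2}₊ : rk K_u = k}`. -/
def manifoldL (k : ℕ) : Set (HPlus (1 / 2)) :=
  {u | Module.rank ℂ (LinearMap.range (shiftedHankel u.val)) = k}

/-- The average `(u | 1)`. -/
def mean (u : L2) : ℂ := ∫ θ, u θ ∂dθ

/-- The mass `Q(u) = ‖u‖²_{L²}`. -/
def mass (u : L2) : ℝ := ∫ θ, ‖u θ‖ ^ 2 ∂dθ

/-- The momentum `M(u) = (Du | u)`, `D = -i∂_θ`, in Fourier variables. -/
def momentum (u : L2) : ℝ := ∑' k : ℤ, (k : ℝ) * ‖coef u k‖ ^ 2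

/-- The energy `E_α(u) = ¼ ∫ |u|⁴ + ½ α |(u | 1)|²`. -/
def energy (α : ℝ) (u : L2) : ℝ := 1 / 4 * ∫ θ, ‖u θ‖ ^ 4 ∂dθ + 1 / 2 * α * ‖mean u‖ ^ 2

/-- `u ∈ C(ℝ; H^{1/2}₊)` solves `i∂ₜu = Π(|u|²u) + α (u | 1)` in the sense of distributions
on the circle, i.e. for every Fourier mode, with `u(0) = u₀`. -/
structure IsSolution (α : ℝ) (u₀ : HPlus (1 / 2)) (u : ℝ → HPlus (1 / 2)) : Prop where
  continuous : Continuous u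
  initial : u 0 = u₀
  equation : ∀ (t : ℝ) (k : ℕ),
    HasDerivAt (fun τ => coef (u τ).val k)
      (-Complex.I * (szegoProj (fun θ => (‖(u t).val θ‖ : ℂ) ^ 2 * (u t).val θ) k
        + if k = 0 then (α : ℂ) * mean (u t).val else 0)) t

/-- The trajectory `{u(t) : t ∈ ℝ}` is relatively compact in `A`: it is contained in a compact
subset of `A`. -/
def RelativelyCompactIn (A : Set (HPlus (1 / 2))) (u : ℝ → HPlus (1 / 2)) : Prop :=
  ∃ K : Set (HPlus (1 / 2)), IsCompact K ∧ K ⊆ A ∧ Set.range u ⊆ K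

/-- `u = b + c z / (1 - p z)` on the circle. -/
def HasCoordinates (u : L2) (b c p : ℂ) : Prop :=
  (u : S1 → ℂ) =ᵐ[dθ] fun θ => b + c * z θ / (1 - p * z θ)

end Szego

end

noncomputable section

namespace Szego

/-! ### Rational functions with one pole -/

theorem norm_z (θ : S1) : ‖z θ‖ = 1 := by
  rw [z, fourier_apply, Circle.norm_coe]

theorem continuous_z : Continuous z := (fourier (T := 2 * Real.pi) 1).continuous

theorem z_mul_conj (θ : S1) : z θ * conj (z θ) = 1 := by
  rw [Complex.mul_conj, Complex.normSq_eq_norm_sq, norm_z]; simp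

theorem one_sub_mul_z_ne_zero {p : ℂ} (hp : ‖p‖ < 1) (θ : S1) : 1 - p * z θ ≠ 0 := by
  intro h
  have h1 : p * z θ = 1 := (sub_eq_zero.mp h).symm
  have h2 : ‖p * z θ‖ = 1 := by rw [h1]; simp
  rw [norm_mul, norm_z, mul_one] at h2
  linarith

theorem one_sub_mul_conj_ne_zero {p : ℂ} (hp : ‖p‖ < 1) : 1 - p * conj p ≠ 0 := by
  rw [Complex.mul_conj, Complex.normSq_eq_norm_sq]
  intro h
  have : (1 : ℝ) - ‖p‖ ^ 2 = 0 := by exact_mod_cast h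
  nlinarith [norm_nonneg p]

/-- The function `z / (1 - p z)` on the circle. -/
def zeta (p : ℂ) (θ : S1) : ℂ := z θ / (1 - p * z θ)

theorem continuous_zeta {p : ℂ} (hp : ‖p‖ < 1) : Continuous (zeta p) :=
  continuous_z.div (by have := continuous_z; fun_prop) (one_sub_mul_z_ne_zero hp)

theorem norm_zeta_le {p : ℂ} (hp : ‖p‖ < 1) (θ : S1) : ‖zeta p θ‖ ≤ 1 / (1 - ‖p‖) := by
  rw [zeta, norm_div, norm_z]
  apply one_div_le_one_div_of_le (by linarith)
  have := norm_sub_norm_le (1 : ℂ) (p * z θ)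
  rwa [norm_mul, norm_z, mul_one, norm_one] at this

theorem zeta_mul_conj {p : ℂ} (hp : ‖p‖ < 1) (θ : S1) :
    (1 - p * conj p) * (zeta p θ * conj (zeta p θ))
      = 1 + p * zeta p θ + conj p * conj (zeta p θ) := by
  have h1 := one_sub_mul_z_ne_zero hp θ
  have h2 : 1 - conj p * conj (z θ) ≠ 0 := by
    intro h; apply h1
    have := congrArg conj h
    simpa using this
  have h3 := z_mul_conj θ
  simp only [zeta, map_div₀, map_sub, map_mul, map_one]
  field_simp
  linear_combination h3

theorem fourierCoeff_mul_z (f : S1 → ℂ) (k : ℤ) :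
    fourierCoeff (fun θ => z θ * f θ) k = fourierCoeff f (k - 1) := by
  simp only [fourierCoeff, smul_eq_mul]
  congr 1; funext θ
  rw [z, ← mul_assoc, ← fourier_add]
  congr 3; ring

theorem fourierCoeff_conj (f : S1 → ℂ) (k : ℤ) :
    fourierCoeff (fun θ => conj (f θ)) k = conj (fourierCoeff f (-k)) := by
  simp only [fourierCoeff, smul_eq_mul]
  rw [← integral_conj]
  congr 1; funext θ
  rw [map_mul, ← fourier_neg, neg_neg]

theorem integrable_of_continuous {f : S1 → ℂ} (hf : Continuous f) : Integrable f dθ :=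
  hf.integrable_of_hasCompactSupport (HasCompactSupport.of_compactSpace f)

theorem fourierCoeff_add' {f g : S1 → ℂ} (hf : Integrable f dθ) (hg : Integrable g dθ) (k : ℤ) :
    fourierCoeff (fun θ => f θ + g θ) k = fourierCoeff f k + fourierCoeff g k := by
  have := congrFun (fourierCoeff.add hf hg) k
  exact this

theorem fourierCoeff_const (a : ℂ) (k : ℤ) :
    fourierCoeff (fun _ : S1 => a) k = if k = 0 then a else 0 := by
  have h := fourierCoeff.const_mul (T := 2 * Real.pi) (fun θ => fourier 0 θ) a k
  simp only [fourier_zero, mul_one] at h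
  rw [h]
  have h2 := congrFun (fourierCoeff_fourier (T := 2 * Real.pi) 0) k
  have h3 : (fun _ : S1 => (1 : ℂ)) = (fourier 0 : S1 → ℂ) := by
    funext θ; simp
  rw [h3, h2]
  by_cases hk : k = 0
  · simp [hk]
  · simp [hk]

theorem norm_fourierCoeff_le (f : S1 → ℂ) (k : ℤ) : ‖fourierCoeff f k‖ ≤ ∫ θ, ‖f θ‖ ∂dθ := by
  refine (norm_integral_le_integral_norm _).trans (le_of_eq ?_)
  congr 1; funext θ
  rw [norm_smul, fourier_apply, Circle.norm_coe, one_mul]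

/-- Fourier coefficients of a solution of `(1 - p z) f = z g`. -/
theorem fourierCoeff_recursion {p : ℂ} {f g : S1 → ℂ} (hf : Continuous f) (hg : Continuous g)
    (h : ∀ θ, f θ = z θ * (p * f θ + g θ)) (k : ℤ) :
    fourierCoeff f k = p * fourierCoeff f (k - 1) + fourierCoeff g (k - 1) := by
  have e : f = fun θ => z θ * (p * f θ + g θ) := funext h
  conv_lhs => rw [e]
  rw [fourierCoeff_mul_z, fourierCoeff_add' (integrable_of_continuous (by fun_prop))
    (integrable_of_continuous hg), fourierCoeff.const_mul]

theorem fourierCoeff_eq_zero_of_recursion {p : ℂ} (hp : ‖p‖ < 1) {f g : S1 → ℂ}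
    (hf : Continuous f) (hg : Continuous g) (h : ∀ θ, f θ = z θ * (p * f θ + g θ)) {m : ℤ}
    (hm : ∀ j < m, fourierCoeff g j = 0) {k : ℤ} (hk : k ≤ m) : fourierCoeff f k = 0 := by
  have key : ∀ n : ℕ, ∀ k ≤ m, fourierCoeff f k = p ^ n * fourierCoeff f (k - n) := by
    intro n
    induction n with
    | zero => intro k _; simp
    | succ n ih =>
      intro k hk
      rw [ih k hk, fourierCoeff_recursion hf hg h (k - n), hm (k - n - 1) (by omega)]
      push_cast
      rw [sub_sub]
      ring
  have hlim : Tendsto (fun n : ℕ => ‖p‖ ^ n * ∫ θ, ‖f θ‖ ∂dθ) atTop (𝓝 0) := by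
    simpa using (tendsto_pow_atTop_nhds_zero_of_lt_one (norm_nonneg p) hp).mul_const
      (∫ θ, ‖f θ‖ ∂dθ)
  have : ‖fourierCoeff f k‖ ≤ 0 := by
    refine ge_of_tendsto' hlim fun n => ?_
    rw [key n k hk, norm_mul, norm_pow]
    gcongr
    exact norm_fourierCoeff_le f _
  simpa using this

theorem zeta_recursion {p : ℂ} (hp : ‖p‖ < 1) (θ : S1) :
    zeta p θ = z θ * (p * zeta p θ + 1) := by
  have h1 := one_sub_mul_z_ne_zero hp θ
  simp only [zeta]
  have h2 := div_mul_cancel₀ (z θ) h1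
  rw [div_eq_iff h1]
  linear_combination (-p * z θ) * h2

theorem zeta_sq_recursion {p : ℂ} (hp : ‖p‖ < 1) (θ : S1) :
    zeta p θ ^ 2 = z θ * (p * zeta p θ ^ 2 + zeta p θ) := by
  have h1 := zeta_recursion hp θ
  linear_combination zeta p θ * h1

theorem fourierCoeff_zeta_of_nonpos {p : ℂ} (hp : ‖p‖ < 1) {k : ℤ} (hk : k ≤ 0) :
    fourierCoeff (zeta p) k = 0 :=
  fourierCoeff_eq_zero_of_recursion hp (continuous_zeta hp) continuous_const (zeta_recursion hp)
    (m := 0) (fun j hj => by rw [fourierCoeff_const, if_neg hj.ne]) hk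

theorem fourierCoeff_zeta_succ {p : ℂ} (hp : ‖p‖ < 1) (n : ℕ) :
    fourierCoeff (zeta p) ((n + 1 : ℕ) : ℤ) = p ^ n := by
  induction n with
  | zero =>
    rw [fourierCoeff_recursion (continuous_zeta hp) continuous_const (zeta_recursion hp),
      fourierCoeff_zeta_of_nonpos hp (by simp), fourierCoeff_const]
    simp
  | succ n ih =>
    rw [fourierCoeff_recursion (continuous_zeta hp) continuous_const (zeta_recursion hp),
      fourierCoeff_const, if_neg (by omega)]
    have : ((n + 1 + 1 : ℕ) : ℤ) - 1 = ((n + 1 : ℕ) : ℤ) := by push_cast; ring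
    rw [this, ih]; ring

theorem fourierCoeff_zeta_sq_of_nonpos {p : ℂ} (hp : ‖p‖ < 1) {k : ℤ} (hk : k ≤ 0) :
    fourierCoeff (fun θ => zeta p θ ^ 2) k = 0 :=
  fourierCoeff_eq_zero_of_recursion hp ((continuous_zeta hp).pow 2) (continuous_zeta hp)
    (zeta_sq_recursion hp) (m := 0) (fun _ hj => fourierCoeff_zeta_of_nonpos hp hj.le) hk

theorem fourierCoeff_zeta_sq_succ {p : ℂ} (hp : ‖p‖ < 1) (n : ℕ) :
    fourierCoeff (fun θ => zeta p θ ^ 2) ((n + 1 : ℕ) : ℤ) = n * p ^ (n - 1) := by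
  induction n with
  | zero =>
    rw [fourierCoeff_recursion (f := fun θ => zeta p θ ^ 2) ((continuous_zeta hp).pow 2)
      (continuous_zeta hp)
      (zeta_sq_recursion hp), fourierCoeff_zeta_sq_of_nonpos hp (by simp),
      fourierCoeff_zeta_of_nonpos hp (by simp)]
    simp
  | succ n ih =>
    rw [fourierCoeff_recursion (f := fun θ => zeta p θ ^ 2) ((continuous_zeta hp).pow 2)
      (continuous_zeta hp)
      (zeta_sq_recursion hp)]
    have : ((n + 1 + 1 : ℕ) : ℤ) - 1 = ((n + 1 : ℕ) : ℤ) := by push_cast; ring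
    rw [this, ih, fourierCoeff_zeta_succ hp]
    rcases n with _ | n
    · simp
    · simp only [Nat.add_sub_cancel]; push_cast; ring

theorem integral_eq_fourierCoeff_zero (f : S1 → ℂ) : ∫ θ, f θ ∂dθ = fourierCoeff f 0 := by
  simp [fourierCoeff]

/-- The function `b + c z / (1 - p z)` on the circle. -/
def ratFun (b c p : ℂ) (θ : S1) : ℂ := b + c * zeta p θ

theorem continuous_ratFun {p : ℂ} (hp : ‖p‖ < 1) (b c : ℂ) : Continuous (ratFun b c p) := by
  have := continuous_zeta hp
  unfold ratFun; fun_prop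

theorem norm_ratFun_le {p : ℂ} (hp : ‖p‖ < 1) (b c : ℂ) (θ : S1) :
    ‖ratFun b c p θ‖ ≤ ‖b‖ + ‖c‖ * (1 / (1 - ‖p‖)) := by
  refine (norm_add_le _ _).trans ?_
  rw [norm_mul]
  gcongr
  exact norm_zeta_le hp θ

/-- Fourier coefficients of `b + c z / (1 - p z)`. -/
def ratCoef (b c p : ℂ) (k : ℤ) : ℂ :=
  if k = 0 then b else if 0 < k then c * p ^ (k - 1).toNat else 0

theorem ratCoef_zero (b c p : ℂ) : ratCoef b c p 0 = b := by simp [ratCoef]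

theorem ratCoef_succ (b c p : ℂ) (n : ℕ) : ratCoef b c p ((n + 1 : ℕ) : ℤ) = c * p ^ n := by
  rw [ratCoef, if_neg (by omega), if_pos (by omega)]
  congr 2; omega

theorem ratCoef_neg (b c p : ℂ) {k : ℤ} (hk : k < 0) : ratCoef b c p k = 0 := by
  rw [ratCoef, if_neg hk.ne, if_neg (by omega)]

theorem fourierCoeff_ratFun {p : ℂ} (hp : ‖p‖ < 1) (b c : ℂ) (k : ℤ) :
    fourierCoeff (ratFun b c p) k = ratCoef b c p k := by
  have hc := continuous_zeta hp
  unfold ratFun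
  rw [fourierCoeff_add' (integrable_of_continuous continuous_const)
    (integrable_of_continuous (by fun_prop)), fourierCoeff.const_mul, fourierCoeff_const]
  rcases lt_trichotomy k 0 with h | h | h
  · rw [fourierCoeff_zeta_of_nonpos hp h.le, ratCoef_neg _ _ _ h, if_neg h.ne]; simp
  · subst h
    rw [fourierCoeff_zeta_of_nonpos hp le_rfl, ratCoef_zero]; simp
  · obtain ⟨n, rfl⟩ : ∃ n : ℕ, k = ((n + 1 : ℕ) : ℤ) := ⟨(k - 1).toNat, by omega⟩
    rw [fourierCoeff_zeta_succ hp, ratCoef_succ, if_neg (by omega)]; simp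

/-- The value of `b + c z / (1 - p z)` at the point `p̄`. -/
def poleVal (b c p : ℂ) : ℂ := b + c * conj p / (1 - p * conj p)

/-- The cubic term of `b + c z / (1 - p z)`, split by frequencies. -/
theorem ratFun_cubic {p : ℂ} (hp : ‖p‖ < 1) (b c : ℂ) (θ : S1) :
    (‖ratFun b c p θ‖ : ℂ) ^ 2 * ratFun b c p θ =
      (b * conj b * b + c * conj c / (1 - p * conj p) * (b + poleVal b c p)
        + (2 * (b * conj b) * c + c * conj c / (1 - p * conj p) * (c + p * (b + poleVal b c p)))
          * zeta p θ
        + c * (conj b * c + c * conj c / (1 - p * conj p) * p) * zeta p θ ^ 2)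
      + conj c * poleVal b c p ^ 2 * conj (zeta p θ) := by
  have hr := one_sub_mul_conj_ne_zero hp
  have h := zeta_mul_conj hp θ
  rw [← Complex.ofReal_pow, ← Complex.normSq_eq_norm_sq, ← Complex.mul_conj]
  simp only [ratFun, poleVal, map_add, map_mul]
  set Z := zeta p θ
  set W := conj Z
  set P := conj p
  set B := conj b
  set C := conj c
  have h' : Z * W = (1 + p * Z + P * W) / (1 - p * P) := by
    rw [eq_div_iff hr]; linear_combination h
  have h2 : Z ^ 2 * W = (Z + p * Z ^ 2 + P * ((1 + p * Z + P * W) / (1 - p * P))) / (1 - p * P) := by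
    rw [← h', eq_div_iff hr]; linear_combination Z * h
  have : (b + c * Z) * (B + C * W) * (b + c * Z) =
      B * (b + c * Z) ^ 2 + C * (b ^ 2 * W + 2 * b * c * (Z * W) + c ^ 2 * (Z ^ 2 * W)) := by ring
  rw [this, h2, h']
  field_simp
  ring

theorem fourierCoeff_cubic_ratFun {p : ℂ} (hp : ‖p‖ < 1) (b c : ℂ) {k : ℤ} (hk : 0 ≤ k) :
    fourierCoeff (fun θ => (‖ratFun b c p θ‖ : ℂ) ^ 2 * ratFun b c p θ) k =
      (if k = 0 then b * conj b * b + c * conj c / (1 - p * conj p) * (b + poleVal b c p) else 0)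
        + (2 * (b * conj b) * c + c * conj c / (1 - p * conj p) * (c + p * (b + poleVal b c p)))
          * fourierCoeff (zeta p) k
        + c * (conj b * c + c * conj c / (1 - p * conj p) * p)
          * fourierCoeff (fun θ => zeta p θ ^ 2) k := by
  have hc := continuous_zeta hp
  simp only [ratFun_cubic hp]
  rw [fourierCoeff_add' (integrable_of_continuous (by fun_prop))
    (integrable_of_continuous (by fun_prop)),
    fourierCoeff_add' (integrable_of_continuous (by fun_prop))
    (integrable_of_continuous (by fun_prop)),
    fourierCoeff_add' (integrable_of_continuous (by fun_prop))
    (integrable_of_continuous (by fun_prop)), fourierCoeff_const, fourierCoeff.const_mul,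
    fourierCoeff.const_mul, fourierCoeff.const_mul, fourierCoeff_conj,
    fourierCoeff_zeta_of_nonpos hp (by omega : -k ≤ 0)]
  simp

theorem integral_zeta {p : ℂ} (hp : ‖p‖ < 1) : ∫ θ, zeta p θ ∂dθ = 0 := by
  rw [integral_eq_fourierCoeff_zero, fourierCoeff_zeta_of_nonpos hp le_rfl]

theorem integral_zeta_sq {p : ℂ} (hp : ‖p‖ < 1) : ∫ θ, zeta p θ ^ 2 ∂dθ = 0 := by
  rw [integral_eq_fourierCoeff_zero, fourierCoeff_zeta_sq_of_nonpos hp le_rfl]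

/-- Mean value property for a quadratic trigonometric expression in `z / (1 - p z)`. -/
theorem integral_zeta_expr {p : ℂ} (hp : ‖p‖ < 1) (a a₁ a₂ b₁ b₂ : ℂ) :
    ∫ θ, (a + a₁ * zeta p θ + a₂ * zeta p θ ^ 2 + b₁ * conj (zeta p θ)
      + b₂ * conj (zeta p θ ^ 2)) ∂dθ = a := by
  have hc := continuous_zeta hp
  rw [integral_add (integrable_of_continuous (by fun_prop)) (integrable_of_continuous (by fun_prop)),
    integral_add (integrable_of_continuous (by fun_prop)) (integrable_of_continuous (by fun_prop)),
    integral_add (integrable_of_continuous (by fun_prop)) (integrable_of_continuous (by fun_prop)),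
    integral_add (integrable_of_continuous (by fun_prop)) (integrable_of_continuous (by fun_prop)),
    integral_const_mul, integral_const_mul, integral_const_mul, integral_const_mul, integral_conj,
    integral_conj, integral_zeta hp, integral_zeta_sq hp]
  simp

theorem integral_sq_ratFun {p : ℂ} (hp : ‖p‖ < 1) (b c : ℂ) :
    ∫ θ, ratFun b c p θ * conj (ratFun b c p θ) ∂dθ
      = b * conj b + c * conj c / (1 - p * conj p) := by
  have hr := one_sub_mul_conj_ne_zero hp
  rw [← integral_zeta_expr hp (b * conj b + c * conj c / (1 - p * conj p))
    (c * conj b + c * conj c / (1 - p * conj p) * p) 0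
    (b * conj c + c * conj c / (1 - p * conj p) * conj p) 0]
  congr 1; funext θ
  have h := zeta_mul_conj hp θ
  simp only [ratFun, map_add, map_mul]
  field_simp
  linear_combination c * conj c * h

theorem integral_fourth_ratFun {p : ℂ} (hp : ‖p‖ < 1) (b c : ℂ) :
    ∫ θ, (ratFun b c p θ * conj (ratFun b c p θ)) ^ 2 ∂dθ
      = (b * conj b + c * conj c / (1 - p * conj p)) ^ 2
        + 2 * (c * conj c / (1 - p * conj p)) * (poleVal b c p * conj (poleVal b c p)) := by
  have hr := one_sub_mul_conj_ne_zero hp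
  set N := c * conj c / (1 - p * conj p) with hN
  set D := b * conj b + N with hD
  set E := c * conj b + N * p with hE
  set F := b * conj c + N * conj p with hF
  rw [← integral_zeta_expr hp (D ^ 2 + 2 * N * (poleVal b c p * conj (poleVal b c p)))
    (2 * D * E + 2 * E * F / (1 - p * conj p) * p) (E ^ 2)
    (2 * D * F + 2 * E * F / (1 - p * conj p) * conj p) (F ^ 2)]
  congr 1; funext θ
  have h := zeta_mul_conj hp θ
  have h1 : ratFun b c p θ * conj (ratFun b c p θ)
      = D + E * zeta p θ + F * conj (zeta p θ) := by
    rw [hD, hE, hF, hN]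
    simp only [ratFun, map_add, map_mul]
    field_simp
    linear_combination c * conj c * h
  have h2 : N * (poleVal b c p * conj (poleVal b c p)) = E * F / (1 - p * conj p) := by
    rw [hE, hF, hN, poleVal]
    simp only [map_add, map_mul, map_div₀, map_sub, map_one, Complex.conj_conj]
    have hr' : 1 - conj p * p ≠ 0 := by rwa [mul_comm]
    field_simp
  rw [h1, mul_assoc 2 N, h2, map_pow]
  field_simp
  linear_combination (2 * E * F) * h

/-! ### Trigonometric polynomials and the embedding of `H^{1/2}₊` in `L⁴` -/

/-- The trigonometric polynomial `∑_{k ∈ s} a k z^k`. -/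
def trig (s : Finset ℕ) (a : ℕ → ℂ) (θ : S1) : ℂ := ∑ k ∈ s, a k * fourier (k : ℤ) θ

theorem continuous_trig (s : Finset ℕ) (a : ℕ → ℂ) : Continuous (trig s a) := by
  unfold trig
  exact continuous_finsetSum _ fun k _ => continuous_const.mul (map_continuous _)

theorem norm_fourier_apply (k : ℤ) (θ : S1) : ‖fourier k θ‖ = 1 := by
  rw [fourier_apply, Circle.norm_coe]

theorem integral_mul_conj_trig {G : S1 → ℂ} (hG : Integrable G dθ) (s : Finset ℕ) (a : ℕ → ℂ) :
    ∫ θ, G θ * conj (trig s a θ) ∂dθ = ∑ k ∈ s, fourierCoeff G k * conj (a k) := by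
  have e : ∀ θ, G θ * conj (trig s a θ)
      = ∑ k ∈ s, conj (a k) * (fourier (-(k : ℤ)) θ • G θ) := by
    intro θ
    rw [trig, map_sum, Finset.mul_sum]
    refine Finset.sum_congr rfl fun k _ => ?_
    rw [map_mul, ← fourier_neg, smul_eq_mul]; ring
  simp only [e]
  rw [integral_finsetSum _ fun k _ => (hG.fourier_smul _).const_mul _]
  refine Finset.sum_congr rfl fun k _ => ?_
  rw [integral_const_mul, fourierCoeff, mul_comm]

theorem fourierCoeff_trig (s : Finset ℕ) (a : ℕ → ℂ) (k : ℕ) :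
    fourierCoeff (trig s a) k = if k ∈ s then a k else 0 := by
  have e : trig s a = ∑ j ∈ s, fun θ => a j * fourier (j : ℤ) θ := by
    funext θ; simp only [trig, Finset.sum_apply]
  have e2 := fourierCoeff.sum s (fun j (θ : S1) => a j * fourier (j : ℤ) θ) fun j _ =>
    integrable_of_continuous (continuous_const.mul (map_continuous _))
  rw [e, e2, Finset.sum_apply]
  have : ∀ j ∈ s, fourierCoeff (fun θ : S1 => a j * fourier (j : ℤ) θ) (k : ℤ)
      = if k = j then a j else 0 := by
    intro j _
    rw [fourierCoeff.const_mul, congrFun (fourierCoeff_fourier (T := 2 * Real.pi) (j : ℤ)) k,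
      Pi.single_apply]
    simp
  rw [Finset.sum_congr rfl this]
  simp

theorem integral_norm_sq_trig (s : Finset ℕ) (a : ℕ → ℂ) :
    ∫ θ, ‖trig s a θ‖ ^ 2 ∂dθ = ∑ k ∈ s, ‖a k‖ ^ 2 := by
  have h := integral_mul_conj_trig (integrable_of_continuous (continuous_trig s a)) s a
  have e : ∀ w : ℂ, w * conj w = ((‖w‖ ^ 2 : ℝ) : ℂ) := fun w => by
    rw [Complex.mul_conj, Complex.normSq_eq_norm_sq]
  simp only [e, integral_complex_ofReal] at h
  have h2 : ∑ k ∈ s, fourierCoeff (trig s a) k * conj (a k)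
      = ((∑ k ∈ s, ‖a k‖ ^ 2 : ℝ) : ℂ) := by
    rw [Complex.ofReal_sum]
    refine Finset.sum_congr rfl fun k hk => ?_
    rw [fourierCoeff_trig, if_pos hk, e]
  rw [h2] at h
  exact_mod_cast h

theorem sum_one_div_succ_le (n : ℕ) : ∑ i ∈ Finset.range n, 1 / (1 + (i : ℝ)) ≤ 2 * √n := by
  induction n with
  | zero => simp
  | succ n ih =>
    rw [Finset.sum_range_succ]
    have h1 : 0 ≤ √(n : ℝ) := Real.sqrt_nonneg _
    have h2 : 0 < √((n + 1 : ℕ) : ℝ) := Real.sqrt_pos.mpr (by positivity)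
    have h3 := Real.sq_sqrt (show (0 : ℝ) ≤ n by positivity)
    have h4 := Real.sq_sqrt (show (0 : ℝ) ≤ ((n + 1 : ℕ) : ℝ) by positivity)
    have h5 : √(n : ℝ) ≤ √((n + 1 : ℕ) : ℝ) := Real.sqrt_le_sqrt (by push_cast; linarith)
    set x := √(n : ℝ)
    set y := √((n + 1 : ℕ) : ℝ)
    have h6 : 1 / (1 + (n : ℝ)) = 1 / y ^ 2 := by rw [h4]; push_cast; ring
    have h7 : (y - x) * (y + x) = 1 := by
      have : y ^ 2 - x ^ 2 = 1 := by rw [h3, h4]; push_cast; ring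
      linarith
    have hy1 : 1 ≤ y := by
      rw [show (1 : ℝ) = √1 by simp]
      exact Real.sqrt_le_sqrt (by push_cast; linarith [(Nat.cast_nonneg n : (0 : ℝ) ≤ n)])
    have h8 : 1 / y ^ 2 ≤ 2 * (y - x) := by
      rw [div_le_iff₀ (by positivity)]
      have : (y - x) * (y + x) ≤ (y - x) * (2 * y ^ 2) := by
        apply mul_le_mul_of_nonneg_left _ (by linarith)
        nlinarith
      linarith
    rw [h6]; linarith

/-- The pairs of elements of `s` with sum `k`. -/
def fiber (s : Finset ℕ) (k : ℕ) : Finset (ℕ × ℕ) := (s ×ˢ s).filter fun q => q.1 + q.2 = k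

theorem sum_fiber_weight_le {s : Finset ℕ} {N : ℕ} (hs : ∀ i ∈ s, N ≤ i) (k : ℕ) :
    ∑ q ∈ fiber s k, 1 / ((1 + (q.1 : ℝ)) * (1 + (q.2 : ℝ))) ≤ 4 / √(N + 1) := by
  rcases (fiber s k).eq_empty_or_nonempty with h | ⟨q₀, hq₀⟩
  · rw [h]; simp; positivity
  have hk : N ≤ k := by
    simp only [fiber, Finset.mem_filter, Finset.mem_product] at hq₀
    have := hs _ hq₀.1.1
    omega
  have hsub : fiber s k ⊆ Finset.HasAntidiagonal.antidiagonal k := by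
    intro q hq
    simp only [fiber, Finset.mem_filter, Finset.mem_product] at hq
    simpa using hq.2
  have e1 : ∑ q ∈ Finset.HasAntidiagonal.antidiagonal k, 1 / (1 + (q.1 : ℝ))
      = ∑ i ∈ Finset.range (k + 1), 1 / (1 + (i : ℝ)) :=
    Finset.Nat.sum_antidiagonal_eq_sum_range_succ (fun i _ => 1 / (1 + (i : ℝ))) k
  have e2 : ∑ q ∈ Finset.HasAntidiagonal.antidiagonal k, 1 / (1 + (q.2 : ℝ))
      = ∑ i ∈ Finset.range (k + 1), 1 / (1 + (i : ℝ)) := by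
    rw [← e1, ← Finset.Nat.sum_antidiagonal_swap]
    rfl
  have hk0 : (0 : ℝ) ≤ k := Nat.cast_nonneg k
  have hsq : 0 < √((k : ℝ) + 1) := Real.sqrt_pos.mpr (by linarith)
  calc ∑ q ∈ fiber s k, 1 / ((1 + (q.1 : ℝ)) * (1 + (q.2 : ℝ)))
      ≤ ∑ q ∈ Finset.HasAntidiagonal.antidiagonal k, 1 / ((1 + (q.1 : ℝ)) * (1 + (q.2 : ℝ))) :=
        Finset.sum_le_sum_of_subset_of_nonneg hsub fun q _ _ => by positivity
    _ = ∑ q ∈ Finset.HasAntidiagonal.antidiagonal k,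
          1 / ((k : ℝ) + 2) * (1 / (1 + (q.1 : ℝ)) + 1 / (1 + (q.2 : ℝ))) := by
        refine Finset.sum_congr rfl fun q hq => ?_
        have hq' : (q.1 : ℝ) + q.2 = k := by
          have := Finset.HasAntidiagonal.mem_antidiagonal.mp hq
          exact_mod_cast this
        have h1 : 1 + (q.1 : ℝ) ≠ 0 := by positivity
        have h2 : 1 + (q.2 : ℝ) ≠ 0 := by positivity
        have h3 : (k : ℝ) + 2 ≠ 0 := by positivity
        field_simp
        linarith
    _ = 1 / ((k : ℝ) + 2) * (2 * ∑ i ∈ Finset.range (k + 1), 1 / (1 + (i : ℝ))) := by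
        rw [← Finset.mul_sum, Finset.sum_add_distrib, e1, e2]; ring
    _ ≤ 1 / ((k : ℝ) + 2) * (2 * (2 * √((k : ℝ) + 1))) := by
        have := sum_one_div_succ_le (k + 1)
        push_cast at this
        gcongr
    _ ≤ 4 / √((k : ℝ) + 1) := by
        rw [one_div_mul_eq_div, div_le_div_iff₀ (by positivity) hsq]
        have := Real.mul_self_sqrt (show (0 : ℝ) ≤ (k : ℝ) + 1 by linarith)
        nlinarith
    _ ≤ 4 / √(N + 1) := by
        have : (N : ℝ) ≤ k := by exact_mod_cast hk
        gcongr

theorem trig_sq (s : Finset ℕ) {n : ℕ} (hs : ∀ i ∈ s, i < n) (a : ℕ → ℂ) (θ : S1) :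
    trig s a θ ^ 2 = trig (Finset.range (2 * n)) (fun k => ∑ q ∈ fiber s k, a q.1 * a q.2) θ := by
  rw [trig, sq, Finset.sum_mul_sum, ← Finset.sum_product', trig]
  rw [← Finset.sum_fiberwise_of_maps_to (t := Finset.range (2 * n)) (g := fun q => q.1 + q.2)]
  · refine Finset.sum_congr rfl fun k _ => ?_
    rw [Finset.sum_mul]
    refine Finset.sum_congr rfl fun q hq => ?_
    have : q.1 + q.2 = k := (Finset.mem_filter.mp hq).2
    rw [← this, Nat.cast_add, fourier_add]; ring
  · intro q hq
    rw [Finset.mem_product] at hq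
    have h1 := hs _ hq.1
    have h2 := hs _ hq.2
    rw [Finset.mem_range]; omega

theorem norm_sq_sum_fiber_le {s : Finset ℕ} {N : ℕ} (hs : ∀ i ∈ s, N ≤ i) (a : ℕ → ℂ) (k : ℕ) :
    ‖∑ q ∈ fiber s k, a q.1 * a q.2‖ ^ 2 ≤ 4 / √(N + 1) *
      ∑ q ∈ fiber s k, ((1 + (q.1 : ℝ)) * ‖a q.1‖ ^ 2) * ((1 + (q.2 : ℝ)) * ‖a q.2‖ ^ 2) := by
  have h1 : ‖∑ q ∈ fiber s k, a q.1 * a q.2‖ ≤ ∑ q ∈ fiber s k, ‖a q.1‖ * ‖a q.2‖ := by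
    refine (norm_sum_le _ _).trans (le_of_eq ?_)
    simp only [norm_mul]
  have h2 := Finset.sum_sq_le_sum_mul_sum_of_sq_le_mul (fiber s k)
    (r := fun q => ‖a q.1‖ * ‖a q.2‖)
    (f := fun q => 1 / ((1 + (q.1 : ℝ)) * (1 + (q.2 : ℝ))))
    (g := fun q => ((1 + (q.1 : ℝ)) * ‖a q.1‖ ^ 2) * ((1 + (q.2 : ℝ)) * ‖a q.2‖ ^ 2))
    (fun q _ => by positivity) (fun q _ => by positivity)
    (fun q _ => le_of_eq <| by
      have h1 : 1 + (q.1 : ℝ) ≠ 0 := by positivity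
      have h2 : 1 + (q.2 : ℝ) ≠ 0 := by positivity
      field_simp)
  calc ‖∑ q ∈ fiber s k, a q.1 * a q.2‖ ^ 2 ≤ (∑ q ∈ fiber s k, ‖a q.1‖ * ‖a q.2‖) ^ 2 := by
        gcongr
    _ ≤ _ := h2
    _ ≤ _ := by
        apply mul_le_mul_of_nonneg_right (sum_fiber_weight_le hs k)
        exact Finset.sum_nonneg fun q _ => by positivity

theorem integral_norm_fourth_trig_le {s : Finset ℕ} {N : ℕ} (hs : ∀ i ∈ s, N ≤ i) (a : ℕ → ℂ) :
    ∫ θ, ‖trig s a θ‖ ^ 4 ∂dθ ≤ 4 / √(N + 1) * (∑ k ∈ s, (1 + (k : ℝ)) * ‖a k‖ ^ 2) ^ 2 := by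
  obtain ⟨n, hn⟩ : ∃ n, ∀ i ∈ s, i < n := by
    obtain ⟨n, hn⟩ := s.exists_nat_subset_range
    exact ⟨n, fun i hi => Finset.mem_range.mp (hn hi)⟩
  have e : ∀ θ, ‖trig s a θ‖ ^ 4 = ‖trig (Finset.range (2 * n))
      (fun k => ∑ q ∈ fiber s k, a q.1 * a q.2) θ‖ ^ 2 := by
    intro θ
    rw [← trig_sq s hn, norm_pow]; ring
  simp only [e]
  rw [integral_norm_sq_trig]
  refine (Finset.sum_le_sum fun k _ => norm_sq_sum_fiber_le hs a k).trans ?_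
  rw [← Finset.mul_sum]
  apply mul_le_mul_of_nonneg_left _ (by positivity)
  rw [sq, Finset.sum_mul_sum, ← Finset.sum_product']
  rw [← Finset.sum_fiberwise_of_maps_to (s := s ×ˢ s) (t := Finset.range (2 * n))
    (g := fun q => q.1 + q.2)]
  · rfl
  · intro q hq
    rw [Finset.mem_product] at hq
    have h1 := hn _ hq.1
    have h2 := hn _ hq.2
    rw [Finset.mem_range]; omega

theorem norm_trig_sq_le (n : ℕ) (a : ℕ → ℂ) (θ : S1) :
    ‖trig (Finset.range n) a θ‖ ^ 2 ≤
      (1 + Real.log n) * ∑ k ∈ Finset.range n, (1 + (k : ℝ)) * ‖a k‖ ^ 2 := by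
  have h1 : ‖trig (Finset.range n) a θ‖ ≤ ∑ k ∈ Finset.range n, ‖a k‖ := by
    refine (norm_sum_le _ _).trans (le_of_eq ?_)
    simp only [norm_mul, norm_fourier_apply, mul_one]
  have h2 := Finset.sum_sq_le_sum_mul_sum_of_sq_le_mul (Finset.range n)
    (r := fun k => ‖a k‖) (f := fun k => 1 / (1 + (k : ℝ)))
    (g := fun k => (1 + (k : ℝ)) * ‖a k‖ ^ 2)
    (fun q _ => by positivity) (fun q _ => by positivity)
    (fun q _ => le_of_eq <| by
      have h1 : 1 + (q : ℝ) ≠ 0 := by positivity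
      field_simp)
  have h3 : ∑ k ∈ Finset.range n, 1 / (1 + (k : ℝ)) ≤ 1 + Real.log n := by
    have := harmonic_le_one_add_log n
    refine le_trans (le_of_eq ?_) this
    rw [harmonic]
    push_cast
    refine Finset.sum_congr rfl fun k _ => ?_
    rw [one_div, add_comm]
  calc _ ≤ (∑ k ∈ Finset.range n, ‖a k‖) ^ 2 := by gcongr
    _ ≤ _ := h2
    _ ≤ _ := mul_le_mul_of_nonneg_right h3 (Finset.sum_nonneg fun q _ => by positivity)

theorem integrable_and_integral_le_of_ae_tendsto {g : ℕ → S1 → ℝ} {h : S1 → ℝ} {K : ℝ}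
    (hg : ∀ n, Continuous (g n)) (hg0 : ∀ n θ, 0 ≤ g n θ) (hh : AEStronglyMeasurable h dθ)
    (hh0 : ∀ θ, 0 ≤ h θ) (hlim : ∀ᵐ θ ∂dθ, Tendsto (fun n => g n θ) atTop (𝓝 (h θ)))
    (hK : ∀ n, ∫ θ, g n θ ∂dθ ≤ K) : Integrable h dθ ∧ ∫ θ, h θ ∂dθ ≤ K := by
  have hK0 : 0 ≤ K := (integral_nonneg (hg0 0)).trans (hK 0)
  have h1 : ∫⁻ θ, ENNReal.ofReal (h θ) ∂dθ ≤ ENNReal.ofReal K := by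
    calc ∫⁻ θ, ENNReal.ofReal (h θ) ∂dθ
        = ∫⁻ θ, liminf (fun n => ENNReal.ofReal (g n θ)) atTop ∂dθ := by
          apply lintegral_congr_ae
          filter_upwards [hlim] with θ hθ
          exact ((ENNReal.continuous_ofReal.tendsto _).comp hθ).liminf_eq.symm
      _ ≤ liminf (fun n => ∫⁻ θ, ENNReal.ofReal (g n θ) ∂dθ) atTop :=
          lintegral_liminf_le fun n => ((hg n).measurable).ennreal_ofReal
      _ ≤ ENNReal.ofReal K := by
          apply liminf_le_of_le (by isBoundedDefault)
          intro b hb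
          obtain ⟨n, hn⟩ := hb.exists
          refine hn.trans ?_
          rw [← ofReal_integral_eq_lintegral_ofReal ((hg n).integrable_of_hasCompactSupport (HasCompactSupport.of_compactSpace _))
            (ae_of_all _ (hg0 n))]
          exact ENNReal.ofReal_le_ofReal (hK n)
  have hint : Integrable h dθ := by
    refine ⟨hh, ?_⟩
    rw [hasFiniteIntegral_iff_ofReal (ae_of_all _ hh0)]
    exact h1.trans_lt ENNReal.ofReal_lt_top
  refine ⟨hint, ?_⟩
  rw [← ofReal_integral_eq_lintegral_ofReal hint (ae_of_all _ hh0)] at h1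
  exact (ENNReal.ofReal_le_ofReal_iff hK0).mp h1

/-- The Fourier coefficients of nonnegative index. -/
def coefNat (f : L2) (k : ℕ) : ℂ := coef f k

/-- Partial sums of the Fourier series converge almost everywhere along a subsequence. -/
theorem exists_subseq_trig_tendsto {f : L2} (hf : f ∈ L2plus) :
    ∃ ns : ℕ → ℕ, StrictMono ns ∧
      ∀ᵐ θ ∂dθ, Tendsto (fun n => trig (Finset.range (ns n)) (coefNat f) θ) atTop (𝓝 (f θ)) := by
  have h1 := hasSum_fourier_series_L2 f
  have h2 : HasSum (fun k : ℕ => coefNat f k • fourierLp (T := 2 * Real.pi) 2 (k : ℤ)) f := by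
    have := (Function.Injective.hasSum_iff (Nat.cast_injective (R := ℤ)) (f := fun i : ℤ =>
      fourierCoeff (f : S1 → ℂ) i • fourierLp (T := 2 * Real.pi) 2 i) (a := f) ?_).mpr h1
    · exact this
    · intro k hk
      have hk0 : k < 0 := by
        by_contra hcon
        exact hk ⟨k.toNat, by simp; omega⟩
      have : fourierCoeff (f : S1 → ℂ) k = 0 := hf k hk0
      rw [this, zero_smul]
  have h3 := h2.tendsto_sum_nat
  have h4 := tendstoInMeasure_of_tendsto_Lp h3
  obtain ⟨ns, hns, h5⟩ := h4.exists_seq_tendsto_ae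
  refine ⟨ns, hns, ?_⟩
  have h6 : ∀ n, ((∑ k ∈ Finset.range n, coefNat f k • fourierLp (T := 2 * Real.pi) 2 (k : ℤ) : L2)
      : S1 → ℂ) =ᵐ[dθ] trig (Finset.range n) (coefNat f) := by
    intro n
    induction n with
    | zero =>
      simp only [Finset.range_zero, Finset.sum_empty]
      filter_upwards [Lp.coeFn_zero ℂ 2 (dθ)] with θ hθ
      rw [hθ]; simp [trig]
    | succ n ih =>
      rw [Finset.sum_range_succ]
      filter_upwards [ih, Lp.coeFn_add (∑ k ∈ Finset.range n, coefNat f k •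
        fourierLp (T := 2 * Real.pi) 2 (k : ℤ)) (coefNat f n • fourierLp (T := 2 * Real.pi) 2 (n : ℤ)),
        Lp.coeFn_smul (coefNat f n) (fourierLp (T := 2 * Real.pi) 2 (n : ℤ)),
        coeFn_fourierLp (T := 2 * Real.pi) 2 (n : ℤ)] with θ a1 a2 a3 a4
      rw [a2, Pi.add_apply, a1, a3, Pi.smul_apply, a4, trig, trig, Finset.sum_range_succ, smul_eq_mul]
  filter_upwards [h5, ae_all_iff.mpr h6] with θ a1 a2
  refine a1.congr fun n => a2 _

theorem sum_weight_le (f : HPlus (1 / 2)) (s : Finset ℕ) :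
    ∑ k ∈ s, (1 + (k : ℝ)) * ‖coefNat f.val k‖ ^ 2 ≤ 2 * ‖f‖ ^ 2 := by
  have hs : Summable fun k : ℤ => (1 + (k : ℝ) ^ 2) ^ (1 / 2 : ℝ) * ‖coef f.val k‖ ^ 2 := by
    have := (memℓp_gen_iff (by simp)).mp f.val_mem.2
    simp only [ENNReal.toReal_ofNat] at this
    refine this.congr fun k => ?_
    have hpos : (0 : ℝ) < 1 + (k : ℝ) ^ 2 := by positivity
    rw [weighted, norm_mul, Complex.norm_real, Real.norm_of_nonneg (by positivity),
      Real.rpow_two, mul_pow, ← Real.rpow_natCast, ← Real.rpow_mul hpos.le]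
    norm_num
  rw [HPlus.norm_eq_hsNorm, hsNorm, Real.sq_sqrt (tsum_nonneg fun k => by positivity)]
  have h1 : ∑ k ∈ s, (1 + ((k : ℤ) : ℝ) ^ 2) ^ (1 / 2 : ℝ) * ‖coef f.val k‖ ^ 2
      ≤ ∑' k : ℤ, (1 + (k : ℝ) ^ 2) ^ (1 / 2 : ℝ) * ‖coef f.val k‖ ^ 2 := by
    have := hs.sum_le_tsum (s.map Nat.castEmbedding) fun k _ => by positivity
    rw [Finset.sum_map] at this
    exact this
  refine le_trans ?_ (mul_le_mul_of_nonneg_left h1 (by norm_num))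
  rw [Finset.mul_sum]
  refine Finset.sum_le_sum fun k _ => ?_
  rw [← mul_assoc]
  apply mul_le_mul_of_nonneg_right _ (by positivity)
  rw [← Real.sqrt_eq_rpow]
  have : 1 + (k : ℝ) = √((1 + (k : ℝ)) ^ 2) := (Real.sqrt_sq (by positivity)).symm
  rw [this, show (2 : ℝ) = √4 by rw [show (4 : ℝ) = 2 ^ 2 by norm_num, Real.sqrt_sq (by norm_num)],
    ← Real.sqrt_mul (by norm_num)]
  apply Real.sqrt_le_sqrt
  push_cast
  nlinarith [sq_nonneg ((k : ℝ) - 1)]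

/-- The part of `f ∈ H^{1/2}₊` of frequencies at least `N` is small in `L⁴`. -/
theorem integral_norm_fourth_tail_le (f : HPlus (1 / 2)) (N : ℕ) :
    Integrable (fun θ => ‖f.val θ - trig (Finset.range N) (coefNat f.val) θ‖ ^ 4) dθ ∧
    ∫ θ, ‖f.val θ - trig (Finset.range N) (coefNat f.val) θ‖ ^ 4 ∂dθ
      ≤ 4 / √(N + 1) * (2 * ‖f‖ ^ 2) ^ 2 := by
  obtain ⟨ns, hns, hlim⟩ := exists_subseq_trig_tendsto f.val_mem.1
  have hge : ∀ n, N ≤ ns (n + N) := fun n => (Nat.le_add_left N n).trans (hns.id_le _)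
  refine integrable_and_integral_le_of_ae_tendsto
    (g := fun n θ => ‖trig (Finset.Ico N (ns (n + N))) (coefNat f.val) θ‖ ^ 4)
    (fun n => ((continuous_trig _ _).norm.pow 4)) (fun n θ => by positivity) ?_
    (fun θ => by positivity) ?_ ?_
  · exact (((Lp.aestronglyMeasurable f.val).sub
      (continuous_trig _ _).aestronglyMeasurable).norm.pow 4)
  · filter_upwards [hlim] with θ hθ
    have h1 : Tendsto (fun n => trig (Finset.range (ns (n + N))) (coefNat f.val) θ
        - trig (Finset.range N) (coefNat f.val) θ) atTop
        (𝓝 (f.val θ - trig (Finset.range N) (coefNat f.val) θ)) :=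
      (hθ.comp (tendsto_add_atTop_nat N)).sub_const _
    refine (h1.norm.pow 4).congr fun n => ?_
    congr 2
    rw [trig, trig, trig, Finset.sum_Ico_eq_sub _ (hge n)]
  · intro n
    refine (integral_norm_fourth_trig_le (N := N) (fun i hi => (Finset.mem_Ico.mp hi).1) _).trans ?_
    gcongr
    exact sum_weight_le f _

/-! ### Uniqueness of solutions -/

/-- The equation `i∂ₜu = Π(|u|²u) + α (u | 1)` at time `t`, mode by mode. -/
def ModeEq (α : ℝ) (u : ℝ → HPlus (1 / 2)) (t : ℝ) : Prop :=
  ∀ k : ℕ, HasDerivAt (fun τ => coef (u τ).val k)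
    (-Complex.I * (szegoProj (fun θ => (‖(u t).val θ‖ : ℂ) ^ 2 * (u t).val θ) k
      + if k = 0 then (α : ℂ) * mean (u t).val else 0)) t

theorem normSq_mul (x : ℂ) : (‖x‖ : ℂ) ^ 2 * x = x * conj x * x := by
  rw [Complex.mul_conj, Complex.normSq_eq_norm_sq]; push_cast; ring

theorem norm_cubic_add_sub_le (x r : ℂ) :
    ‖(‖x + r‖ : ℂ) ^ 2 * (x + r) - (‖x‖ : ℂ) ^ 2 * x‖ ≤ 3 * (‖x‖ + ‖r‖) ^ 2 * ‖r‖ := by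
  rw [normSq_mul, normSq_mul]
  have e : (x + r) * conj (x + r) * (x + r) - x * conj x * x
      = r * (x + (x + r)) * conj (x + r) + x ^ 2 * conj r := by
    rw [map_add]; ring
  rw [e]
  have h1 : ‖x + r‖ ≤ ‖x‖ + ‖r‖ := norm_add_le _ _
  have h2 : ‖x + (x + r)‖ ≤ 2 * (‖x‖ + ‖r‖) :=
    (norm_add_le _ _).trans (by linarith [norm_nonneg r])
  refine (norm_add_le _ _).trans ?_
  simp only [norm_mul, norm_pow, RCLike.norm_conj]
  have hx := norm_nonneg x
  have hr := norm_nonneg r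
  calc ‖r‖ * ‖x + (x + r)‖ * ‖x + r‖ + ‖x‖ ^ 2 * ‖r‖
      ≤ ‖r‖ * (2 * (‖x‖ + ‖r‖)) * (‖x‖ + ‖r‖) + (‖x‖ + ‖r‖) ^ 2 * ‖r‖ := by
        gcongr
        linarith
    _ = _ := by ring

theorem abs_im_cubic_le {v a : ℂ} {V A : ℝ} (hv : ‖v‖ ≤ V) (ha : ‖a‖ ≤ A) :
    |(((‖v + a‖ : ℂ) ^ 2 * (v + a) - (‖v‖ : ℂ) ^ 2 * v) * conj a).im|
      ≤ (V ^ 2 + 3 * V * A) * ‖a‖ ^ 2 := by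
  have haa : a * conj a = ((‖a‖ ^ 2 : ℝ) : ℂ) := by
    rw [Complex.mul_conj, Complex.normSq_eq_norm_sq]
  have hvv : v * conj v = ((‖v‖ ^ 2 : ℝ) : ℂ) := by
    rw [Complex.mul_conj, Complex.normSq_eq_norm_sq]
  have e : ((‖v + a‖ : ℂ) ^ 2 * (v + a) - (‖v‖ : ℂ) ^ 2 * v) * conj a
      = ((2 * ‖v‖ ^ 2 * ‖a‖ ^ 2 + ‖a‖ ^ 4 : ℝ) : ℂ)
        + (v ^ 2 * conj a ^ 2 + 2 * (v * conj a) * (a * conj a) + (conj v * a) * (a * conj a)) := by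
    rw [normSq_mul, normSq_mul, map_add]
    have : ((2 * ‖v‖ ^ 2 * ‖a‖ ^ 2 + ‖a‖ ^ 4 : ℝ) : ℂ)
        = 2 * (v * conj v) * (a * conj a) + (a * conj a) ^ 2 := by
      rw [haa, hvv]; push_cast; ring
    rw [this]; ring
  rw [e, Complex.add_im, Complex.ofReal_im, zero_add]
  refine (Complex.abs_im_le_norm _).trans ?_
  refine (norm_add₃_le).trans ?_
  simp only [norm_mul, norm_pow, RCLike.norm_conj, Complex.norm_ofNat]
  have h1 := norm_nonneg v
  have h2 := norm_nonneg a
  have h3 : 0 ≤ V := h1.trans hv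
  calc ‖v‖ ^ 2 * ‖a‖ ^ 2 + 2 * (‖v‖ * ‖a‖) * (‖a‖ * ‖a‖) + ‖v‖ * ‖a‖ * (‖a‖ * ‖a‖)
      ≤ V ^ 2 * ‖a‖ ^ 2 + 2 * (V * A) * (‖a‖ * ‖a‖) + V * A * (‖a‖ * ‖a‖) := by gcongr
    _ = _ := by ring

theorem cube_mul_le {x y n : ℝ} (hx : 0 ≤ x) (hy : 0 ≤ y) (hn : 0 < n) :
    x ^ 3 * y ≤ x ^ 4 / n + n ^ 3 * y ^ 4 := by
  rcases le_total (n * y) x with h | h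
  · have : x ^ 3 * y ≤ x ^ 4 / n := by
      rw [le_div_iff₀ hn]
      calc x ^ 3 * y * n = x ^ 3 * (n * y) := by ring
        _ ≤ x ^ 3 * x := by gcongr
        _ = x ^ 4 := by ring
    have h2 : 0 ≤ n ^ 3 * y ^ 4 := by positivity
    linarith
  · have : x ^ 3 * y ≤ n ^ 3 * y ^ 4 := by
      calc x ^ 3 * y ≤ (n * y) ^ 3 * y := by gcongr
        _ = n ^ 3 * y ^ 4 := by ring
    have h2 : 0 ≤ x ^ 4 / n := by positivity
    linarith

theorem pow_four_add_le {x y w : ℝ} :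
    (x + y + w) ^ 4 ≤ 27 * (x ^ 4 + y ^ 4 + w ^ 4) := by
  have h1 : (x + y + w) ^ 2 ≤ 3 * (x ^ 2 + y ^ 2 + w ^ 2) := by
    nlinarith [sq_nonneg (x - y), sq_nonneg (y - w), sq_nonneg (x - w)]
  have h2 : (x ^ 2 + y ^ 2 + w ^ 2) ^ 2 ≤ 3 * (x ^ 4 + y ^ 4 + w ^ 4) := by
    nlinarith [sq_nonneg (x ^ 2 - y ^ 2), sq_nonneg (y ^ 2 - w ^ 2), sq_nonneg (x ^ 2 - w ^ 2)]
  calc (x + y + w) ^ 4 = ((x + y + w) ^ 2) ^ 2 := by ring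
    _ ≤ (3 * (x ^ 2 + y ^ 2 + w ^ 2)) ^ 2 := by gcongr
    _ = 9 * (x ^ 2 + y ^ 2 + w ^ 2) ^ 2 := by ring
    _ ≤ _ := by linarith

theorem abs_im_cubic_pairing_le {v a r : ℂ} {V A n : ℝ} (hv : ‖v‖ ≤ V) (ha : ‖a‖ ≤ A)
    (hn : 0 < n) :
    |(((‖v + a + r‖ : ℂ) ^ 2 * (v + a + r) - (‖v‖ : ℂ) ^ 2 * v) * conj a).im|
      ≤ (V ^ 2 + 3 * V * A) * ‖a‖ ^ 2
        + 3 * (27 * (V ^ 4 + ‖a‖ ^ 4 + ‖r‖ ^ 4) / n + n ^ 3 * ‖r‖ ^ 4) := by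
  have e : ((‖v + a + r‖ : ℂ) ^ 2 * (v + a + r) - (‖v‖ : ℂ) ^ 2 * v) * conj a
      = ((‖v + a‖ : ℂ) ^ 2 * (v + a) - (‖v‖ : ℂ) ^ 2 * v) * conj a
        + ((‖v + a + r‖ : ℂ) ^ 2 * (v + a + r) - (‖v + a‖ : ℂ) ^ 2 * (v + a)) * conj a := by ring
  rw [e, Complex.add_im]
  refine (abs_add_le _ _).trans (add_le_add (abs_im_cubic_le hv ha) ?_)
  refine (Complex.abs_im_le_norm _).trans ?_
  rw [norm_mul, RCLike.norm_conj]
  have h0 := norm_nonneg a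
  have h1 := norm_nonneg r
  have hV : 0 ≤ V := (norm_nonneg v).trans hv
  have h2 : ‖v + a‖ ≤ V + ‖a‖ := (norm_add_le _ _).trans (by linarith)
  have h3 := norm_cubic_add_sub_le (v + a) r
  calc _ ≤ 3 * (‖v + a‖ + ‖r‖) ^ 2 * ‖r‖ * ‖a‖ := by gcongr
    _ ≤ 3 * (V + ‖a‖ + ‖r‖) ^ 2 * ‖r‖ * (V + ‖a‖ + ‖r‖) := by
        gcongr
        linarith
    _ = 3 * ((V + ‖a‖ + ‖r‖) ^ 3 * ‖r‖) := by ring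
    _ ≤ 3 * ((V + ‖a‖ + ‖r‖) ^ 4 / n + n ^ 3 * ‖r‖ ^ 4) := by
        gcongr
        exact cube_mul_le (by positivity) h1 hn
    _ ≤ _ := by
        gcongr
        exact pow_four_add_le

theorem integrable_norm_fourth (f : HPlus (1 / 2)) : Integrable (fun θ => ‖f.val θ‖ ^ 4) dθ := by
  have := (integral_norm_fourth_tail_le f 0).1
  simpa [trig] using this

theorem integrable_cubic (f : HPlus (1 / 2)) :
    Integrable (fun θ => (‖f.val θ‖ : ℂ) ^ 2 * f.val θ) dθ := by
  have hm : AEStronglyMeasurable (fun θ => f.val θ) dθ := Lp.aestronglyMeasurable f.val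
  refine ((integrable_const (1 : ℝ)).add (integrable_norm_fourth f)).mono' ?_ ?_
  · exact (((Complex.continuous_ofReal.comp_aestronglyMeasurable hm.norm).pow 2).mul hm)
  · refine ae_of_all _ fun θ => ?_
    simp only [norm_mul, norm_pow, Complex.norm_real, norm_norm, Pi.add_apply]
    have h0 := norm_nonneg (f.val θ)
    set x := ‖f.val θ‖
    nlinarith [sq_nonneg (x ^ 2 - x), sq_nonneg x, sq_nonneg (x - 1), sq_nonneg (x ^ 2 - 1)]

theorem HPlus.val_sub {s : ℝ} (f g : HPlus s) : (f - g).val = f.val - g.val := rfl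

theorem HPlus.val_zero {s : ℝ} : (0 : HPlus s).val = 0 := rfl

theorem coef_sub (f g : L2) (k : ℤ) : coef (f - g) k = coef f k - coef g k := by
  simp [coef_eq_repr]

/-- The nonlinear part of the energy estimate for the difference of two solutions. -/
theorem abs_im_sum_cubic_le (u v : HPlus (1 / 2)) {V R : ℝ}
    (hV : ∀ᵐ θ ∂dθ, ‖v.val θ‖ ≤ V) (hR : ‖u - v‖ ≤ R) {n : ℕ} (hn : 1 ≤ n) :
    |(∑ k ∈ Finset.range (n ^ 8),
      (szegoProj (fun θ => (‖u.val θ‖ : ℂ) ^ 2 * u.val θ) k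
        - szegoProj (fun θ => (‖v.val θ‖ : ℂ) ^ 2 * v.val θ) k)
        * conj (coefNat (u - v).val k)).im|
      ≤ (V ^ 2 + 3 * V * (√(1 + 8 * Real.log n) * (2 * R)))
          * ∑ k ∈ Finset.range (n ^ 8), ‖coefNat (u - v).val k‖ ^ 2
        + (81 * (V ^ 4 + 32 * R ^ 4) + 48 * R ^ 4) / n := by
  set w := u - v with hw
  set N := n ^ 8 with hN
  set a : S1 → ℂ := trig (Finset.range N) (coefNat w.val) with ha
  set r : S1 → ℂ := fun θ => w.val θ - a θ with hr
  have hR0 : 0 ≤ R := (norm_nonneg _).trans hR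
  have hn0 : (0 : ℝ) < n := by exact_mod_cast hn
  have hlog : 0 ≤ Real.log n := Real.log_nonneg (by exact_mod_cast hn)
  have hA : ∀ θ, ‖a θ‖ ≤ √(1 + 8 * Real.log n) * (2 * R) := by
    intro θ
    have h1 := norm_trig_sq_le N (coefNat w.val) θ
    have h2 := sum_weight_le w (Finset.range N)
    have h3 : Real.log (N : ℝ) = 8 * Real.log n := by rw [hN]; push_cast; rw [Real.log_pow]; norm_num
    rw [h3] at h1
    refine abs_le_of_sq_le_sq' ?_ (by positivity) |>.2
    rw [mul_pow, Real.sq_sqrt (by positivity)]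
    refine h1.trans ?_
    apply mul_le_mul_of_nonneg_left _ (by positivity)
    nlinarith [norm_nonneg w]
  have hGi : Integrable (fun θ => (‖u.val θ‖ : ℂ) ^ 2 * u.val θ - (‖v.val θ‖ : ℂ) ^ 2 * v.val θ) dθ :=
    (integrable_cubic u).sub (integrable_cubic v)
  have hcont : Continuous a := continuous_trig _ _
  have e1 := integral_mul_conj_trig hGi (Finset.range N) (coefNat w.val)
  have e2 : ∀ k : ℤ, fourierCoeff (fun θ => (‖u.val θ‖ : ℂ) ^ 2 * u.val θ
      - (‖v.val θ‖ : ℂ) ^ 2 * v.val θ) k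
      = fourierCoeff (fun θ => (‖u.val θ‖ : ℂ) ^ 2 * u.val θ) k
        - fourierCoeff (fun θ => (‖v.val θ‖ : ℂ) ^ 2 * v.val θ) k := by
    intro k
    simp only [fourierCoeff, smul_sub]
    exact integral_sub ((integrable_cubic u).fourier_smul _) ((integrable_cubic v).fourier_smul _)
  simp only [e2] at e1
  simp only [szegoProj]
  rw [← e1]
  have hint : Integrable (fun θ => ((‖u.val θ‖ : ℂ) ^ 2 * u.val θ
      - (‖v.val θ‖ : ℂ) ^ 2 * v.val θ) * conj (a θ)) dθ := by
    refine hGi.mul_bdd (c := √(1 + 8 * Real.log n) * (2 * R)) ?_ ?_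
    · exact (Complex.continuous_conj.comp hcont).aestronglyMeasurable
    · exact ae_of_all _ fun θ => by rw [RCLike.norm_conj]; exact hA θ
  have hr4 := integral_norm_fourth_tail_le w N
  have ha4 := integral_norm_fourth_trig_le (s := Finset.range N) (N := 0) (fun i _ => Nat.zero_le i)
    (coefNat w.val)
  have hS := sum_weight_le w (Finset.range N)
  have hS2 : (2 * ‖w‖ ^ 2) ^ 2 ≤ 4 * R ^ 4 := by
    calc (2 * ‖w‖ ^ 2) ^ 2 ≤ (2 * R ^ 2) ^ 2 := by gcongr
      _ = 4 * R ^ 4 := by ring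
  have ha4' : ∫ θ, ‖a θ‖ ^ 4 ∂dθ ≤ 16 * R ^ 4 := by
    refine ha4.trans ?_
    have : (∑ k ∈ Finset.range N, (1 + (k : ℝ)) * ‖coefNat w.val k‖ ^ 2) ^ 2 ≤ 4 * R ^ 4 := by
      refine le_trans ?_ hS2
      gcongr
    norm_num
    linarith
  have hr4' : ∫ θ, ‖r θ‖ ^ 4 ∂dθ ≤ 16 * R ^ 4 / n ^ 4 := by
    refine hr4.2.trans ?_
    have h1 : (n : ℝ) ^ 4 ≤ √((N : ℝ) + 1) := by
      apply Real.le_sqrt_of_sq_le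
      rw [hN]; push_cast
      nlinarith
    calc 4 / √((N : ℝ) + 1) * (2 * ‖w‖ ^ 2) ^ 2 ≤ 4 / (n : ℝ) ^ 4 * (4 * R ^ 4) := by gcongr
      _ = _ := by ring
  have hr4'' : ∫ θ, ‖r θ‖ ^ 4 ∂dθ ≤ 16 * R ^ 4 := by
    refine hr4'.trans (div_le_self (by positivity) ?_)
    exact one_le_pow₀ (by exact_mod_cast hn)
  rw [← integral_norm_sq_trig, show (∫ θ, ((‖u.val θ‖ : ℂ) ^ 2 * u.val θ
    - (‖v.val θ‖ : ℂ) ^ 2 * v.val θ) * conj (a θ) ∂dθ).im = ∫ θ, (((‖u.val θ‖ : ℂ) ^ 2 * u.val θ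
    - (‖v.val θ‖ : ℂ) ^ 2 * v.val θ) * conj (a θ)).im ∂dθ from (integral_im hint).symm]
  have i1 : Integrable (fun θ => ‖a θ‖ ^ 2) dθ :=
    (hcont.norm.pow 2).integrable_of_hasCompactSupport (HasCompactSupport.of_compactSpace _)
  have i2 : Integrable (fun θ => ‖a θ‖ ^ 4) dθ :=
    (hcont.norm.pow 4).integrable_of_hasCompactSupport (HasCompactSupport.of_compactSpace _)
  have i3 : Integrable (fun θ => ‖r θ‖ ^ 4) dθ := hr4.1
  set K := V ^ 2 + 3 * V * (√(1 + 8 * Real.log n) * (2 * R)) with hK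
  have j0 : Integrable (fun θ => V ^ 4 + ‖a θ‖ ^ 4) dθ := (integrable_const _).add i2
  have j1 : Integrable (fun θ => V ^ 4 + ‖a θ‖ ^ 4 + ‖r θ‖ ^ 4) dθ := j0.add i3
  have j2 : Integrable (fun θ => 27 * (V ^ 4 + ‖a θ‖ ^ 4 + ‖r θ‖ ^ 4) / (n : ℝ)) dθ :=
    (j1.const_mul 27).div_const _
  have j3 : Integrable (fun θ => (n : ℝ) ^ 3 * ‖r θ‖ ^ 4) dθ := i3.const_mul _
  have j4 : Integrable (fun θ => 3 * (27 * (V ^ 4 + ‖a θ‖ ^ 4 + ‖r θ‖ ^ 4) / (n : ℝ)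
      + (n : ℝ) ^ 3 * ‖r θ‖ ^ 4)) dθ := (j2.add j3).const_mul 3
  calc |∫ θ, (((‖u.val θ‖ : ℂ) ^ 2 * u.val θ - (‖v.val θ‖ : ℂ) ^ 2 * v.val θ) * conj (a θ)).im ∂dθ|
      ≤ ∫ θ, |(((‖u.val θ‖ : ℂ) ^ 2 * u.val θ
        - (‖v.val θ‖ : ℂ) ^ 2 * v.val θ) * conj (a θ)).im| ∂dθ := abs_integral_le_integral_abs
    _ ≤ ∫ θ, (K * ‖a θ‖ ^ 2 + 3 * (27 * (V ^ 4 + ‖a θ‖ ^ 4 + ‖r θ‖ ^ 4) / (n : ℝ)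
          + (n : ℝ) ^ 3 * ‖r θ‖ ^ 4)) ∂dθ := by
        refine integral_mono_ae hint.im.abs ((i1.const_mul K).add j4) ?_
        filter_upwards [hV, Lp.coeFn_sub u.val v.val] with θ h1 h2
        have h3 : u.val θ = v.val θ + a θ + r θ := by
          have : w.val θ = u.val θ - v.val θ := by
            rw [hw, HPlus.val_sub, h2, Pi.sub_apply]
          rw [hr]; simp only [this]; ring
        rw [h3]
        exact abs_im_cubic_pairing_le h1 (hA θ) hn0
    _ = K * ∫ θ, ‖a θ‖ ^ 2 ∂dθ + 3 * (27 * (V ^ 4 + ∫ θ, ‖a θ‖ ^ 4 ∂dθ + ∫ θ, ‖r θ‖ ^ 4 ∂dθ) / n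
          + (n : ℝ) ^ 3 * ∫ θ, ‖r θ‖ ^ 4 ∂dθ) := by
        rw [integral_add (i1.const_mul K) j4, integral_const_mul, integral_const_mul,
          integral_add j2 j3, integral_div, integral_const_mul, integral_const_mul,
          integral_add j0 i3, integral_add (integrable_const _) i2]
        simp
    _ ≤ K * ∫ θ, ‖a θ‖ ^ 2 ∂dθ + 3 * (27 * (V ^ 4 + 16 * R ^ 4 + 16 * R ^ 4) / n
          + (n : ℝ) ^ 3 * (16 * R ^ 4 / n ^ 4)) := by gcongr
    _ = _ := by
        field_simp
        ring

theorem le_exp_of_abs_deriv_le {f f' : ℝ → ℝ} {t₀ δ K ε : ℝ} (hK : 1 ≤ K) (hε : 0 ≤ ε)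
    (h0 : f t₀ = 0) (hf : ∀ t ∈ Set.Icc (t₀ - δ) (t₀ + δ), HasDerivAt f (f' t) t)
    (hb : ∀ t ∈ Set.Icc (t₀ - δ) (t₀ + δ), |f' t| ≤ K * |f t| + ε) :
    ∀ t ∈ Set.Icc (t₀ - δ) (t₀ + δ), |f t| ≤ ε * Real.exp (K * δ) := by
  have hg : ∀ s ∈ Set.Icc 0 δ, gronwallBound 0 K ε s ≤ ε * Real.exp (K * δ) := by
    intro s hs
    rw [gronwallBound_of_K_ne_0 (by linarith)]
    have h1 : ε / K ≤ ε := div_le_self hε hK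
    have h2 : 0 ≤ Real.exp (K * s) - 1 := by
      have := Real.add_one_le_exp (K * s)
      nlinarith [hs.1]
    have h3 : Real.exp (K * s) ≤ Real.exp (K * δ) :=
      Real.exp_le_exp.mpr (mul_le_mul_of_nonneg_left hs.2 (by linarith))
    calc 0 * Real.exp (K * s) + ε / K * (Real.exp (K * s) - 1) = ε / K * (Real.exp (K * s) - 1) := by
          ring
      _ ≤ ε * (Real.exp (K * s) - 1) := by gcongr
      _ ≤ ε * Real.exp (K * δ) := by
          apply mul_le_mul_of_nonneg_left _ hε
          linarith
  intro t ht
  rcases le_total t₀ t with h | h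
  · have := norm_le_gronwallBound_of_norm_deriv_right_le (f := f) (f' := f') (δ := 0) (K := K)
      (ε := ε) (a := t₀) (b := t₀ + δ)
      (fun s hs => (hf s ⟨by linarith [hs.1, hs.2], hs.2⟩).continuousAt.continuousWithinAt)
      (fun s hs => (hf s ⟨by linarith [hs.1, hs.2], hs.2.le⟩).hasDerivWithinAt)
      (by simp [h0]) (fun s hs => hb s ⟨by linarith [hs.1, hs.2], hs.2.le⟩) t ⟨h, ht.2⟩
    exact this.trans (hg _ ⟨by linarith, by linarith [ht.2]⟩)
  · have hrefl : ∀ s ∈ Set.Icc (0 : ℝ) δ, t₀ - s ∈ Set.Icc (t₀ - δ) (t₀ + δ) := fun s hs =>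
      ⟨by linarith [hs.2], by linarith [hs.1, hs.2]⟩
    have hd : ∀ s ∈ Set.Icc (0 : ℝ) δ, HasDerivAt (fun s => f (t₀ - s)) (-f' (t₀ - s)) s := by
      intro s hs
      have h1 : HasDerivAt (fun s : ℝ => t₀ - s) (-1) s := by
        simpa using (hasDerivAt_id s).const_sub t₀
      have := (hf _ (hrefl s hs)).comp s h1
      simpa [Function.comp_def] using this
    have := norm_le_gronwallBound_of_norm_deriv_right_le (f := fun s => f (t₀ - s))
      (f' := fun s => -f' (t₀ - s)) (δ := 0) (K := K) (ε := ε) (a := 0) (b := δ)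
      (fun s hs => (hd s hs).continuousAt.continuousWithinAt)
      (fun s hs => (hd s ⟨hs.1, hs.2.le⟩).hasDerivWithinAt)
      (by simp [h0])
      (fun s hs => by
        rw [norm_neg]
        exact hb _ (hrefl s ⟨hs.1, hs.2.le⟩)) (t₀ - t) ⟨by linarith, by linarith [ht.1]⟩
    simp only [sub_sub_cancel, sub_zero] at this
    exact this.trans (hg _ ⟨by linarith, by linarith [ht.1]⟩)

theorem tendsto_gronwall_constant (c₀ c₁ D δ : ℝ) :
    Tendsto (fun n : ℕ => D / n * Real.exp ((c₀ + c₁ * √(1 + 8 * Real.log n)) * δ)) atTop (𝓝 0) := by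
  have hlog : Tendsto (fun n : ℕ => Real.log (n : ℝ)) atTop atTop :=
    Real.tendsto_log_atTop.comp tendsto_natCast_atTop_atTop
  have hE : Tendsto (fun n : ℕ => |D| * Real.exp
      ((c₀ * δ + 4 * (c₁ * δ) ^ 2 + 1 / 16) - 1 / 2 * Real.log n)) atTop (𝓝 0) := by
    have h1 : Tendsto (fun n : ℕ => (c₀ * δ + 4 * (c₁ * δ) ^ 2 + 1 / 16) - 1 / 2 * Real.log n)
        atTop atBot := by
      have := tendsto_neg_atTop_atBot.comp (hlog.const_mul_atTop (show (0 : ℝ) < 1 / 2 by norm_num))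
      exact tendsto_atBot_add_const_left _ (c₀ * δ + 4 * (c₁ * δ) ^ 2 + 1 / 16) this
    simpa using (Real.tendsto_exp_atBot.comp h1).const_mul |D|
  refine squeeze_zero_norm' ?_ hE
  filter_upwards [eventually_ge_atTop 1] with n hn
  have hn0 : (0 : ℝ) < n := by exact_mod_cast hn
  have hl : 0 ≤ Real.log n := Real.log_nonneg (by exact_mod_cast hn)
  rw [norm_mul, norm_div, Real.norm_eq_abs, Real.norm_eq_abs, Real.norm_eq_abs,
    abs_of_pos (Real.exp_pos _), abs_of_pos hn0]
  rw [div_mul_eq_mul_div, mul_div_assoc]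
  apply mul_le_mul_of_nonneg_left _ (abs_nonneg D)
  rw [div_le_iff₀ hn0]
  nth_rewrite 3 [← Real.exp_log hn0]
  rw [← Real.exp_add]
  apply Real.exp_le_exp.mpr
  have hs := Real.sq_sqrt (show (0 : ℝ) ≤ 1 + 8 * Real.log n by positivity)
  set y := √(1 + 8 * Real.log n)
  nlinarith [sq_nonneg (y / 4 - 2 * (c₁ * δ))]

theorem hasDerivAt_sum_norm_sq {α : ℝ} {u v : ℝ → HPlus (1 / 2)} {t : ℝ} (hu : ModeEq α u t)
    (hv : ModeEq α v t) (N : ℕ) :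
    HasDerivAt (fun τ => ∑ k ∈ Finset.range N, ‖coefNat (u τ - v τ).val k‖ ^ 2)
      (2 * (∑ k ∈ Finset.range N,
        (szegoProj (fun θ => (‖(u t).val θ‖ : ℂ) ^ 2 * (u t).val θ) k
          - szegoProj (fun θ => (‖(v t).val θ‖ : ℂ) ^ 2 * (v t).val θ) k)
          * conj (coefNat (u t - v t).val k)).im) t := by
  have hm : ∀ f : L2, mean f = coef f 0 := fun f => integral_eq_fourierCoeff_zero _
  rw [Complex.im_sum, Finset.mul_sum]
  apply HasDerivAt.fun_sum
  intro k _
  have h1 := (hu k).sub (hv k)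
  have h2 := h1.congr_of_eventuallyEq (f₁ := fun τ => coefNat (u τ - v τ).val k)
    (Eventually.of_forall fun τ => by
      simp only [coefNat, HPlus.val_sub, coef_sub, Pi.sub_apply])
  refine h2.norm_sq.congr_deriv ?_
  congr 1
  rw [Complex.inner]
  set w := coefNat (u t - v t).val k with hw
  set G := szegoProj (fun θ => (‖(u t).val θ‖ : ℂ) ^ 2 * (u t).val θ) k
  set H := szegoProj (fun θ => (‖(v t).val θ‖ : ℂ) ^ 2 * (v t).val θ) k
  by_cases hk : k = 0
  · simp only [if_pos hk, hm]
    have hw0 : w = coef (u t).val 0 - coef (v t).val 0 := by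
      rw [hw, hk, coefNat, HPlus.val_sub, coef_sub]; simp
    have e : -Complex.I * (G + α * coef (u t).val 0) - -Complex.I * (H + α * coef (v t).val 0)
        = -Complex.I * ((G - H) + α * w) := by rw [hw0]; ring
    rw [e]
    simp
    ring
  · simp only [if_neg hk]
    simp
    ring

/-- Two solutions that agree at one time agree, if one of them is bounded. -/
theorem eq_of_modeEq {α : ℝ} {u v : ℝ → HPlus (1 / 2)} {t₀ δ V : ℝ} (hδ : 0 ≤ δ)
    (huc : ContinuousOn u (Set.Icc (t₀ - δ) (t₀ + δ)))
    (hvc : ContinuousOn v (Set.Icc (t₀ - δ) (t₀ + δ)))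
    (hu : ∀ t ∈ Set.Icc (t₀ - δ) (t₀ + δ), ModeEq α u t)
    (hv : ∀ t ∈ Set.Icc (t₀ - δ) (t₀ + δ), ModeEq α v t)
    (hV0 : 0 ≤ V) (hV : ∀ t ∈ Set.Icc (t₀ - δ) (t₀ + δ), ∀ᵐ θ ∂dθ, ‖(v t).val θ‖ ≤ V)
    (h0 : u t₀ = v t₀) : ∀ t ∈ Set.Icc (t₀ - δ) (t₀ + δ), u t = v t := by
  obtain ⟨R, hR⟩ := isCompact_Icc.exists_bound_of_continuousOn (huc.sub hvc)
  have hR0 : 0 ≤ R := (norm_nonneg _).trans (hR t₀ ⟨by linarith, by linarith⟩)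
  intro t ht
  set D := 2 * (81 * (V ^ 4 + 32 * R ^ 4) + 48 * R ^ 4) with hD
  have hD0 : 0 ≤ D := by positivity
  have key : ∀ n : ℕ, 1 ≤ n → ∑ k ∈ Finset.range (n ^ 8), ‖coefNat (u t - v t).val k‖ ^ 2
      ≤ D / n * Real.exp (((1 + 2 * V ^ 2) + (12 * V * R) * √(1 + 8 * Real.log n)) * δ) := by
    intro n hn
    have := le_exp_of_abs_deriv_le (f := fun τ => ∑ k ∈ Finset.range (n ^ 8),
      ‖coefNat (u τ - v τ).val k‖ ^ 2) (t₀ := t₀) (δ := δ)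
      (K := (1 + 2 * V ^ 2) + (12 * V * R) * √(1 + 8 * Real.log n)) (ε := D / n)
      (by
        have : 0 ≤ (12 * V * R) * √(1 + 8 * Real.log n) := by positivity
        nlinarith [sq_nonneg V]) (by positivity)
      (by simp [h0, coefNat, HPlus.val_zero, coef_zero])
      (fun s hs => hasDerivAt_sum_norm_sq (hu s hs) (hv s hs) (n ^ 8))
      (fun s hs => by
        have h1 := abs_im_sum_cubic_le (u s) (v s) (hV s hs) (hR s hs) hn
        have h2 : 0 ≤ ∑ k ∈ Finset.range (n ^ 8), ‖coefNat (u s - v s).val k‖ ^ 2 :=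
          Finset.sum_nonneg fun _ _ => by positivity
        rw [abs_mul, abs_two, abs_of_nonneg h2]
        calc _ ≤ 2 * _ := mul_le_mul_of_nonneg_left h1 zero_le_two
          _ ≤ _ := by
            rw [hD]
            ring_nf
            linarith) t ht
    exact (le_abs_self _).trans this
  apply HPlus.val_injective
  apply coef_injective
  intro k
  rcases lt_or_ge k 0 with hk | hk
  · rw [(u t).val_mem.1 k hk, (v t).val_mem.1 k hk]
  obtain ⟨j, rfl⟩ := Int.eq_ofNat_of_zero_le hk
  have hle : ‖coefNat (u t - v t).val j‖ ^ 2 ≤ 0 := by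
    refine ge_of_tendsto (tendsto_gronwall_constant (1 + 2 * V ^ 2) (12 * V * R) D δ) ?_
    filter_upwards [eventually_ge_atTop (j + 1)] with n hn
    refine le_trans ?_ (key n (by omega))
    have hj : j ∈ Finset.range (n ^ 8) := by
      rw [Finset.mem_range]
      exact lt_of_lt_of_le (by omega) (Nat.le_self_pow (by norm_num) n)
    exact Finset.single_le_sum (f := fun k => ‖coefNat (u t - v t).val k‖ ^ 2)
      (fun _ _ => by positivity) hj
  have : coefNat (u t - v t).val j = 0 := by
    have := norm_nonneg (coefNat (u t - v t).val j)
    rw [← norm_eq_zero]; nlinarith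
  rw [coefNat, HPlus.val_sub, coef_sub] at this
  exact sub_eq_zero.mp this

/-! ### The Sobolev norms of rational functions with one pole -/

/-- The series `∑ₙ (1 + (n + 1)²)^s xⁿ`. -/
def sobolevSeries (s x : ℝ) : ℝ := ∑' n : ℕ, (1 + ((n : ℝ) + 1) ^ 2) ^ s * x ^ n

theorem sobolevSeries_term_le {s x : ℝ} (hs : 0 < s) (hx0 : 0 ≤ x) (hx1 : x < 1) (n : ℕ) :
    (1 + ((n : ℝ) + 1) ^ 2) ^ s * x ^ n
      ≤ 2 * (8 * s) ^ (2 * s) * (1 - x) ^ (-(2 * s)) * Real.exp (-((1 - x) / 2)) ^ n := by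
  set r := 1 - x with hr
  have hr0 : 0 < r := by linarith
  set m : ℝ := (n : ℝ) + 1 with hm
  have hm1 : 1 ≤ m := by rw [hm]; linarith [(Nat.cast_nonneg n : (0 : ℝ) ≤ n)]
  have h1 : (1 + m ^ 2) ^ s ≤ (2 * m) ^ (2 * s) := by
    rw [mul_comm 2 s, mul_comm s 2, Real.rpow_mul (by positivity)]
    apply Real.rpow_le_rpow (by positivity) _ hs.le
    rw [Real.rpow_two]; nlinarith
  have h2 : 2 * m ≤ 8 * s * r⁻¹ * Real.exp (m * r / (4 * s)) := by
    have h3 : m * r / (4 * s) ≤ Real.exp (m * r / (4 * s)) :=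
      (by linarith : m * r / (4 * s) ≤ m * r / (4 * s) + 1).trans (Real.add_one_le_exp _)
    calc 2 * m = 8 * s * r⁻¹ * (m * r / (4 * s)) := by field_simp; norm_num
      _ ≤ _ := by gcongr
  have h4 : (2 * m) ^ (2 * s) ≤ (8 * s) ^ (2 * s) * r ^ (-(2 * s)) * Real.exp (m * r / 2) := by
    calc (2 * m) ^ (2 * s) ≤ (8 * s * r⁻¹ * Real.exp (m * r / (4 * s))) ^ (2 * s) :=
          Real.rpow_le_rpow (by positivity) h2 (by positivity)
      _ = _ := by
          rw [Real.mul_rpow (by positivity) (by positivity),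
            Real.mul_rpow (by positivity) (by positivity), Real.inv_rpow hr0.le,
            ← Real.rpow_neg hr0.le, ← Real.exp_mul]
          congr 2
          field_simp
          norm_num
  have h5 : x ^ n ≤ Real.exp (-r) ^ n := by
    have : x ≤ Real.exp (-r) := by
      have := Real.add_one_le_exp (-r)
      linarith
    gcongr
  have h6 : Real.exp (m * r / 2) * Real.exp (-r) ^ n ≤ 2 * Real.exp (-(r / 2)) ^ n := by
    have e1 : Real.exp (m * r / 2) * Real.exp (-r) ^ n
        = Real.exp (r / 2) * Real.exp (-(r / 2)) ^ n := by
      rw [← Real.exp_nat_mul, ← Real.exp_nat_mul, ← Real.exp_add, ← Real.exp_add, hm]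
      congr 1; ring
    rw [e1]
    gcongr
    have h7 : Real.exp (r / 2) ≤ Real.exp (1 / 2) := Real.exp_le_exp.mpr (by linarith)
    have h8 : Real.exp (1 / 2) ^ 2 = Real.exp 1 := by rw [← Real.exp_nat_mul]; norm_num
    have h9 := Real.exp_one_lt_d9
    have h10 : Real.exp (1 / 2) ≤ 2 := by
      apply le_of_sq_le_sq _ (by norm_num)
      rw [h8]; linarith
    linarith
  calc (1 + m ^ 2) ^ s * x ^ n
      ≤ ((8 * s) ^ (2 * s) * r ^ (-(2 * s)) * Real.exp (m * r / 2)) * Real.exp (-r) ^ n := by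
        gcongr
        exact h1.trans h4
    _ = (8 * s) ^ (2 * s) * r ^ (-(2 * s)) * (Real.exp (m * r / 2) * Real.exp (-r) ^ n) := by ring
    _ ≤ (8 * s) ^ (2 * s) * r ^ (-(2 * s)) * (2 * Real.exp (-(r / 2)) ^ n) := by gcongr
    _ = _ := by ring

theorem exp_neg_half_lt_one {x : ℝ} (hx1 : x < 1) : Real.exp (-((1 - x) / 2)) < 1 :=
  lt_of_lt_of_eq (Real.exp_lt_exp.mpr (show -((1 - x) / 2) < 0 by linarith)) Real.exp_zero

theorem summable_sobolevSeries {s x : ℝ} (hs : 0 < s) (hx0 : 0 ≤ x) (hx1 : x < 1) :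
    Summable fun n : ℕ => (1 + ((n : ℝ) + 1) ^ 2) ^ s * x ^ n :=
  Summable.of_nonneg_of_le (fun n => by positivity) (sobolevSeries_term_le hs hx0 hx1)
    ((summable_geometric_of_lt_one (Real.exp_pos _).le (exp_neg_half_lt_one hx1)).mul_left _)

theorem sobolevSeries_le {s x : ℝ} (hs : 0 < s) (hx0 : 0 ≤ x) (hx1 : x < 1) :
    sobolevSeries s x ≤ 8 * (8 * s) ^ (2 * s) * (1 - x) ^ (-(2 * s) - 1) := by
  have hr0 : 0 < 1 - x := by linarith
  have hg := summable_geometric_of_lt_one (Real.exp_pos (-((1 - x) / 2))).le (exp_neg_half_lt_one hx1)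
  refine ((summable_sobolevSeries hs hx0 hx1).tsum_le_tsum (sobolevSeries_term_le hs hx0 hx1)
    (hg.mul_left _)).trans ?_
  rw [tsum_mul_left, tsum_geometric_of_lt_one (Real.exp_pos _).le (exp_neg_half_lt_one hx1),
    Real.rpow_sub_one hr0.ne']
  have h1 : (1 - x) / 4 ≤ 1 - Real.exp (-((1 - x) / 2)) := by
    set y := (1 - x) / 2 with hy
    have hy0 : 0 < y := by rw [hy]; linarith
    have hy1 : y ≤ 1 := by rw [hy]; linarith
    have h2 : Real.exp (-y) ≤ 1 / (1 + y) := by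
      rw [Real.exp_neg, ← one_div]
      apply one_div_le_one_div_of_le (by linarith)
      have := Real.add_one_le_exp y
      linarith
    have h3 : 1 / (1 + y) ≤ 1 - y / 2 := by
      rw [div_le_iff₀ (by linarith)]; nlinarith
    have : (1 - x) / 4 = y / 2 := by rw [hy]; ring
    linarith
  have h4 : (1 - Real.exp (-((1 - x) / 2)))⁻¹ ≤ ((1 - x) / 4)⁻¹ :=
    inv_anti₀ (by linarith) h1
  calc _ ≤ 2 * (8 * s) ^ (2 * s) * (1 - x) ^ (-(2 * s)) * ((1 - x) / 4)⁻¹ := by gcongr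
    _ = _ := by field_simp; norm_num

theorem le_sobolevSeries {s x : ℝ} (hs : 0 < s) (hx0 : 1 / 2 ≤ x) (hx1 : x < 1) :
    Real.exp (-8) * (1 - x) ^ (-(2 * s) - 1) ≤ sobolevSeries s x := by
  set r := 1 - x with hr
  have hr0 : 0 < r := by linarith
  set n₀ := ⌈1 / r⌉₊ with hn₀
  have h1 : 1 / r ≤ n₀ := Nat.le_ceil _
  have h2 : (n₀ : ℝ) ≤ 2 / r := by
    have := Nat.ceil_lt_add_one (show 0 ≤ 1 / r by positivity)
    have h3 : 1 ≤ 1 / r := by rw [le_div_iff₀ hr0]; linarith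
    have h4 : 2 / r = 1 / r + 1 / r := by ring
    linarith
  have hx : Real.exp (-(2 * r)) ≤ x := by
    rw [Real.exp_neg]
    apply inv_le_of_inv_le₀ (by linarith)
    have h3 : x⁻¹ ≤ 2 * r + 1 := by
      rw [inv_le_comm₀ (by linarith) (by linarith), ← one_div, div_le_iff₀ (by linarith)]
      nlinarith
    exact h3.trans (Real.add_one_le_exp _)
  have hterm : ∀ n ∈ Finset.Ico n₀ (2 * n₀),
      r ^ (-(2 * s)) * Real.exp (-8) ≤ (1 + ((n : ℝ) + 1) ^ 2) ^ s * x ^ n := by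
    intro n hn
    rw [Finset.mem_Ico] at hn
    have hn1 : 1 / r ≤ n := h1.trans (by exact_mod_cast hn.1)
    have hn2 : (n : ℝ) ≤ 4 / r := by
      have : (n : ℝ) ≤ 2 * n₀ := by exact_mod_cast hn.2.le
      have h4 : 4 / r = 2 * (2 / r) := by ring
      linarith
    have e1 : r ^ (-(2 * s)) ≤ (1 + ((n : ℝ) + 1) ^ 2) ^ s := by
      have : r ^ (-(2 * s)) = ((1 / r) ^ 2) ^ s := by
        rw [Real.rpow_neg hr0.le, ← Real.inv_rpow hr0.le, Real.rpow_mul (by positivity), one_div,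
          Real.rpow_two]
      rw [this]
      apply Real.rpow_le_rpow (by positivity) _ hs.le
      have h5 : (1 / r) ^ 2 ≤ (n : ℝ) ^ 2 := by gcongr
      nlinarith [(Nat.cast_nonneg n : (0 : ℝ) ≤ n)]
    have e2 : Real.exp (-8) ≤ x ^ n := by
      calc Real.exp (-8) ≤ Real.exp (-(2 * r)) ^ n := by
            rw [← Real.exp_nat_mul]
            apply Real.exp_le_exp.mpr
            have : (n : ℝ) * r ≤ 4 := by rwa [le_div_iff₀ hr0] at hn2
            nlinarith
        _ ≤ x ^ n := by gcongr
    gcongr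
  have h3 : ∑ n ∈ Finset.Ico n₀ (2 * n₀), (1 + ((n : ℝ) + 1) ^ 2) ^ s * x ^ n
      ≤ sobolevSeries s x :=
    (summable_sobolevSeries hs (by linarith) hx1).sum_le_tsum _ fun n _ => by
      have : 0 ≤ x := by linarith
      positivity
  refine le_trans ?_ h3
  refine le_trans ?_ (Finset.card_nsmul_le_sum _ _ _ hterm)
  rw [Nat.card_Ico, nsmul_eq_mul, show 2 * n₀ - n₀ = n₀ by omega, Real.rpow_sub_one hr0.ne']
  calc Real.exp (-8) * (r ^ (-(2 * s)) / r) = 1 / r * (r ^ (-(2 * s)) * Real.exp (-8)) := by ring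
    _ ≤ _ := by gcongr

/-! ### Functions given by coordinates -/

theorem hasCoordinates_iff_ratFun {f : L2} {b c p : ℂ} :
    HasCoordinates f b c p ↔ (f : S1 → ℂ) =ᵐ[dθ] ratFun b c p := by
  have e : (fun θ => b + c * z θ / (1 - p * z θ)) = ratFun b c p := by
    funext θ; rw [ratFun, zeta, mul_div_assoc]
  rw [HasCoordinates, e]

theorem HasCoordinates.coef_eq {f : L2} {b c p : ℂ} (hp : ‖p‖ < 1) (h : HasCoordinates f b c p)
    (k : ℤ) : coef f k = ratCoef b c p k := by
  rw [coef, fourierCoeff_congr_ae (hasCoordinates_iff_ratFun.mp h), fourierCoeff_ratFun hp]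

theorem memLp_ratFun {p : ℂ} (hp : ‖p‖ < 1) (b c : ℂ) : MemLp (ratFun b c p) 2 dθ :=
  MemLp.of_bound (continuous_ratFun hp b c).aestronglyMeasurable _
    (ae_of_all _ (norm_ratFun_le hp b c))

theorem hasCoordinates_of_coef_eq {f : L2} {b c p : ℂ} (hp : ‖p‖ < 1)
    (h : ∀ k, coef f k = ratCoef b c p k) : HasCoordinates f b c p := by
  have hg := (memLp_ratFun hp b c).coeFn_toLp
  have e : f = (memLp_ratFun hp b c).toLp := by
    apply coef_injective
    intro k
    rw [h, coef, fourierCoeff_congr_ae hg, fourierCoeff_ratFun hp]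
  rw [hasCoordinates_iff_ratFun, e]
  exact hg

theorem hasSum_int_of_neg_eq_zero {g : ℤ → ℝ} {a : ℝ} (hneg : ∀ k < 0, g k = 0)
    (h : HasSum (fun n : ℕ => g ((n + 1 : ℕ) : ℤ)) a) : HasSum g (g 0 + a) := by
  have h1 : HasSum (fun n : ℕ => g (n : ℤ)) (g 0 + a) := by
    have := (hasSum_nat_add_iff' (f := fun n : ℕ => g (n : ℤ)) (g := g 0 + a) 1).mp
    apply this
    simpa using h
  refine (Function.Injective.hasSum_iff (Nat.cast_injective (R := ℤ)) (f := g) ?_).mp h1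
  intro k hk
  apply hneg
  by_contra hcon
  exact hk ⟨k.toNat, by simp; omega⟩

theorem hasSum_sobolev {f : L2} {b c p : ℂ} (hp : ‖p‖ < 1) (h : HasCoordinates f b c p) {s : ℝ}
    (hs : 0 < s) : HasSum (fun k : ℤ => (1 + (k : ℝ) ^ 2) ^ s * ‖coef f k‖ ^ 2)
      (‖b‖ ^ 2 + ‖c‖ ^ 2 * sobolevSeries s (‖p‖ ^ 2)) := by
  have hx1 : ‖p‖ ^ 2 < 1 := by nlinarith [norm_nonneg p]
  have h1 := (summable_sobolevSeries hs (sq_nonneg ‖p‖) hx1).hasSum.mul_left (‖c‖ ^ 2)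
  have h2 := hasSum_int_of_neg_eq_zero
    (g := fun k : ℤ => (1 + (k : ℝ) ^ 2) ^ s * ‖coef f k‖ ^ 2)
    (a := ‖c‖ ^ 2 * sobolevSeries s (‖p‖ ^ 2)) (fun k hk => by
      simp only [h.coef_eq hp, ratCoef_neg _ _ _ hk]; simp) (by
      refine h1.congr_fun fun n => ?_
      rw [h.coef_eq hp, ratCoef_succ, norm_mul, norm_pow]
      push_cast
      ring)
  simpa [h.coef_eq hp, ratCoef_zero] using h2

theorem HasCoordinates.hsNorm_sq {f : L2} {b c p : ℂ} (hp : ‖p‖ < 1) (h : HasCoordinates f b c p)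
    {s : ℝ} (hs : 0 < s) :
    hsNorm s f ^ 2 = ‖b‖ ^ 2 + ‖c‖ ^ 2 * sobolevSeries s (‖p‖ ^ 2) := by
  rw [hsNorm, Real.sq_sqrt (tsum_nonneg fun k => by positivity), (hasSum_sobolev hp h hs).tsum_eq]

theorem HasCoordinates.memHs {f : L2} {b c p : ℂ} (hp : ‖p‖ < 1) (h : HasCoordinates f b c p)
    {s : ℝ} (hs : 0 < s) : MemHs s f := by
  rw [MemHs, memℓp_gen_iff (by simp)]
  simp only [ENNReal.toReal_ofNat]
  refine (hasSum_sobolev hp h hs).summable.congr fun k => ?_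
  have hpos : (0 : ℝ) < 1 + (k : ℝ) ^ 2 := by positivity
  have e : ((1 + (k : ℝ) ^ 2) ^ (s / 2)) ^ 2 = (1 + (k : ℝ) ^ 2) ^ s := by
    rw [← Real.rpow_two, ← Real.rpow_mul hpos.le, div_mul_cancel₀ _ two_ne_zero]
  rw [weighted, norm_mul, Complex.norm_real, Real.norm_of_nonneg (by positivity),
    Real.rpow_two, mul_pow, e]

theorem mul_conj_eq (w : ℂ) : w * conj w = ((‖w‖ ^ 2 : ℝ) : ℂ) := by
  rw [Complex.mul_conj, Complex.normSq_eq_norm_sq]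

theorem HasCoordinates.mass_eq {f : L2} {b c p : ℂ} (hp : ‖p‖ < 1) (h : HasCoordinates f b c p) :
    mass f = ‖b‖ ^ 2 + ‖c‖ ^ 2 / (1 - ‖p‖ ^ 2) := by
  have h1 := integral_sq_ratFun hp b c
  simp only [mul_conj_eq, integral_complex_ofReal] at h1
  have h2 : mass f = ∫ θ, ‖ratFun b c p θ‖ ^ 2 ∂dθ := by
    apply integral_congr_ae
    filter_upwards [hasCoordinates_iff_ratFun.mp h] with θ hθ
    rw [hθ]
  rw [h2]
  exact_mod_cast h1

theorem HasCoordinates.mean_eq {f : L2} {b c p : ℂ} (hp : ‖p‖ < 1) (h : HasCoordinates f b c p) :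
    mean f = b := by
  rw [mean, integral_eq_fourierCoeff_zero]
  exact (h.coef_eq hp 0).trans (ratCoef_zero b c p)

theorem HasCoordinates.momentum_eq {f : L2} {b c p : ℂ} (hp : ‖p‖ < 1)
    (h : HasCoordinates f b c p) : momentum f = ‖c‖ ^ 2 / (1 - ‖p‖ ^ 2) ^ 2 := by
  have hx : ‖(‖p‖ ^ 2 : ℝ)‖ < 1 := by
    rw [Real.norm_of_nonneg (by positivity)]; nlinarith [norm_nonneg p]
  have h0 : (1 - ‖p‖ ^ 2) ≠ 0 := by
    rw [Real.norm_of_nonneg (by positivity)] at hx; linarith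
  have h1 := (hasSum_coe_mul_geometric_of_norm_lt_one hx).add (hasSum_geometric_of_norm_lt_one hx)
  have h2 := hasSum_int_of_neg_eq_zero
    (g := fun k : ℤ => (k : ℝ) * ‖coef f k‖ ^ 2) (fun k hk => by
      simp only [h.coef_eq hp, ratCoef_neg _ _ _ hk]; simp)
    (HasSum.congr_fun (h1.mul_left (‖c‖ ^ 2)) fun n => by
      rw [h.coef_eq hp, ratCoef_succ, norm_mul, norm_pow]
      push_cast
      ring)
  rw [momentum, h2.tsum_eq]
  simp only [Int.cast_zero, zero_mul, zero_add]
  field_simp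
  ring

theorem HasCoordinates.energy_eq {f : L2} {b c p : ℂ} (hp : ‖p‖ < 1)
    (h : HasCoordinates f b c p) (α : ℝ) :
    energy α f = 1 / 4 * ((‖b‖ ^ 2 + ‖c‖ ^ 2 / (1 - ‖p‖ ^ 2)) ^ 2
      + 2 * (‖c‖ ^ 2 / (1 - ‖p‖ ^ 2)) * ‖poleVal b c p‖ ^ 2) + 1 / 2 * α * ‖b‖ ^ 2 := by
  have h1 := integral_fourth_ratFun hp b c
  simp only [mul_conj_eq] at h1
  norm_cast at h1
  have h2 : ∫ θ, ‖f θ‖ ^ 4 ∂dθ = ∫ θ, (‖ratFun b c p θ‖ ^ 2) ^ 2 ∂dθ := by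
    apply integral_congr_ae
    filter_upwards [hasCoordinates_iff_ratFun.mp h] with θ hθ
    rw [hθ]; ring
  rw [energy, h2, h1, h.mean_eq hp]

theorem HasCoordinates.szegoProj_cubic {f : L2} {b c p : ℂ} (hp : ‖p‖ < 1)
    (h : HasCoordinates f b c p) (k : ℕ) :
    szegoProj (fun θ => (‖f θ‖ : ℂ) ^ 2 * f θ) k =
      (if k = 0 then b * conj b * b + c * conj c / (1 - p * conj p) * (b + poleVal b c p) else 0)
        + (2 * (b * conj b) * c + c * conj c / (1 - p * conj p) * (c + p * (b + poleVal b c p)))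
          * fourierCoeff (zeta p) k
        + c * (conj b * c + c * conj c / (1 - p * conj p) * p)
          * fourierCoeff (fun θ => zeta p θ ^ 2) k := by
  have e : (fun θ => (‖f θ‖ : ℂ) ^ 2 * f θ) =ᵐ[dθ]
      fun θ => (‖ratFun b c p θ‖ : ℂ) ^ 2 * ratFun b c p θ := by
    filter_upwards [hasCoordinates_iff_ratFun.mp h] with θ hθ
    rw [hθ]
  rw [szegoProj, fourierCoeff_congr_ae e, fourierCoeff_cubic_ratFun hp b c (by omega)]
  simp only [Nat.cast_eq_zero]

/-- The element of `H^s₊` given by an element of `L²`. -/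
def HPlus.mk {s : ℝ} (f : L2) (hf : f ∈ L2plus ∧ MemHs s f) : HPlus s :=
  (⟨f, hf⟩ : hsPlusSubmodule s)

theorem HPlus.val_mk {s : ℝ} (f : L2) (hf : f ∈ L2plus ∧ MemHs s f) : (HPlus.mk f hf).val = f :=
  rfl

/-- The function with coordinates `b`, `c`, `p`, as an element of `H^{1/2}₊`; it is `0` if
`|p| ≥ 1`. -/
def rat (b c p : ℂ) : HPlus (1 / 2) :=
  if hp : ‖p‖ < 1 then
    HPlus.mk (memLp_ratFun hp b c).toLp (by
      have h : HasCoordinates (memLp_ratFun hp b c).toLp b c p :=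
        hasCoordinates_iff_ratFun.mpr (memLp_ratFun hp b c).coeFn_toLp
      exact ⟨fun k hk => by rw [h.coef_eq hp, ratCoef_neg _ _ _ hk], h.memHs hp (by norm_num)⟩)
  else 0

theorem hasCoordinates_rat {p : ℂ} (hp : ‖p‖ < 1) (b c : ℂ) :
    HasCoordinates (rat b c p).val b c p := by
  rw [hasCoordinates_iff_ratFun, rat, dif_pos hp, HPlus.val_mk]
  exact (memLp_ratFun hp b c).coeFn_toLp

theorem eq_rat {f : HPlus (1 / 2)} {b c p : ℂ} (hp : ‖p‖ < 1) (h : HasCoordinates f.val b c p) :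
    f = rat b c p := by
  apply HPlus.val_injective
  apply coef_injective
  intro k
  rw [h.coef_eq hp, (hasCoordinates_rat hp b c).coef_eq hp]

/-! ### The equation in coordinates and its conserved quantities -/

/-- Time derivative of the coordinate `b`. -/
def fieldB (α : ℝ) (b c p : ℂ) : ℂ :=
  -Complex.I * (b * conj b * b + c * conj c / (1 - p * conj p) * (b + poleVal b c p) + α * b)

/-- Time derivative of the coordinate `c`. -/
def fieldC (b c p : ℂ) : ℂ :=
  -Complex.I * (2 * (b * conj b) * c
    + c * conj c / (1 - p * conj p) * (c + p * (b + poleVal b c p)))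

/-- Time derivative of the coordinate `p`. -/
def fieldP (b c p : ℂ) : ℂ :=
  -Complex.I * (conj b * c + c * conj c / (1 - p * conj p) * p)

/-- The coordinates `b`, `c`, `p` satisfy the equation at time `t`. -/
structure CoordEq (α : ℝ) (b c p : ℝ → ℂ) (t : ℝ) : Prop where
  norm_lt : ‖p t‖ < 1
  derivB : HasDerivAt b (fieldB α (b t) (c t) (p t)) t
  derivC : HasDerivAt c (fieldC (b t) (c t) (p t)) t
  derivP : HasDerivAt p (fieldP (b t) (c t) (p t)) t

theorem hasDerivAt_conj {f : ℝ → ℂ} {f' : ℂ} {t : ℝ} (h : HasDerivAt f f' t) :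
    HasDerivAt (fun τ => conj (f τ)) (conj f') t := h.star

section Conservation

variable {α : ℝ} {b c p : ℝ → ℂ} {t : ℝ}

theorem conj_poleVal (b c p : ℂ) :
    conj (poleVal b c p) = conj b + conj c * p / (1 - p * conj p) := by
  simp only [poleVal, map_add, map_mul, map_div₀, map_sub, map_one, Complex.conj_conj]
  rw [mul_comm (conj p) p]

theorem conj_fieldB (α : ℝ) (b c p : ℂ) : conj (fieldB α b c p) =
    Complex.I * (conj b * b * conj b + c * conj c / (1 - p * conj p)
      * (conj b + (conj b + conj c * p / (1 - p * conj p))) + α * conj b) := by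
  simp only [fieldB, map_add, map_mul, map_div₀, map_sub, map_one, Complex.conj_conj, map_neg,
    Complex.conj_I, neg_neg, conj_poleVal, Complex.conj_ofReal]
  rw [mul_comm (conj p) p, mul_comm (conj c) c]

theorem conj_fieldC (b c p : ℂ) : conj (fieldC b c p) =
    Complex.I * (2 * (conj b * b) * conj c + c * conj c / (1 - p * conj p)
      * (conj c + conj p * (conj b + (conj b + conj c * p / (1 - p * conj p))))) := by
  simp only [fieldC, map_add, map_mul, map_div₀, map_sub, map_one, Complex.conj_conj, map_neg,
    Complex.conj_I, neg_neg, conj_poleVal, map_ofNat]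
  rw [mul_comm (conj p) p, mul_comm (conj c) c]

theorem conj_fieldP (b c p : ℂ) : conj (fieldP b c p) =
    Complex.I * (b * conj c + c * conj c / (1 - p * conj p) * conj p) := by
  simp only [fieldP, map_add, map_mul, map_div₀, map_sub, map_one, Complex.conj_conj, map_neg,
    Complex.conj_I, neg_neg]
  rw [mul_comm (conj p) p, mul_comm (conj c) c]

theorem CoordEq.hasDerivAt_gap (h : CoordEq α b c p t) :
    HasDerivAt (fun τ => 1 - p τ * conj (p τ))
      (-(fieldP (b t) (c t) (p t) * conj (p t) + p t * conj (fieldP (b t) (c t) (p t)))) t :=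
  (h.derivP.mul (hasDerivAt_conj h.derivP)).const_sub 1

theorem CoordEq.hasDerivAt_ratio (h : CoordEq α b c p t) :
    HasDerivAt (fun τ => c τ / (1 - p τ * conj (p τ)))
      (-Complex.I * (c t / (1 - p t * conj (p t))) * (b t * conj (b t)
        + c t * conj (c t) / (1 - p t * conj (p t))
        + poleVal (b t) (c t) (p t) * conj (poleVal (b t) (c t) (p t)))) t := by
  have hr := one_sub_mul_conj_ne_zero h.norm_lt
  refine (h.derivC.div h.hasDerivAt_gap hr).congr_deriv ?_
  rw [conj_fieldP, fieldP, fieldC, conj_poleVal, poleVal]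
  field_simp
  ring

theorem CoordEq.hasDerivAt_poleVal (h : CoordEq α b c p t) :
    HasDerivAt (fun τ => poleVal (b τ) (c τ) (p τ))
      (-Complex.I * ((b t * conj (b t) + c t * conj (c t) / (1 - p t * conj (p t))
          + poleVal (b t) (c t) (p t) * conj (poleVal (b t) (c t) (p t)))
            * poleVal (b t) (c t) (p t)
        + (α - poleVal (b t) (c t) (p t) * conj (poleVal (b t) (c t) (p t))) * b t)) t := by
  have hr := one_sub_mul_conj_ne_zero h.norm_lt
  have h1 := h.derivB.add (h.hasDerivAt_ratio.mul (hasDerivAt_conj h.derivP))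
  have e : (fun τ => poleVal (b τ) (c τ) (p τ))
      = fun τ => b τ + c τ / (1 - p τ * conj (p τ)) * conj (p τ) := by
    funext τ; rw [poleVal]; ring
  rw [e]
  refine h1.congr_deriv ?_
  rw [conj_fieldP, fieldB, conj_poleVal, poleVal]
  field_simp
  ring

theorem CoordEq.hasDerivAt_momentum (h : CoordEq α b c p t) :
    HasDerivAt (fun τ => c τ / (1 - p τ * conj (p τ)) * conj (c τ / (1 - p τ * conj (p τ)))) 0 t := by
  refine (h.hasDerivAt_ratio.mul (hasDerivAt_conj h.hasDerivAt_ratio)).congr_deriv ?_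
  simp only [map_add, map_mul, map_div₀, map_sub, map_one, Complex.conj_conj, map_neg,
    Complex.conj_I, neg_neg]
  rw [mul_comm (conj (p t)) (p t)]
  ring

theorem CoordEq.hasDerivAt_mass (h : CoordEq α b c p t) :
    HasDerivAt (fun τ => b τ * conj (b τ) + c τ * conj (c τ) / (1 - p τ * conj (p τ))) 0 t := by
  have hr := one_sub_mul_conj_ne_zero h.norm_lt
  refine ((h.derivB.mul (hasDerivAt_conj h.derivB)).add
    ((h.derivC.mul (hasDerivAt_conj h.derivC)).div h.hasDerivAt_gap hr)).congr_deriv ?_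
  simp only [Pi.mul_apply]
  rw [conj_fieldP, conj_fieldC, conj_fieldB, fieldP, fieldC, fieldB, poleVal]
  field_simp
  ring

theorem CoordEq.hasDerivAt_defect (h : CoordEq α b c p t) :
    HasDerivAt (fun τ => c τ * conj (c τ) / (1 - p τ * conj (p τ))
      * (poleVal (b τ) (c τ) (p τ) * conj (poleVal (b τ) (c τ) (p τ)) - α)) 0 t := by
  have hr := one_sub_mul_conj_ne_zero h.norm_lt
  refine (((h.derivC.mul (hasDerivAt_conj h.derivC)).div h.hasDerivAt_gap hr).mul
    ((h.hasDerivAt_poleVal.mul (hasDerivAt_conj h.hasDerivAt_poleVal)).sub_const (α : ℂ))).congr_deriv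
    ?_
  simp only [map_add, map_mul, map_div₀, map_sub, map_one, Complex.conj_conj, map_neg,
    Complex.conj_I, neg_neg, Complex.conj_ofReal, Pi.mul_apply, Pi.div_apply]
  rw [mul_comm (conj (p t)) (p t), conj_fieldP, conj_fieldC, fieldP, fieldC, conj_poleVal, poleVal]
  field_simp
  ring

theorem CoordEq.hasDerivAt_slope (h : CoordEq α b c p t)
    (hU : poleVal (b t) (c t) (p t) * conj (poleVal (b t) (c t) (p t)) = α) :
    HasDerivAt (fun τ => conj (poleVal (b τ) (c τ) (p τ)) * (c τ / (1 - p τ * conj (p τ)))) 0 t := by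
  refine ((hasDerivAt_conj h.hasDerivAt_poleVal).mul h.hasDerivAt_ratio).congr_deriv ?_
  rw [hU, sub_self, zero_mul, add_zero]
  simp only [map_add, map_mul, map_div₀, map_sub, map_one, Complex.conj_conj, map_neg,
    Complex.conj_I, neg_neg, Complex.conj_ofReal]
  rw [mul_comm (conj (p t)) (p t)]
  ring

theorem CoordEq.hasDerivAt_log (h : CoordEq α b c p t) (hc : c t ≠ 0) :
    HasDerivAt (fun τ => Real.log ‖c τ‖)
      (-2 * (conj (poleVal (b t) (c t) (p t)) * (c t / (1 - p t * conj (p t))) * conj (p t)).im) t := by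
  have hr := one_sub_mul_conj_ne_zero h.norm_lt
  have h1 := h.derivC.norm_sq.log (by simpa using hc)
  have e : (fun τ => Real.log ‖c τ‖) = fun τ => 1 / 2 * Real.log (‖c τ‖ ^ 2) := by
    funext τ; rw [Real.log_pow]; push_cast; ring
  rw [e]
  refine (h1.const_mul (1 / 2)).congr_deriv ?_
  rw [Complex.inner]
  have hc2 : (‖c t‖ : ℂ) ^ 2 = c t * conj (c t) := by
    rw [mul_conj_eq]; push_cast; rfl
  have hcc : conj (c t) ≠ 0 := by simpa using hc
  have key : ((1 / 2 * (2 * (fieldC (b t) (c t) (p t) * conj (c t)).re / ‖c t‖ ^ 2) : ℝ) : ℂ)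
      = ((-2 * (conj (poleVal (b t) (c t) (p t)) * (c t / (1 - p t * conj (p t)))
        * conj (p t)).im : ℝ) : ℂ) := by
    push_cast
    rw [Complex.re_eq_add_conj, Complex.im_eq_sub_conj, hc2]
    simp only [map_mul, map_div₀, map_sub, map_one, Complex.conj_conj]
    rw [conj_fieldC, conj_poleVal, fieldC, poleVal, mul_comm (conj (p t)) (p t)]
    have hI := Complex.I_ne_zero
    field_simp
    ring_nf
    simp only [Complex.I_sq]
    ring
  exact_mod_cast key

end Conservation

/-! ### The Hankel operator in Fourier variables and the manifold `𝓛(1)` -/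

/-- Multiplication of an `L²` function by `z^k`. -/
theorem memLp_fourier_mul (h : L2) (k : ℤ) : MemLp (fun θ => fourier k θ * h θ) 2 dθ :=
  (Lp.memLp h).of_le ((map_continuous (fourier k)).aestronglyMeasurable.mul
    (Lp.aestronglyMeasurable h)) (ae_of_all _ fun θ => by rw [norm_mul, norm_fourier_apply, one_mul])

theorem coef_fourier_mul (h : L2) (k j : ℤ) :
    coef (memLp_fourier_mul h k).toLp j = coef h (j - k) := by
  rw [coef, fourierCoeff_congr_ae (memLp_fourier_mul h k).coeFn_toLp, coef]
  simp only [fourierCoeff, smul_eq_mul]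
  congr 1; funext θ
  rw [← mul_assoc, ← fourier_add]
  congr 3; ring

theorem hasSum_hankel (u : L2) (h : L2plus) (k : ℕ) :
    HasSum (fun n : ℕ => coef u ((k + n : ℕ) : ℤ) * conj (coef (h : L2) n)) (hankel u h k) := by
  have h1 := fourierBasis.hasSum_inner_mul_inner (memLp_fourier_mul (h : L2) k).toLp u
  have e1 : inner ℂ (memLp_fourier_mul (h : L2) k).toLp u = hankel u h k := by
    rw [L2.inner_def]
    change _ = fourierCoeff (fun θ => u θ * conj ((h : L2) θ)) k
    rw [fourierCoeff]
    apply integral_congr_ae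
    filter_upwards [(memLp_fourier_mul (h : L2) k).coeFn_toLp] with θ hθ
    rw [hθ, RCLike.inner_apply, map_mul, ← fourier_neg, smul_eq_mul]; ring
  rw [e1] at h1
  have e2 : ∀ j : ℤ, inner ℂ (memLp_fourier_mul (h : L2) k).toLp (fourierBasis j) *
      inner ℂ (fourierBasis j) u = coef u j * conj (coef (h : L2) (j - k)) := by
    intro j
    rw [← inner_conj_symm, ← HilbertBasis.repr_apply_apply, ← HilbertBasis.repr_apply_apply,
      ← coef_eq_repr, ← coef_eq_repr, coef_fourier_mul, mul_comm]
  simp only [e2] at h1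
  have h2 := (Function.Injective.hasSum_iff (g := fun n : ℕ => ((k + n : ℕ) : ℤ))
    (fun a b hab => by simpa using hab) (fun j hj => by
      have : j - k < 0 := by
        by_contra hcon
        exact hj ⟨(j - k).toNat, by push_cast; omega⟩
      rw [h.2 _ this]; simp)).mpr h1
  refine h2.congr_fun fun n => ?_
  simp

theorem shiftedHankel_apply (u : L2) (h : L2plus) (k : ℕ) :
    shiftedHankel u h k = hankel u h (k + 1) := rfl

/-- The monomial `z^n` in `L²₊`. -/
def monomialPlus (n : ℕ) : L2plus :=
  ⟨fourierBasis (n : ℤ), fun k hk => by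
    rw [coef_eq_repr, HilbertBasis.repr_self, lp.single_apply, Pi.single_eq_of_ne (by omega)]⟩

theorem coef_monomialPlus (n m : ℕ) : coef (monomialPlus n : L2) m = if m = n then 1 else 0 := by
  change coef (fourierBasis (n : ℤ)) m = _
  rw [coef_eq_repr, HilbertBasis.repr_self, lp.single_apply]
  by_cases h : m = n
  · subst h; simp
  · rw [if_neg h, Pi.single_apply, if_neg (by exact_mod_cast h)]

theorem shiftedHankel_monomialPlus (u : L2) (n k : ℕ) :
    shiftedHankel u (monomialPlus n) k = coef u ((k + n + 1 : ℕ) : ℤ) := by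
  rw [shiftedHankel_apply]
  have h1 := hasSum_hankel u (monomialPlus n) (k + 1)
  have h2 := hasSum_single (f := fun m : ℕ => coef u ((k + 1 + m : ℕ) : ℤ)
    * conj (coef (monomialPlus n : L2) m)) n (fun m hm => by
      rw [coef_monomialPlus, if_neg hm]; simp)
  rw [h1.unique h2, coef_monomialPlus, if_pos rfl, map_one, mul_one]
  congr 2; omega

theorem exists_coordinates_of_minors {f : L2} (hf : f ∈ L2plus)
    (hm : ∀ m n : ℕ, coef f ((m + 1 : ℕ) : ℤ) * coef f ((n + 1 : ℕ) : ℤ)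
      = coef f ((0 + 1 : ℕ) : ℤ) * coef f ((m + n + 1 : ℕ) : ℤ))
    (hne : ∃ n : ℕ, coef f ((n + 1 : ℕ) : ℤ) ≠ 0) :
    ∃ b c p : ℂ, c ≠ 0 ∧ ‖p‖ < 1 ∧ HasCoordinates f b c p := by
  set g : ℕ → ℂ := fun n => coef f ((n + 1 : ℕ) : ℤ) with hg
  have hm' : ∀ m n, g m * g n = g 0 * g (m + n) := hm
  have hc : g 0 ≠ 0 := by
    intro h0
    obtain ⟨n, hn⟩ := hne
    have := hm' n n
    rw [h0, zero_mul] at this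
    exact hn (mul_self_eq_zero.mp this)
  have hgeo : ∀ n, g n = g 0 * (g 1 / g 0) ^ n := by
    intro n
    induction n with
    | zero => simp
    | succ n ih =>
      have h1 := hm' n 1
      have : g (n + 1) = g n * (g 1 / g 0) := by
        field_simp
        rw [mul_comm, ← h1]
      rw [this, ih]
      ring
  have hlim : Tendsto (fun n => ‖g n‖ ^ 2) atTop (𝓝 0) := by
    have h1 := (hasSum_sq_fourierCoeff f).summable
    have h2 : Summable fun n : ℕ => ‖g n‖ ^ 2 :=
      h1.comp_injective (i := fun n : ℕ => ((n + 1 : ℕ) : ℤ)) (fun a b hab => by simpa using hab)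
    exact h2.tendsto_atTop_zero
  have hp : ‖g 1 / g 0‖ < 1 := by
    by_contra hcon
    have hcon' : 1 ≤ ‖g 1 / g 0‖ := not_lt.mp hcon
    have h1 : ∀ n, ‖g 0‖ ^ 2 ≤ ‖g n‖ ^ 2 := by
      intro n
      have : ‖g 0‖ ≤ ‖g n‖ := by
        rw [hgeo n, norm_mul, norm_pow]
        exact le_mul_of_one_le_right (norm_nonneg _) (one_le_pow₀ hcon')
      gcongr
    have h2 := ge_of_tendsto' hlim h1
    have : 0 < ‖g 0‖ := norm_pos_iff.mpr hc
    nlinarith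
  refine ⟨coef f 0, g 0, g 1 / g 0, hc, hp, hasCoordinates_of_coef_eq hp fun k => ?_⟩
  rcases lt_trichotomy k 0 with h | h | h
  · rw [ratCoef_neg _ _ _ h, hf k h]
  · rw [h, ratCoef_zero]
  · obtain ⟨n, rfl⟩ : ∃ n : ℕ, k = ((n + 1 : ℕ) : ℤ) := ⟨(k - 1).toNat, by omega⟩
    rw [ratCoef_succ]
    exact hgeo n

theorem exists_coordinates_of_mem_manifoldL {u : HPlus (1 / 2)} (hu : u ∈ manifoldL 1) :
    ∃ b c p : ℂ, c ≠ 0 ∧ ‖p‖ < 1 ∧ HasCoordinates u.val b c p := by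
  have h1 : Module.rank ℂ (LinearMap.range (shiftedHankel u.val)) = 1 := by
    have : Module.rank ℂ (LinearMap.range (shiftedHankel u.val)) = ((1 : ℕ) : Cardinal) := hu
    simpa using this
  obtain ⟨v, ⟨h₀, hv⟩, hv0, hle⟩ := (rank_submodule_eq_one_iff _).mp h1
  have hl : ∀ n, ∃ a : ℂ, ∀ k, coef u.val ((k + n + 1 : ℕ) : ℤ) = a * v k := by
    intro n
    obtain ⟨a, ha⟩ := Submodule.mem_span_singleton.mp
      (hle (LinearMap.mem_range_self (shiftedHankel u.val) (monomialPlus n)))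
    refine ⟨a, fun k => ?_⟩
    rw [← shiftedHankel_monomialPlus, ← ha]; rfl
  choose a ha using hl
  refine exists_coordinates_of_minors u.val_mem.1 (fun m n => ?_) ?_
  · have e1 := ha m 0
    have e2 := ha 0 n
    have e3 := ha 0 0
    rw [show m + n + 1 = n + m + 1 by ring, show m + 1 = 0 + m + 1 by ring, e1, e2,
      show 0 + 1 = 0 + 0 + 1 by ring, e3, ha m n]
    ring
  · by_contra hcon
    push Not at hcon
    apply hv0
    rw [← hv]
    funext k
    rw [shiftedHankel_apply]
    have h2 := hasSum_hankel u.val h₀ (k + 1)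
    have h3 : HasSum (fun n : ℕ => coef u.val ((k + 1 + n : ℕ) : ℤ) * conj (coef (h₀ : L2) n)) 0 := by
      refine hasSum_zero.congr_fun fun n => ?_
      rw [show k + 1 + n = k + n + 1 by ring, hcon (k + n), zero_mul]
    exact h2.unique h3

theorem mem_manifoldL_of_hasCoordinates {u : HPlus (1 / 2)} {b c p : ℂ} (hc : c ≠ 0)
    (hp : ‖p‖ < 1) (h : HasCoordinates u.val b c p) : u ∈ manifoldL 1 := by
  have key : Module.rank ℂ (LinearMap.range (shiftedHankel u.val)) = 1 := by
    rw [rank_submodule_eq_one_iff]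
    have hform : ∀ g : L2plus, shiftedHankel u.val g
        = (shiftedHankel u.val g 0 / c) • fun k => c * p ^ k := by
      intro g
      funext k
      have h1 : ∀ k, HasSum (fun n : ℕ => p ^ k * (c * p ^ n * conj (coef (g : L2) n)))
          (shiftedHankel u.val g k) := by
        intro k
        refine (hasSum_hankel u.val g (k + 1)).congr_fun fun n => ?_
        rw [show k + 1 + n = k + n + 1 by ring, h.coef_eq hp, ratCoef_succ]; ring
      have h0 := (h1 0).mul_left (p ^ k)
      simp only [pow_zero, one_mul] at h0
      rw [(h1 k).unique h0, Pi.smul_apply, smul_eq_mul]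
      field_simp
    refine ⟨fun k => c * p ^ k, ⟨monomialPlus 0, ?_⟩, ?_, ?_⟩
    · funext k
      rw [shiftedHankel_monomialPlus, h.coef_eq hp, add_zero, ratCoef_succ]
    · intro h0
      have := congrFun h0 0
      simp [hc] at this
    · rintro _ ⟨g, rfl⟩
      rw [hform g]
      exact Submodule.smul_mem _ _ (Submodule.mem_span_singleton_self _)
  change Module.rank ℂ (LinearMap.range (shiftedHankel u.val)) = ((1 : ℕ) : Cardinal)
  simpa using key

/-! ### Continuity in the coordinates -/

theorem norm_sq_eq_tsum (f : HPlus (1 / 2)) :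
    ‖f‖ ^ 2 = ∑' k : ℤ, (1 + (k : ℝ) ^ 2) ^ (1 / 2 : ℝ) * ‖coef f.val k‖ ^ 2 := by
  rw [HPlus.norm_eq_hsNorm, hsNorm, Real.sq_sqrt (tsum_nonneg fun k => by positivity)]

theorem norm_ratCoef_sub_le {b c p b₀ c₀ p₀ : ℂ} {D ρ : ℝ} (hb : ‖b - b₀‖ ≤ D) (hc : ‖c‖ ≤ D)
    (hc₀ : ‖c₀‖ ≤ D) (hp : ‖p‖ ≤ ρ) (hp₀ : ‖p₀‖ ≤ ρ) (k : ℤ) :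
    ‖ratCoef b c p k - ratCoef b₀ c₀ p₀ k‖ ≤ ‖ratCoef D (2 * D : ℝ) ρ k‖ := by
  have hD : 0 ≤ D := (norm_nonneg _).trans hc
  have hρ : 0 ≤ ρ := (norm_nonneg _).trans hp
  rcases lt_trichotomy k 0 with h | h | h
  · rw [ratCoef_neg _ _ _ h, ratCoef_neg _ _ _ h, ratCoef_neg _ _ _ h]; simp
  · rw [h, ratCoef_zero, ratCoef_zero, ratCoef_zero, Complex.norm_real, Real.norm_of_nonneg hD]
    exact hb
  · obtain ⟨n, rfl⟩ : ∃ n : ℕ, k = ((n + 1 : ℕ) : ℤ) := ⟨(k - 1).toNat, by omega⟩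
    rw [ratCoef_succ, ratCoef_succ, ratCoef_succ, norm_mul, norm_pow, Complex.norm_real,
      Complex.norm_real, Real.norm_of_nonneg hρ, Real.norm_of_nonneg (by positivity)]
    refine (norm_sub_le _ _).trans ?_
    rw [norm_mul, norm_mul, norm_pow, norm_pow]
    calc ‖c‖ * ‖p‖ ^ n + ‖c₀‖ * ‖p₀‖ ^ n ≤ D * ρ ^ n + D * ρ ^ n := by gcongr
      _ = _ := by ring

theorem continuous_ratCoef (k : ℤ) :
    Continuous fun q : ℂ × ℂ × ℂ => ratCoef q.1 q.2.1 q.2.2 k := by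
  unfold ratCoef
  split_ifs <;> fun_prop

theorem continuousAt_rat {q₀ : ℂ × ℂ × ℂ} (h₀ : ‖q₀.2.2‖ < 1) :
    ContinuousAt (fun q : ℂ × ℂ × ℂ => rat q.1 q.2.1 q.2.2) q₀ := by
  obtain ⟨ρ, hρ0, hρ1⟩ := exists_between h₀
  set D := ‖q₀.2.1‖ + 1 with hD
  have hD1 : 1 ≤ D := by rw [hD]; linarith [norm_nonneg q₀.2.1]
  have e1 : ∀ᶠ q : ℂ × ℂ × ℂ in 𝓝 q₀, ‖q.2.2‖ < ρ :=
    (continuous_snd.snd.norm.tendsto q₀).eventually_lt_const hρ0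
  have e2 : ∀ᶠ q : ℂ × ℂ × ℂ in 𝓝 q₀, ‖q.2.1‖ < D :=
    (continuous_snd.fst.norm.tendsto q₀).eventually_lt_const (by rw [hD]; linarith)
  have e3 : ∀ᶠ q : ℂ × ℂ × ℂ in 𝓝 q₀, ‖q.1 - q₀.1‖ < D := by
    have : Continuous fun q : ℂ × ℂ × ℂ => ‖q.1 - q₀.1‖ := by fun_prop
    refine (this.tendsto q₀).eventually_lt_const ?_
    simp; linarith
  have hρ' : ‖(ρ : ℂ)‖ < 1 := by
    rw [Complex.norm_real, Real.norm_of_nonneg ((norm_nonneg _).trans hρ0.le)]; exact hρ1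
  have hS := (hasSum_sobolev hρ' (hasCoordinates_rat hρ' D (2 * D : ℝ))
    (show (0 : ℝ) < 1 / 2 by norm_num)).summable
  have hlim : Tendsto (fun q : ℂ × ℂ × ℂ => ∑' k : ℤ, (1 + (k : ℝ) ^ 2) ^ (1 / 2 : ℝ)
      * ‖ratCoef q.1 q.2.1 q.2.2 k - ratCoef q₀.1 q₀.2.1 q₀.2.2 k‖ ^ 2) (𝓝 q₀)
      (𝓝 (∑' k : ℤ, (1 + (k : ℝ) ^ 2) ^ (1 / 2 : ℝ) * 0)) := by
    refine tendsto_tsum_of_dominated_convergence hS (fun k => ?_) ?_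
    · have hc : Continuous fun q : ℂ × ℂ × ℂ =>
          ‖ratCoef q.1 q.2.1 q.2.2 k - ratCoef q₀.1 q₀.2.1 q₀.2.2 k‖ ^ 2 := by
        have := continuous_ratCoef k
        fun_prop
      have := hc.tendsto q₀
      simp only [sub_self, norm_zero, ne_eq, OfNat.ofNat_ne_zero, not_false_eq_true, zero_pow] at this
      exact this.const_mul _
    · filter_upwards [e1, e2, e3] with q h1 h2 h3 k
      rw [Real.norm_of_nonneg (by positivity), (hasCoordinates_rat hρ' D (2 * D : ℝ)).coef_eq hρ']
      have := norm_ratCoef_sub_le (c₀ := q₀.2.1) h3.le h2.le (by rw [hD]; linarith) h1.le hρ0.le k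
      gcongr
  simp only [mul_zero, tsum_zero] at hlim
  have hlim2 : Tendsto (fun q : ℂ × ℂ × ℂ => ‖rat q.1 q.2.1 q.2.2 - rat q₀.1 q₀.2.1 q₀.2.2‖ ^ 2)
      (𝓝 q₀) (𝓝 0) := by
    refine hlim.congr' ?_
    filter_upwards [e1] with q h1
    rw [norm_sq_eq_tsum]
    refine tsum_congr fun k => ?_
    rw [HPlus.val_sub, coef_sub, (hasCoordinates_rat (h1.trans hρ1) _ _).coef_eq (h1.trans hρ1),
      (hasCoordinates_rat h₀ _ _).coef_eq h₀]
  rw [ContinuousAt, tendsto_iff_norm_sub_tendsto_zero]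
  have := hlim2.sqrt
  simpa [Real.sqrt_sq (norm_nonneg _)] using this

/-! ### Invariance of `𝓛(1)` -/

theorem CoordEq.modeEq {α : ℝ} {v : ℝ → HPlus (1 / 2)} {b c p : ℝ → ℂ} {t : ℝ}
    (h : CoordEq α b c p t)
    (hv : ∀ᶠ τ in 𝓝 t, ‖p τ‖ < 1 ∧ HasCoordinates (v τ).val (b τ) (c τ) (p τ)) :
    ModeEq α v t := by
  obtain ⟨hp, hvt⟩ := hv.self_of_nhds
  intro k
  have e : (fun τ => coef (v τ).val k) =ᶠ[𝓝 t] fun τ => ratCoef (b τ) (c τ) (p τ) k := by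
    filter_upwards [hv] with τ hτ
    rw [hτ.2.coef_eq hτ.1]
  refine HasDerivAt.congr_of_eventuallyEq ?_ e
  rw [hvt.szegoProj_cubic hp, hvt.mean_eq hp]
  rcases k with _ | n
  · have e2 : (fun τ => ratCoef (b τ) (c τ) (p τ) ((0 : ℕ) : ℤ)) = b := by
      funext τ; exact ratCoef_zero _ _ _
    rw [e2]
    refine h.derivB.congr_deriv ?_
    rw [fourierCoeff_zeta_of_nonpos hp (by simp), fourierCoeff_zeta_sq_of_nonpos hp (by simp), fieldB]
    simp
  · have e2 : (fun τ => ratCoef (b τ) (c τ) (p τ) ((n + 1 : ℕ) : ℤ)) = fun τ => c τ * p τ ^ n := by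
      funext τ; exact ratCoef_succ _ _ _ _
    rw [e2]
    refine (h.derivC.mul (h.derivP.pow n)).congr_deriv ?_
    rw [fourierCoeff_zeta_succ hp, fourierCoeff_zeta_sq_succ hp, fieldC, fieldP]
    simp only [Nat.add_eq_zero_iff, one_ne_zero, and_false, if_false, Pi.pow_apply]
    ring

theorem ModeEq.coordEq {α : ℝ} {u : ℝ → HPlus (1 / 2)} {b c p : ℝ → ℂ} {t : ℝ}
    (h : ModeEq α u t)
    (hu : ∀ τ, c τ ≠ 0 ∧ ‖p τ‖ < 1 ∧ HasCoordinates (u τ).val (b τ) (c τ) (p τ)) :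
    CoordEq α b c p t := by
  obtain ⟨hc, hp, hut⟩ := hu t
  have hz : ∀ τ k, coef (u τ).val k = ratCoef (b τ) (c τ) (p τ) k := fun τ k =>
    (hu τ).2.2.coef_eq (hu τ).2.1 k
  have h0 := h 0
  have h1 := h 1
  have h2 := h 2
  have e0 : (fun τ => coef (u τ).val ((0 : ℕ) : ℤ)) = b := by
    funext τ; rw [hz]; exact ratCoef_zero _ _ _
  have e1 : (fun τ => coef (u τ).val ((1 : ℕ) : ℤ)) = c := by
    funext τ; rw [hz]; exact (ratCoef_succ _ _ _ 0).trans (by simp)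
  have e2 : (fun τ => coef (u τ).val ((2 : ℕ) : ℤ)) = fun τ => c τ * p τ := by
    funext τ; rw [hz]; exact (ratCoef_succ _ _ _ 1).trans (by simp)
  rw [e0, hut.szegoProj_cubic hp, hut.mean_eq hp, fourierCoeff_zeta_of_nonpos hp (by simp),
    fourierCoeff_zeta_sq_of_nonpos hp (by simp)] at h0
  rw [e1, hut.szegoProj_cubic hp, fourierCoeff_zeta_succ hp 0, fourierCoeff_zeta_sq_succ hp 0] at h1
  rw [e2, hut.szegoProj_cubic hp, fourierCoeff_zeta_succ hp 1, fourierCoeff_zeta_sq_succ hp 1] at h2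
  refine ⟨hp, h0.congr_deriv ?_, h1.congr_deriv ?_, ?_⟩
  · rw [fieldB]; simp
  · rw [fieldC]; simp
  · have e3 : p = fun τ => c τ * p τ / c τ := by
      funext τ
      rw [mul_comm, mul_div_cancel_right₀ _ (hu τ).1]
    have h3 := h2.div h1 hc
    rw [e3]
    refine h3.congr_deriv ?_
    have hr := one_sub_mul_conj_ne_zero hp
    simp only [fieldP, OfNat.ofNat_ne_zero, one_ne_zero, if_false, zero_add, pow_one, pow_zero,
      Nat.cast_one, Nat.cast_zero, mul_one, zero_mul, mul_zero, add_zero, Nat.sub_self]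
    rw [mul_comm (c t) (p t), mul_div_cancel_right₀ _ hc]
    field_simp
    ring

/-- The vector field of the equation in coordinates. -/
def field (α : ℝ) (q : ℂ × ℂ × ℂ) : ℂ × ℂ × ℂ :=
  (fieldB α q.1 q.2.1 q.2.2, fieldC q.1 q.2.1 q.2.2, fieldP q.1 q.2.1 q.2.2)

theorem contDiffAt_field (α : ℝ) {q : ℂ × ℂ × ℂ} (hq : ‖q.2.2‖ < 1) :
    ContDiffAt ℝ 1 (field α) q := by
  have hr := one_sub_mul_conj_ne_zero hq
  have hconj : ∀ {f : ℂ × ℂ × ℂ → ℂ}, ContDiffAt ℝ 1 f q →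
      ContDiffAt ℝ 1 (fun x => conj (f x)) q := fun hf =>
    (Complex.conjCLE.contDiff.contDiffAt (x := _)).comp q hf
  have hb : ContDiffAt ℝ 1 (fun x : ℂ × ℂ × ℂ => x.1) q := contDiffAt_fst
  have hc : ContDiffAt ℝ 1 (fun x : ℂ × ℂ × ℂ => x.2.1) q := contDiffAt_snd.fst
  have hp : ContDiffAt ℝ 1 (fun x : ℂ × ℂ × ℂ => x.2.2) q := contDiffAt_snd.snd
  have hgap : ContDiffAt ℝ 1 (fun x : ℂ × ℂ × ℂ => 1 - x.2.2 * conj x.2.2) q :=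
    contDiffAt_const.sub (hp.mul (hconj hp))
  have hN : ContDiffAt ℝ 1 (fun x : ℂ × ℂ × ℂ => x.2.1 * conj x.2.1 / (1 - x.2.2 * conj x.2.2)) q :=
    (hc.mul (hconj hc)).mul (hgap.inv hr)
  have hU : ContDiffAt ℝ 1 (fun x : ℂ × ℂ × ℂ => poleVal x.1 x.2.1 x.2.2) q :=
    hb.add ((hc.mul (hconj hp)).mul (hgap.inv hr))
  refine ContDiffAt.prodMk ?_ (ContDiffAt.prodMk ?_ ?_)
  · exact contDiffAt_const.mul ((((hb.mul (hconj hb)).mul hb).add (hN.mul (hb.add hU))).add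
      (contDiffAt_const.mul hb))
  · exact contDiffAt_const.mul (((contDiffAt_const.mul (hb.mul (hconj hb))).mul hc).add
      (hN.mul (hc.add (hp.mul (hb.add hU)))))
  · exact contDiffAt_const.mul (((hconj hb).mul hc).add (hN.mul hp))

theorem momentum_eq_ratio {f : L2} {b c p : ℂ} (hp : ‖p‖ < 1) (h : HasCoordinates f b c p) :
    c / (1 - p * conj p) * conj (c / (1 - p * conj p)) = (momentum f : ℂ) := by
  rw [h.momentum_eq hp, mul_conj_eq, norm_div, div_pow]
  have : ‖1 - p * conj p‖ = |1 - ‖p‖ ^ 2| := by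
    rw [mul_conj_eq, ← Complex.ofReal_one, ← Complex.ofReal_sub, Complex.norm_real,
      Real.norm_eq_abs]
  rw [this, sq_abs]

theorem exists_coordinates_near {α : ℝ} {u : ℝ → HPlus (1 / 2)} (huc : Continuous u)
    (hu : ∀ t, ModeEq α u t) {t₀ : ℝ} {b₀ c₀ p₀ : ℂ} (hc₀ : c₀ ≠ 0) (hp₀ : ‖p₀‖ < 1)
    (h₀ : HasCoordinates (u t₀).val b₀ c₀ p₀) :
    ∃ ε > 0, ∀ t ∈ Set.Ioo (t₀ - ε) (t₀ + ε), momentum (u t).val = momentum (u t₀).val ∧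
      ∃ b c p : ℂ, c ≠ 0 ∧ ‖p‖ < 1 ∧ HasCoordinates (u t).val b c p := by
  obtain ⟨q, hq0, ε, hε, hq⟩ := (contDiffAt_field α (q := (b₀, c₀, p₀)) hp₀)
    |>.exists_forall_mem_closedBall_exists_eq_forall_mem_Ioo_hasDerivAt₀ t₀
  have hqt₀ : ContinuousAt q t₀ := (hq t₀ ⟨by linarith, by linarith⟩).continuousAt
  have hev : ∀ᶠ t in 𝓝 t₀, ‖(q t).2.2‖ < 1 := by
    refine (hqt₀.snd.snd.norm).eventually_lt_const ?_
    simpa only [hq0] using hp₀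
  obtain ⟨ε', hε', hball⟩ := Metric.eventually_nhds_iff.mp hev
  set δ := min ε ε' / 2 with hδ
  have hδ0 : 0 < δ := by positivity
  have hδε : δ < ε := by have := min_le_left ε ε'; rw [hδ]; linarith
  have hδε' : δ < ε' := by have := min_le_right ε ε'; rw [hδ]; linarith
  set I := Set.Icc (t₀ - δ) (t₀ + δ) with hI
  have hder : ∀ t ∈ I, HasDerivAt q (field α (q t)) t := fun t ht =>
    hq t ⟨by linarith [ht.1], by linarith [ht.2]⟩
  have hpI : ∀ t ∈ I, ‖(q t).2.2‖ < 1 := fun t ht => hball (by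
    rw [Real.dist_eq, abs_lt]; constructor <;> linarith [ht.1, ht.2])
  have hcoord : ∀ t ∈ I, CoordEq α (fun τ => (q τ).1) (fun τ => (q τ).2.1) (fun τ => (q τ).2.2) t := by
    intro t ht
    have h1 := (hder t ht).hasFDerivAt
    refine ⟨hpI t ht, ?_, ?_, ?_⟩
    · simpa [field] using h1.fst.hasDerivAt
    · simpa [field] using h1.snd.fst.hasDerivAt
    · simpa [field] using h1.snd.snd.hasDerivAt
  set v : ℝ → HPlus (1 / 2) := fun t => rat (q t).1 (q t).2.1 (q t).2.2 with hv
  have hvc : ContinuousOn v I := fun t ht =>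
    ((continuousAt_rat (hpI t ht)).comp (hder t ht).continuousAt).continuousWithinAt
  have hvm : ∀ t ∈ I, ModeEq α v t := by
    intro t ht
    refine (hcoord t ht).modeEq ?_
    have := (hder t ht).continuousAt.snd.snd.norm.eventually_lt_const (hpI t ht)
    filter_upwards [this] with τ hτ
    exact ⟨hτ, hasCoordinates_rat hτ _ _⟩
  obtain ⟨V, hV⟩ := isCompact_Icc.exists_bound_of_continuousOn
    (f := fun t => ‖(q t).1‖ + ‖(q t).2.1‖ * (1 / (1 - ‖(q t).2.2‖))) (s := I) (by
      intro t ht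
      have hqc := (hder t ht).continuousAt
      have h1 : 1 - ‖(q t).2.2‖ ≠ 0 := by linarith [hpI t ht]
      exact (hqc.fst.norm.add (hqc.snd.fst.norm.mul
        (continuousAt_const.div (continuousAt_const.sub hqc.snd.snd.norm) h1))).continuousWithinAt)
  have ht₀ : t₀ ∈ I := ⟨by linarith, by linarith⟩
  have hV0 : 0 ≤ V := (norm_nonneg _).trans (hV t₀ ht₀)
  have heq : ∀ t ∈ I, u t = v t := by
    refine eq_of_modeEq hδ0.le huc.continuousOn hvc (fun t _ => hu t) hvm hV0 (fun t ht => ?_) ?_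
    · filter_upwards [hasCoordinates_iff_ratFun.mp (hasCoordinates_rat (hpI t ht) (q t).1 (q t).2.1)]
        with θ hθ
      rw [hθ]
      exact (norm_ratFun_le (hpI t ht) _ _ _).trans ((le_abs_self _).trans (hV t ht))
    · rw [hv]
      simp only [hq0]
      exact eq_rat hp₀ h₀
  have hcoords : ∀ t ∈ I, HasCoordinates (u t).val (q t).1 (q t).2.1 (q t).2.2 := fun t ht => by
    rw [heq t ht]; exact hasCoordinates_rat (hpI t ht) _ _
  refine ⟨δ, hδ0, fun t ht => ?_⟩
  have htI : t ∈ I := ⟨ht.1.le, ht.2.le⟩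
  have hmom : momentum (u t).val = momentum (u t₀).val := by
    have h1 : ∀ s ∈ I, HasDerivWithinAt (fun τ => (q τ).2.1 / (1 - (q τ).2.2 * conj (q τ).2.2)
        * conj ((q τ).2.1 / (1 - (q τ).2.2 * conj (q τ).2.2))) 0 I s := fun s hs =>
      (hcoord s hs).hasDerivAt_momentum.hasDerivWithinAt
    have h2 := (convex_Icc (t₀ - δ) (t₀ + δ)).norm_image_sub_le_of_norm_hasDerivWithin_le
      (C := 0) h1 (fun s _ => by simp) ht₀ htI
    rw [zero_mul, norm_le_zero_iff, sub_eq_zero, momentum_eq_ratio (hpI t htI) (hcoords t htI),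
      momentum_eq_ratio (hpI t₀ ht₀) (hcoords t₀ ht₀)] at h2
    exact_mod_cast h2
  refine ⟨hmom, _, _, _, ?_, hpI t htI, hcoords t htI⟩
  intro hc
  rw [(hcoords t htI).momentum_eq (hpI t htI), hc, h₀.momentum_eq hp₀] at hmom
  have h3 : 0 < ‖c₀‖ := norm_pos_iff.mpr hc₀
  have h4 : 0 < 1 - ‖p₀‖ ^ 2 := by nlinarith [norm_nonneg p₀]
  have h5 : 0 < ‖c₀‖ ^ 2 / (1 - ‖p₀‖ ^ 2) ^ 2 := by positivity
  rw [← hmom] at h5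
  simp at h5

/-- The distance to the functions with only the frequency `0` controls the momentum. -/
theorem momentum_le_norm_sub_sq {f g : HPlus (1 / 2)}
    {b c p : ℂ} (hp : ‖p‖ < 1) (hf : HasCoordinates f.val b c p)
    (hg : ∀ n : ℕ, coef g.val ((n + 1 : ℕ) : ℤ) = 0) : momentum f.val ≤ ‖f - g‖ ^ 2 := by
  have hs : Summable fun k : ℤ => (1 + (k : ℝ) ^ 2) ^ (1 / 2 : ℝ) * ‖coef (f - g).val k‖ ^ 2 := by
    have e : ∀ k : ℤ, coef (f - g).val k = ratCoef (b - coef g.val 0) c p k := by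
      intro k
      rw [HPlus.val_sub, coef_sub, hf.coef_eq hp]
      rcases lt_trichotomy k 0 with h | h | h
      · rw [ratCoef_neg _ _ _ h, ratCoef_neg _ _ _ h, g.val_mem.1 k h, sub_zero]
      · rw [h, ratCoef_zero, ratCoef_zero]
      · obtain ⟨n, rfl⟩ : ∃ n : ℕ, k = ((n + 1 : ℕ) : ℤ) := ⟨(k - 1).toNat, by omega⟩
        rw [ratCoef_succ, ratCoef_succ, hg, sub_zero]
    exact (hasSum_sobolev hp (hasCoordinates_of_coef_eq hp e) (by norm_num)).summable
  have hle : ∀ k : ℤ, (k : ℝ) * ‖coef f.val k‖ ^ 2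
      ≤ (1 + (k : ℝ) ^ 2) ^ (1 / 2 : ℝ) * ‖coef (f - g).val k‖ ^ 2 := by
    intro k
    have h0 : 0 ≤ (1 + (k : ℝ) ^ 2) ^ (1 / 2 : ℝ) * ‖coef (f - g).val k‖ ^ 2 := by positivity
    rcases le_or_gt k 0 with h | h
    · have : (k : ℝ) ≤ 0 := by exact_mod_cast h
      nlinarith [sq_nonneg ‖coef f.val k‖]
    · obtain ⟨n, rfl⟩ : ∃ n : ℕ, k = ((n + 1 : ℕ) : ℤ) := ⟨(k - 1).toNat, by omega⟩
      rw [HPlus.val_sub, coef_sub, hg, sub_zero]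
      gcongr
      rw [← Real.sqrt_eq_rpow]
      exact Real.le_sqrt_of_sq_le (by linarith)
  have hsm : Summable fun k : ℤ => (k : ℝ) * ‖coef f.val k‖ ^ 2 := by
    refine Summable.of_nonneg_of_le (fun k => ?_) hle hs
    rcases lt_or_ge k 0 with h | h
    · rw [f.val_mem.1 k h]; simp
    · have : (0 : ℝ) ≤ k := by exact_mod_cast h
      positivity
  rw [norm_sq_eq_tsum]
  exact hsm.tsum_le_tsum hle hs

theorem continuous_coef {α : ℝ} {u : ℝ → HPlus (1 / 2)} (hu : ∀ t, ModeEq α u t) (k : ℕ) :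
    Continuous fun t => coef (u t).val k :=
  continuous_iff_continuousAt.mpr fun t => (hu t k).continuousAt

/-- Solutions that start in `𝓛(1)` stay there. -/
theorem exists_coordinates_of_modeEq {α : ℝ} {u : ℝ → HPlus (1 / 2)} (huc : Continuous u)
    (hu : ∀ t, ModeEq α u t) (h0 : u 0 ∈ manifoldL 1) (t : ℝ) :
    ∃ b c p : ℂ, c ≠ 0 ∧ ‖p‖ < 1 ∧ HasCoordinates (u t).val b c p := by
  set A : Set ℝ := {t | momentum (u t).val = momentum (u 0).val ∧
    ∃ b c p : ℂ, c ≠ 0 ∧ ‖p‖ < 1 ∧ HasCoordinates (u t).val b c p} with hA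
  have hcoords0 := exists_coordinates_of_mem_manifoldL h0
  have hM0 : 0 < momentum (u 0).val := by
    obtain ⟨b, c, p, hc, hp, h⟩ := hcoords0
    rw [h.momentum_eq hp]
    have h3 : 0 < ‖c‖ := norm_pos_iff.mpr hc
    have h4 : 0 < 1 - ‖p‖ ^ 2 := by nlinarith [norm_nonneg p]
    positivity
  have h0A : (0 : ℝ) ∈ A := ⟨rfl, hcoords0⟩
  have hopen : IsOpen A := by
    rw [isOpen_iff_mem_nhds]
    rintro s ⟨hs, b, c, p, hc, hp, h⟩
    obtain ⟨ε, hε, hnear⟩ := exists_coordinates_near huc hu hc hp h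
    refine Filter.mem_of_superset (Ioo_mem_nhds (by linarith : s - ε < s) (by linarith : s < s + ε)) ?_
    intro τ hτ
    exact ⟨(hnear τ hτ).1.trans hs, (hnear τ hτ).2⟩
  have hclosed : IsClosed A := by
    rw [← isOpen_compl_iff, isOpen_iff_mem_nhds]
    intro s hs
    by_contra hcon
    have hfreq : ∃ᶠ τ in 𝓝 s, τ ∈ A := by
      intro h; exact hcon h
    have hmin : ∀ m n : ℕ, coef (u s).val ((m + 1 : ℕ) : ℤ) * coef (u s).val ((n + 1 : ℕ) : ℤ)
        = coef (u s).val ((0 + 1 : ℕ) : ℤ) * coef (u s).val ((m + n + 1 : ℕ) : ℤ) := by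
      intro m n
      have hcl : IsClosed {τ | coef (u τ).val ((m + 1 : ℕ) : ℤ) * coef (u τ).val ((n + 1 : ℕ) : ℤ)
          = coef (u τ).val ((0 + 1 : ℕ) : ℤ) * coef (u τ).val ((m + n + 1 : ℕ) : ℤ)} :=
        isClosed_eq ((continuous_coef hu _).mul (continuous_coef hu _))
          ((continuous_coef hu _).mul (continuous_coef hu _))
      refine hcl.mem_of_frequently_of_tendsto (hfreq.mono ?_) tendsto_id
      rintro τ ⟨-, b, c, p, hc, hp, h⟩
      simp only [id, Set.mem_ofPred_eq, h.coef_eq hp, ratCoef_succ]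
      ring
    have hne : ∃ n : ℕ, coef (u s).val ((n + 1 : ℕ) : ℤ) ≠ 0 := by
      by_contra hall
      push Not at hall
      have hlim : Tendsto (fun τ => ‖u τ - u s‖ ^ 2) (𝓝 s) (𝓝 0) := by
        have : Continuous fun τ => ‖u τ - u s‖ ^ 2 := by fun_prop
        simpa using this.tendsto s
      obtain ⟨τ, ⟨hτ, b, c, p, hc, hp, h⟩, hτ2⟩ :=
        (hfreq.and_eventually (hlim.eventually_lt_const hM0)).exists
      have := momentum_le_norm_sub_sq hp h hall
      linarith
    obtain ⟨b, c, p, hc, hp, h⟩ := exists_coordinates_of_minors (u s).val_mem.1 hmin hne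
    obtain ⟨ε, hε, hnear⟩ := exists_coordinates_near huc hu hc hp h
    obtain ⟨τ, hτA, hτ⟩ := (hfreq.and_eventually
      (Ioo_mem_nhds (by linarith : s - ε < s) (by linarith : s < s + ε))).exists
    exact hs ⟨(hnear τ hτ).1.symm.trans hτA.1, b, c, p, hc, hp, h⟩
  have huniv : A = Set.univ := IsClopen.eq_univ ⟨hclosed, hopen⟩ ⟨0, h0A⟩
  have : t ∈ A := by rw [huniv]; trivial
  exact this.2

/-! ### The equation `p' = -iβ (1 - |p|²)` -/

theorem mul_bounds_of_ratio {a x y : ℝ} (hx : |x| < a) (h : a + x = Real.exp y * (a - x)) :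
    a ^ 2 * Real.exp (-|y|) ≤ (a + x) * (a - x) ∧
      (a + x) * (a - x) ≤ 4 * a ^ 2 * Real.exp (-|y|) := by
  obtain ⟨h1, h2⟩ := abs_lt.mp hx
  have ha : 0 < a := (abs_nonneg x).trans_lt hx
  rcases le_total 0 y with hy | hy
  · have he : 1 ≤ Real.exp y := Real.one_le_exp hy
    have hx0 : 0 ≤ x := by nlinarith
    have e : a - x = Real.exp (-y) * (a + x) := by
      rw [h, ← mul_assoc, ← Real.exp_add]; simp
    rw [abs_of_nonneg hy]
    have hpos := Real.exp_pos (-y)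
    have e2 : (a + x) * (a - x) = (a + x) ^ 2 * Real.exp (-y) := by rw [e]; ring
    rw [e2]
    constructor
    · gcongr; linarith
    · gcongr; nlinarith
  · have he : Real.exp y ≤ 1 := Real.exp_le_one_iff.mpr hy
    have hx0 : x ≤ 0 := by nlinarith
    rw [abs_of_nonpos hy, neg_neg]
    have hpos := Real.exp_pos y
    have e2 : (a + x) * (a - x) = (a - x) ^ 2 * Real.exp y := by rw [h]; ring
    rw [e2]
    constructor
    · gcongr; linarith
    · gcongr; nlinarith

/-- The gap `1 - |p|²` decays at an exact exponential rate. -/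
theorem gap_bounds {p : ℝ → ℂ} {β : ℂ} (hβ : β ≠ 0) (hp : ∀ t, ‖p t‖ < 1)
    (hd : ∀ t, HasDerivAt p (-Complex.I * β * (1 - p t * conj (p t))) t) :
    0 < ‖β‖ ^ 2 - (β * conj (p 0)).re ^ 2 ∧ ∃ m₁ m₂ : ℝ, 0 < m₁ ∧ 0 < m₂ ∧ ∀ t,
      m₁ * Real.exp (-(2 * √(‖β‖ ^ 2 - (β * conj (p 0)).re ^ 2) * |t|)) ≤ 1 - ‖p t‖ ^ 2 ∧
      1 - ‖p t‖ ^ 2 ≤ m₂ * Real.exp (-(2 * √(‖β‖ ^ 2 - (β * conj (p 0)).re ^ 2) * |t|)) := by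
  set S : ℝ → ℂ := fun t => β * conj (p t) with hS
  have hω : 0 < ‖β‖ ^ 2 := by have := norm_pos_iff.mpr hβ; positivity
  have hgap : ∀ t, ‖β‖ ^ 2 * (1 - ‖p t‖ ^ 2) = ‖β‖ ^ 2 - (S t).re ^ 2 - (S t).im ^ 2 := by
    intro t
    have h1 : ‖S t‖ ^ 2 = ‖β‖ ^ 2 * ‖p t‖ ^ 2 := by
      rw [hS]; simp only [norm_mul, RCLike.norm_conj]; ring
    have h2 : ‖S t‖ ^ 2 = (S t).re ^ 2 + (S t).im ^ 2 := by
      rw [← Complex.normSq_eq_norm_sq, Complex.normSq_apply]; ring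
    linarith
  have hgap0 : ∀ t, 0 < ‖β‖ ^ 2 - (S t).re ^ 2 - (S t).im ^ 2 := by
    intro t
    rw [← hgap]
    have : 0 < 1 - ‖p t‖ ^ 2 := by nlinarith [hp t, norm_nonneg (p t)]
    positivity
  have hSd : ∀ t, HasDerivAt S (Complex.I * ((‖β‖ ^ 2 * (1 - ‖p t‖ ^ 2) : ℝ) : ℂ)) t := by
    intro t
    refine ((hasDerivAt_conj (hd t)).const_mul β).congr_deriv ?_
    simp only [map_mul, map_neg, Complex.conj_I, map_sub, map_one, Complex.conj_conj, neg_neg]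
    push_cast
    have h1 : β * conj β = (‖β‖ : ℂ) ^ 2 := by rw [mul_conj_eq]; push_cast; rfl
    have h2 : p t * conj (p t) = (‖p t‖ : ℂ) ^ 2 := by rw [mul_conj_eq]; push_cast; rfl
    rw [← h1, ← h2]; ring
  have hre : ∀ t, HasDerivAt (fun τ => (S τ).re) 0 t := by
    intro t
    have := Complex.reCLM.hasFDerivAt.comp_hasDerivAt t (hSd t)
    have e : (Complex.I * ((‖β‖ ^ 2 * (1 - ‖p t‖ ^ 2) : ℝ) : ℂ)).re = 0 := by
      rw [Complex.re_mul_ofReal]; simp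
    rw [← e]
    exact this
  have him : ∀ t, HasDerivAt (fun τ => (S τ).im) (‖β‖ ^ 2 * (1 - ‖p t‖ ^ 2)) t := by
    intro t
    have := Complex.imCLM.hasFDerivAt.comp_hasDerivAt t (hSd t)
    have e : (Complex.I * ((‖β‖ ^ 2 * (1 - ‖p t‖ ^ 2) : ℝ) : ℂ)).im = ‖β‖ ^ 2 * (1 - ‖p t‖ ^ 2) := by
      rw [Complex.im_mul_ofReal]; simp
    rw [← e]
    exact this
  set σ := (S 0).re with hσ
  have hconst : ∀ t, (S t).re = σ := fun t =>
    is_const_of_deriv_eq_zero (f := fun τ => (S τ).re) (fun t => (hre t).differentiableAt)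
      (fun t => (hre t).deriv) t 0
  have ha0 : 0 < ‖β‖ ^ 2 - σ ^ 2 := by
    have := hgap0 0
    nlinarith [sq_nonneg (S 0).im]
  change 0 < ‖β‖ ^ 2 - σ ^ 2 ∧ ∃ m₁ m₂ : ℝ, 0 < m₁ ∧ 0 < m₂ ∧ ∀ t,
      m₁ * Real.exp (-(2 * √(‖β‖ ^ 2 - σ ^ 2) * |t|)) ≤ 1 - ‖p t‖ ^ 2 ∧
      1 - ‖p t‖ ^ 2 ≤ m₂ * Real.exp (-(2 * √(‖β‖ ^ 2 - σ ^ 2) * |t|))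
  refine ⟨ha0, ?_⟩
  set a := √(‖β‖ ^ 2 - σ ^ 2) with ha
  have hapos : 0 < a := Real.sqrt_pos.mpr ha0
  have hasq : a ^ 2 = ‖β‖ ^ 2 - σ ^ 2 := Real.sq_sqrt ha0.le
  set x : ℝ → ℝ := fun t => (S t).im with hx
  have hxg : ∀ t, ‖β‖ ^ 2 * (1 - ‖p t‖ ^ 2) = (a + x t) * (a - x t) := by
    intro t
    rw [hgap, hconst, ← hasq, hx]; ring
  have hxa : ∀ t, |x t| < a := by
    intro t
    refine abs_lt_of_sq_lt_sq ?_ hapos.le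
    have := hgap0 t
    rw [hconst] at this
    rw [hasq]; linarith
  have hplus : ∀ t, 0 < a + x t := fun t => by linarith [(abs_lt.mp (hxa t)).1]
  have hminus : ∀ t, 0 < a - x t := fun t => by linarith [(abs_lt.mp (hxa t)).2]
  have hL : ∀ t, HasDerivAt (fun τ => Real.log (a + x τ) - Real.log (a - x τ) - 2 * a * τ) 0 t := by
    intro t
    have h1 : HasDerivAt x ((a + x t) * (a - x t)) t := by rw [← hxg]; exact him t
    have h2 := ((h1.const_add a).log (hplus t).ne').sub ((h1.const_sub a).log (hminus t).ne')
    have h3 := h2.sub ((hasDerivAt_id t).const_mul (2 * a))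
    refine h3.congr_deriv ?_
    have := (hplus t).ne'
    have := (hminus t).ne'
    field_simp
    ring
  set y₀ := Real.log (a + x 0) - Real.log (a - x 0) with hy₀
  have hlog : ∀ t, Real.log (a + x t) - Real.log (a - x t) = 2 * a * t + y₀ := by
    intro t
    have := is_const_of_deriv_eq_zero (fun t => (hL t).differentiableAt)
      (fun t => (hL t).deriv) t 0
    simp only [mul_zero, sub_zero] at this
    linarith
  have hratio : ∀ t, a + x t = Real.exp (2 * a * t + y₀) * (a - x t) := by
    intro t
    rw [← hlog, Real.exp_sub, Real.exp_log (hplus t), Real.exp_log (hminus t)]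
    field_simp [(hminus t).ne']
  have habs : ∀ t, |2 * a * t| = 2 * a * |t| := fun t => by
    rw [abs_mul, abs_of_pos (by positivity)]
  refine ⟨a ^ 2 * Real.exp (-|y₀|) / ‖β‖ ^ 2, 4 * a ^ 2 * Real.exp |y₀| / ‖β‖ ^ 2, by positivity,
    by positivity, fun t => ?_⟩
  obtain ⟨hlow, hupp⟩ := mul_bounds_of_ratio (hxa t) (hratio t)
  rw [← hxg] at hlow hupp
  have hy1 : |2 * a * t + y₀| ≤ 2 * a * |t| + |y₀| := by
    rw [← habs]; exact abs_add_le _ _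
  have hy2 : 2 * a * |t| - |y₀| ≤ |2 * a * t + y₀| := by
    have := abs_sub_abs_le_abs_sub (2 * a * t) (-y₀)
    rw [abs_neg, sub_neg_eq_add, habs] at this
    exact this
  constructor
  · rw [div_mul_eq_mul_div, div_le_iff₀ hω, mul_comm (1 - ‖p t‖ ^ 2)]
    refine le_trans ?_ hlow
    rw [mul_assoc, ← Real.exp_add]
    gcongr
    linarith
  · rw [div_mul_eq_mul_div, le_div_iff₀ hω, mul_comm (1 - ‖p t‖ ^ 2)]
    refine hupp.trans ?_
    rw [mul_assoc _ (Real.exp _) (Real.exp _), ← Real.exp_add]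
    gcongr
    linarith

/-! ### Growth of the Sobolev norms -/

theorem isTheta_of_sq_bounds {f : ℝ → ℝ} {C d₁ d₂ : ℝ} (hf : ∀ t, 0 ≤ f t) (h1 : 0 < d₁)
    (hlow : ∀ᶠ t in cocompact ℝ, d₁ * Real.exp (C * |t|) ^ 2 ≤ f t ^ 2)
    (hupp : ∀ t, f t ^ 2 ≤ d₂ * Real.exp (C * |t|) ^ 2) :
    f =Θ[cocompact ℝ] fun t => Real.exp (C * |t|) := by
  have hd₂ : 0 ≤ d₂ := by
    have := (sq_nonneg _).trans (hupp 0)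
    simpa using this
  constructor
  · refine IsBigO.of_bound (√d₂) (Eventually.of_forall fun t => ?_)
    rw [Real.norm_of_nonneg (hf t), Real.norm_of_nonneg (Real.exp_pos _).le]
    refine le_of_sq_le_sq ?_ (by positivity)
    rw [mul_pow, Real.sq_sqrt hd₂]
    exact hupp t
  · refine IsBigO.of_bound (√d₁)⁻¹ (hlow.mono fun t ht => ?_)
    rw [Real.norm_of_nonneg (hf t), Real.norm_of_nonneg (Real.exp_pos _).le,
      inv_mul_eq_div, le_div_iff₀ (Real.sqrt_pos.mpr h1)]
    refine le_of_sq_le_sq ?_ (hf t)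
    rw [mul_pow, Real.sq_sqrt h1.le, mul_comm]
    exact ht

theorem rpow_mul_exp {m κ s : ℝ} (hm : 0 < m) (t : ℝ) :
    (m * Real.exp (-(κ * |t|))) ^ (1 - 2 * s)
      = m ^ (1 - 2 * s) * Real.exp ((s - 1 / 2) * κ * |t|) ^ 2 := by
  rw [Real.mul_rpow hm.le (Real.exp_pos _).le, ← Real.exp_mul, ← Real.exp_nat_mul]
  congr 2
  push_cast
  ring

theorem sq_mul_rpow {r s : ℝ} (hr : 0 < r) : r ^ 2 * r ^ (-(2 * s) - 1) = r ^ (1 - 2 * s) := by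
  rw [← Real.rpow_two, ← Real.rpow_add hr]
  congr 1; ring

theorem hsNorm_isTheta {u : ℝ → HPlus (1 / 2)} {b c p : ℝ → ℂ} {M Q κ m₁ m₂ s : ℝ}
    (hs : 1 / 2 < s) (hM : 0 < M) (hκ : 0 < κ) (hm₁ : 0 < m₁) (hm₂ : 0 < m₂)
    (hp : ∀ t, ‖p t‖ < 1) (hu : ∀ t, HasCoordinates (u t).val (b t) (c t) (p t))
    (hc : ∀ t, ‖c t‖ ^ 2 = M * (1 - ‖p t‖ ^ 2) ^ 2) (hb : ∀ t, ‖b t‖ ^ 2 ≤ Q)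
    (hlow : ∀ t, m₁ * Real.exp (-(κ * |t|)) ≤ 1 - ‖p t‖ ^ 2)
    (hupp : ∀ t, 1 - ‖p t‖ ^ 2 ≤ m₂ * Real.exp (-(κ * |t|))) :
    (fun t => hsNorm s (u t).val) =Θ[cocompact ℝ] fun t => Real.exp ((s - 1 / 2) * κ * |t|) := by
  have hs0 : 0 < s := by linarith
  have hr : ∀ t, 0 < 1 - ‖p t‖ ^ 2 := fun t => by nlinarith [hp t, norm_nonneg (p t)]
  have hQ : 0 ≤ Q := (sq_nonneg _).trans (hb 0)
  have hneg : 1 - 2 * s ≤ 0 := by linarith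
  set K := 8 * (8 * s) ^ (2 * s) with hK
  have hK0 : 0 < K := by positivity
  refine isTheta_of_sq_bounds (d₁ := M * Real.exp (-8) * m₂ ^ (1 - 2 * s))
    (d₂ := (Q + M * K) * m₁ ^ (1 - 2 * s)) (fun t => Real.sqrt_nonneg _) (by positivity) ?_ ?_
  · have hsmall : ∀ᶠ t : ℝ in cocompact ℝ, m₂ * Real.exp (-(κ * |t|)) ≤ 1 / 2 := by
      have h1 : Tendsto (fun t : ℝ => m₂ * Real.exp (-(κ * |t|))) (cocompact ℝ) (𝓝 (m₂ * 0)) := by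
        refine (Real.tendsto_exp_atBot.comp ?_).const_mul m₂
        exact tendsto_neg_atTop_atBot.comp (tendsto_norm_cocompact_atTop.const_mul_atTop hκ)
      rw [mul_zero] at h1
      exact h1.eventually_le_const (by norm_num)
    filter_upwards [hsmall] with t ht
    rw [(hu t).hsNorm_sq (hp t) hs0, hc t]
    have hx : 1 / 2 ≤ ‖p t‖ ^ 2 := by linarith [hupp t]
    have hG := le_sobolevSeries hs0 hx (by linarith [hr t])
    have hrp : (m₂ * Real.exp (-(κ * |t|))) ^ (1 - 2 * s) ≤ (1 - ‖p t‖ ^ 2) ^ (1 - 2 * s) :=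
      Real.rpow_le_rpow_of_nonpos (hr t) (hupp t) hneg
    rw [rpow_mul_exp hm₂] at hrp
    have hM8 : 0 < M * Real.exp (-8) := by positivity
    calc M * Real.exp (-8) * m₂ ^ (1 - 2 * s) * Real.exp ((s - 1 / 2) * κ * |t|) ^ 2
        = M * Real.exp (-8) * (m₂ ^ (1 - 2 * s) * Real.exp ((s - 1 / 2) * κ * |t|) ^ 2) := by ring
      _ ≤ M * Real.exp (-8) * (1 - ‖p t‖ ^ 2) ^ (1 - 2 * s) := by gcongr
      _ = M * (1 - ‖p t‖ ^ 2) ^ 2 * (Real.exp (-8) * (1 - ‖p t‖ ^ 2) ^ (-(2 * s) - 1)) := by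
          rw [← sq_mul_rpow (hr t)]; ring
      _ ≤ M * (1 - ‖p t‖ ^ 2) ^ 2 * sobolevSeries s (‖p t‖ ^ 2) := by gcongr
      _ ≤ _ := by linarith [sq_nonneg ‖b t‖]
  · intro t
    rw [(hu t).hsNorm_sq (hp t) hs0, hc t]
    have hG := sobolevSeries_le hs0 (sq_nonneg ‖p t‖) (by linarith [hr t])
    have hrp : (1 - ‖p t‖ ^ 2) ^ (1 - 2 * s) ≤ (m₁ * Real.exp (-(κ * |t|))) ^ (1 - 2 * s) :=
      Real.rpow_le_rpow_of_nonpos (by positivity) (hlow t) hneg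
    rw [rpow_mul_exp hm₁] at hrp
    have hone : 1 ≤ (1 - ‖p t‖ ^ 2) ^ (1 - 2 * s) :=
      Real.one_le_rpow_of_pos_of_le_one_of_nonpos (hr t) (by linarith [sq_nonneg ‖p t‖]) hneg
    calc ‖b t‖ ^ 2 + M * (1 - ‖p t‖ ^ 2) ^ 2 * sobolevSeries s (‖p t‖ ^ 2)
        ≤ Q * 1 + M * (1 - ‖p t‖ ^ 2) ^ 2 * (K * (1 - ‖p t‖ ^ 2) ^ (-(2 * s) - 1)) := by
          gcongr
          linarith [hb t]
      _ = Q * 1 + M * K * (1 - ‖p t‖ ^ 2) ^ (1 - 2 * s) := by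
          rw [← sq_mul_rpow (hr t)]; ring
      _ ≤ Q * (1 - ‖p t‖ ^ 2) ^ (1 - 2 * s) + M * K * (1 - ‖p t‖ ^ 2) ^ (1 - 2 * s) := by gcongr
      _ = (Q + M * K) * (1 - ‖p t‖ ^ 2) ^ (1 - 2 * s) := by ring
      _ ≤ (Q + M * K) * (m₁ ^ (1 - 2 * s) * Real.exp ((s - 1 / 2) * κ * |t|) ^ 2) := by gcongr
      _ = _ := by ring

/-! ### Global consequences -/

theorem one_sub_norm_sq_pos {p : ℂ} (hp : ‖p‖ < 1) : 0 < 1 - ‖p‖ ^ 2 := by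
  nlinarith [norm_nonneg p]

theorem one_sub_mul_conj_eq (p : ℂ) : 1 - p * conj p = ((1 - ‖p‖ ^ 2 : ℝ) : ℂ) := by
  rw [mul_conj_eq]; push_cast; rfl

theorem norm_sq_eq_of_momentum {f : L2} {b c p : ℂ} (hp : ‖p‖ < 1) (h : HasCoordinates f b c p) :
    ‖c‖ ^ 2 = momentum f * (1 - ‖p‖ ^ 2) ^ 2 := by
  rw [h.momentum_eq hp, div_mul_cancel₀ _ (pow_ne_zero _ (one_sub_norm_sq_pos hp).ne')]

theorem norm_sq_div_eq_of_momentum {f : L2} {b c p : ℂ} (hp : ‖p‖ < 1)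
    (h : HasCoordinates f b c p) : ‖c‖ ^ 2 / (1 - ‖p‖ ^ 2) = momentum f * (1 - ‖p‖ ^ 2) := by
  rw [norm_sq_eq_of_momentum hp h, div_eq_iff (one_sub_norm_sq_pos hp).ne']; ring

theorem norm_ratio_sq {f : L2} {b c p : ℂ} (hp : ‖p‖ < 1) (h : HasCoordinates f b c p) :
    ‖c / (1 - p * conj p)‖ ^ 2 = momentum f := by
  have := momentum_eq_ratio hp h
  rw [mul_conj_eq] at this
  exact_mod_cast this

theorem norm_poleVal_sq_le {f : L2} {b c p : ℂ} (hp : ‖p‖ < 1) (h : HasCoordinates f b c p) :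
    ‖poleVal b c p‖ ^ 2 ≤ 2 * mass f + 2 * momentum f := by
  have h1 : ‖poleVal b c p‖ ≤ ‖b‖ + ‖c / (1 - p * conj p)‖ := by
    have e : poleVal b c p = b + c / (1 - p * conj p) * conj p := by rw [poleVal]; ring
    rw [e]
    refine (norm_add_le _ _).trans ?_
    rw [norm_mul, RCLike.norm_conj]
    have := mul_le_of_le_one_right (norm_nonneg (c / (1 - p * conj p))) hp.le
    linarith
  have h2 := norm_ratio_sq hp h
  have h3 : ‖b‖ ^ 2 ≤ mass f := by
    rw [h.mass_eq hp]
    have := one_sub_norm_sq_pos hp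
    have : 0 ≤ ‖c‖ ^ 2 / (1 - ‖p‖ ^ 2) := by positivity
    linarith
  have h4 : ‖poleVal b c p‖ ^ 2 ≤ (‖b‖ + ‖c / (1 - p * conj p)‖) ^ 2 := by gcongr
  nlinarith [sq_nonneg (‖b‖ - ‖c / (1 - p * conj p)‖)]

/-- The threshold condition in terms of the energy. -/
theorem norm_poleVal_sq_eq_iff_energy {f : L2} {b c p : ℂ} (hc : c ≠ 0) (hp : ‖p‖ < 1)
    (h : HasCoordinates f b c p) (α : ℝ) :
    ‖poleVal b c p‖ ^ 2 = α ↔ energy α f = 1 / 4 * mass f ^ 2 + α / 2 * mass f := by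
  rw [h.energy_eq hp, h.mass_eq hp]
  have hN : 0 < ‖c‖ ^ 2 / (1 - ‖p‖ ^ 2) := by
    have := one_sub_norm_sq_pos hp
    have := norm_pos_iff.mpr hc
    positivity
  set N := ‖c‖ ^ 2 / (1 - ‖p‖ ^ 2)
  constructor
  · intro h; rw [h]; ring
  · intro h
    have : N * (‖poleVal b c p‖ ^ 2 - α) = 0 := by linarith
    rcases mul_eq_zero.mp this with h | h
    · exact absurd h hN.ne'
    · linarith

theorem norm_eq_sqrt_iff_sq {w : ℂ} {α : ℝ} (hα : 0 < α) : ‖w‖ = √α ↔ ‖w‖ ^ 2 = α := by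
  constructor
  · intro h; rw [h, Real.sq_sqrt hα.le]
  · intro h; rw [← h, Real.sqrt_sq (norm_nonneg _)]

section Global

variable {α : ℝ} {u : ℝ → HPlus (1 / 2)} {b c p : ℝ → ℂ}

theorem momentum_const (hco : ∀ t, CoordEq α b c p t)
    (hu : ∀ t, HasCoordinates (u t).val (b t) (c t) (p t)) (t : ℝ) :
    momentum (u t).val = momentum (u 0).val := by
  have h1 := is_const_of_deriv_eq_zero (fun t => (hco t).hasDerivAt_momentum.differentiableAt)
    (fun t => (hco t).hasDerivAt_momentum.deriv) t 0
  simp only [momentum_eq_ratio (hco _).norm_lt (hu _)] at h1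
  exact_mod_cast h1

theorem mass_const (hco : ∀ t, CoordEq α b c p t)
    (hu : ∀ t, HasCoordinates (u t).val (b t) (c t) (p t)) (t : ℝ) :
    mass (u t).val = mass (u 0).val := by
  have h1 := is_const_of_deriv_eq_zero (fun t => (hco t).hasDerivAt_mass.differentiableAt)
    (fun t => (hco t).hasDerivAt_mass.deriv) t 0
  simp only [mul_conj_eq] at h1
  rw [(hu t).mass_eq (hco t).norm_lt, (hu 0).mass_eq (hco 0).norm_lt]
  exact_mod_cast h1

theorem defect_const (hco : ∀ t, CoordEq α b c p t)
    (hu : ∀ t, HasCoordinates (u t).val (b t) (c t) (p t)) (t : ℝ) :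
    momentum (u 0).val * (1 - ‖p t‖ ^ 2) * (‖poleVal (b t) (c t) (p t)‖ ^ 2 - α)
      = momentum (u 0).val * (1 - ‖p 0‖ ^ 2) * (‖poleVal (b 0) (c 0) (p 0)‖ ^ 2 - α) := by
  have h1 := is_const_of_deriv_eq_zero (fun t => (hco t).hasDerivAt_defect.differentiableAt)
    (fun t => (hco t).hasDerivAt_defect.deriv) t 0
  simp only [mul_conj_eq] at h1
  norm_cast at h1
  rw [norm_sq_div_eq_of_momentum (hco t).norm_lt (hu t),
    norm_sq_div_eq_of_momentum (hco 0).norm_lt (hu 0), momentum_const hco hu t] at h1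
  exact h1

theorem momentum_pos (hco : ∀ t, CoordEq α b c p t)
    (hu : ∀ t, HasCoordinates (u t).val (b t) (c t) (p t)) (hc : c 0 ≠ 0) :
    0 < momentum (u 0).val := by
  rw [(hu 0).momentum_eq (hco 0).norm_lt]
  have := one_sub_norm_sq_pos (hco 0).norm_lt
  have := norm_pos_iff.mpr hc
  positivity

/-- Off the threshold, the trajectory is relatively compact in `𝓛(1)`. -/
theorem relativelyCompactIn_of_ne (hα : 0 < α) (hco : ∀ t, CoordEq α b c p t)
    (hu : ∀ t, HasCoordinates (u t).val (b t) (c t) (p t)) (hc : c 0 ≠ 0)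
    (hne : ‖poleVal (b 0) (c 0) (p 0)‖ ^ 2 ≠ α) : RelativelyCompactIn (manifoldL 1) u := by
  set M := momentum (u 0).val with hM
  set Q := mass (u 0).val with hQ
  have hM0 : 0 < M := momentum_pos hco hu hc
  have hr : ∀ t, 0 < 1 - ‖p t‖ ^ 2 := fun t => one_sub_norm_sq_pos (hco t).norm_lt
  set W := M * (1 - ‖p 0‖ ^ 2) * (‖poleVal (b 0) (c 0) (p 0)‖ ^ 2 - α) with hW
  have hW0 : 0 < |W| := abs_pos.mpr (mul_ne_zero (mul_pos hM0 (hr 0)).ne' (sub_ne_zero.mpr hne))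
  have hbQ : ∀ t, ‖b t‖ ^ 2 + M * (1 - ‖p t‖ ^ 2) = Q := fun t => by
    have h1 := (hu t).mass_eq (hco t).norm_lt
    rw [norm_sq_div_eq_of_momentum (hco t).norm_lt (hu t), mass_const hco hu,
      momentum_const hco hu] at h1
    exact h1.symm
  have hQ0 : 0 ≤ Q := by
    rw [← hbQ 0]
    have := hr 0
    positivity
  set B := 2 * Q + 2 * M + α with hB
  have hB0 : 0 < B := by positivity
  set ε := |W| / (M * B) with hε
  have hε0 : 0 < ε := by positivity
  have hgap : ∀ t, ε ≤ 1 - ‖p t‖ ^ 2 := by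
    intro t
    have h1 := defect_const hco hu t
    rw [← hM, ← hW] at h1
    have h2 := norm_poleVal_sq_le (hco t).norm_lt (hu t)
    rw [mass_const hco hu, momentum_const hco hu] at h2
    have h3 : |‖poleVal (b t) (c t) (p t)‖ ^ 2 - α| ≤ B := by
      rw [abs_le]
      constructor <;> nlinarith [sq_nonneg ‖poleVal (b t) (c t) (p t)‖]
    rw [hε, div_le_iff₀ (by positivity), ← h1, abs_mul, abs_of_pos (mul_pos hM0 (hr t))]
    calc M * (1 - ‖p t‖ ^ 2) * |‖poleVal (b t) (c t) (p t)‖ ^ 2 - α|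
        ≤ M * (1 - ‖p t‖ ^ 2) * B := by
          have := hr t
          gcongr
      _ = _ := by ring
  set K₀ : Set (ℂ × ℂ × ℂ) := {q | ‖q.1‖ ^ 2 ≤ Q ∧ ‖q.2.1‖ ^ 2 ≤ M ∧ M * ε ^ 2 ≤ ‖q.2.1‖ ^ 2 ∧
    ε ≤ 1 - ‖q.2.2‖ ^ 2} with hK₀
  have hK₀p : ∀ q ∈ K₀, ‖q.2.2‖ < 1 := by
    rintro q ⟨-, -, -, h⟩
    nlinarith [norm_nonneg q.2.2]
  have hcompact : IsCompact K₀ := by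
    refine Metric.isCompact_of_isClosed_isBounded ?_ ?_
    · have k1 : IsClosed {q : ℂ × ℂ × ℂ | ‖q.1‖ ^ 2 ≤ Q} := isClosed_le (by fun_prop) (by fun_prop)
      have k2 : IsClosed {q : ℂ × ℂ × ℂ | ‖q.2.1‖ ^ 2 ≤ M} := isClosed_le (by fun_prop) (by fun_prop)
      have k3 : IsClosed {q : ℂ × ℂ × ℂ | M * ε ^ 2 ≤ ‖q.2.1‖ ^ 2} :=
        isClosed_le (by fun_prop) (by fun_prop)
      have k4 : IsClosed {q : ℂ × ℂ × ℂ | ε ≤ 1 - ‖q.2.2‖ ^ 2} :=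
        isClosed_le (by fun_prop) (by fun_prop)
      exact k1.inter (k2.inter (k3.inter k4))
    · refine (Metric.isBounded_closedBall (x := (0 : ℂ × ℂ × ℂ)) (r := max (√Q) (max (√M) 1))).subset ?_
      intro q hq
      rw [mem_closedBall_zero_iff, Prod.norm_def, Prod.norm_def]
      exact max_le_max (Real.le_sqrt_of_sq_le hq.1)
        (max_le_max (Real.le_sqrt_of_sq_le hq.2.1) (hK₀p q hq).le)
  refine ⟨(fun q : ℂ × ℂ × ℂ => rat q.1 q.2.1 q.2.2) '' K₀, ?_, ?_, ?_⟩
  · exact hcompact.image_of_continuousOn fun q hq =>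
      (continuousAt_rat (hK₀p q hq)).continuousWithinAt
  · rintro _ ⟨q, hq, rfl⟩
    refine mem_manifoldL_of_hasCoordinates ?_ (hK₀p q hq) (hasCoordinates_rat (hK₀p q hq) _ _)
    intro h0
    have h1 := hq.2.2.1
    rw [h0] at h1
    have : 0 < M * ε ^ 2 := by positivity
    simp at h1
    linarith
  · rintro _ ⟨t, rfl⟩
    refine ⟨(b t, c t, p t), ⟨?_, ?_, ?_, hgap t⟩, (eq_rat (hco t).norm_lt (hu t)).symm⟩
    · have := hbQ t
      have := mul_pos hM0 (hr t)
      change ‖b t‖ ^ 2 ≤ Q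
      linarith
    · change ‖c t‖ ^ 2 ≤ M
      rw [norm_sq_eq_of_momentum (hco t).norm_lt (hu t), momentum_const hco hu]
      have h1 : (1 - ‖p t‖ ^ 2) ^ 2 ≤ 1 := pow_le_one₀ (hr t).le (by linarith [sq_nonneg ‖p t‖])
      exact mul_le_of_le_one_right hM0.le h1
    · change M * ε ^ 2 ≤ ‖c t‖ ^ 2
      rw [norm_sq_eq_of_momentum (hco t).norm_lt (hu t), momentum_const hco hu]
      have := hgap t
      gcongr

/-- The threshold condition is preserved. -/
theorem norm_poleVal_sq_const (hco : ∀ t, CoordEq α b c p t)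
    (hu : ∀ t, HasCoordinates (u t).val (b t) (c t) (p t)) (hc : c 0 ≠ 0)
    (h0 : ‖poleVal (b 0) (c 0) (p 0)‖ ^ 2 = α) (t : ℝ) :
    ‖poleVal (b t) (c t) (p t)‖ ^ 2 = α := by
  have h1 := defect_const hco hu t
  rw [h0, sub_self, mul_zero] at h1
  have h2 := mul_pos (momentum_pos hco hu hc) (one_sub_norm_sq_pos (hco t).norm_lt)
  rcases mul_eq_zero.mp h1 with h | h
  · exact absurd h h2.ne'
  · linarith

/-- The slope `Ū c / (1 - |p|²)`, `U` the value at `p̄`, and the conserved quantities. -/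
theorem two_re_slope {f : L2} {b c p : ℂ} (hp : ‖p‖ < 1) (h : HasCoordinates f b c p) :
    2 * (conj (poleVal b c p) * (c / (1 - p * conj p)) * conj p).re
      = ‖poleVal b c p‖ ^ 2 + momentum f - mass f := by
  have h1 := norm_ratio_sq hp h
  have h2 : b = poleVal b c p - c / (1 - p * conj p) * conj p := by rw [poleVal]; ring
  have h3 : ‖b‖ ^ 2 = ‖poleVal b c p‖ ^ 2
      - 2 * (conj (poleVal b c p) * (c / (1 - p * conj p)) * conj p).re
      + momentum f * ‖p‖ ^ 2 := by
    conv_lhs => rw [h2]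
    rw [norm_sub_sq_real, norm_mul, mul_pow, h1, RCLike.norm_conj, Complex.inner]
    congr 4
    ring
  rw [h.mass_eq hp, norm_sq_div_eq_of_momentum hp h, h3]
  ring

theorem norm_slope_sq {f : L2} {b c p : ℂ} (hp : ‖p‖ < 1) (h : HasCoordinates f b c p) :
    ‖conj (poleVal b c p) * (c / (1 - p * conj p))‖ ^ 2 = ‖poleVal b c p‖ ^ 2 * momentum f := by
  rw [norm_mul, mul_pow, RCLike.norm_conj, norm_ratio_sq hp h]


theorem fieldP_eq {b c p : ℂ} (hp : ‖p‖ < 1) : fieldP b c p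
    = -Complex.I * (conj (poleVal b c p) * (c / (1 - p * conj p))) * (1 - p * conj p) := by
  have hr := one_sub_mul_conj_ne_zero hp
  rw [fieldP, conj_poleVal]
  field_simp

/-- The equation of `log |c|` on the threshold. -/
theorem exists_hasDerivAt_log (hco : ∀ t, CoordEq α b c p t)
    (hu : ∀ t, HasCoordinates (u t).val (b t) (c t) (p t)) (hc : ∀ t, c t ≠ 0)
    (h0 : ‖poleVal (b 0) (c 0) (p 0)‖ ^ 2 = α) (t : ℝ) :
    ∃ d : ℝ, HasDerivAt (fun τ => Real.log ‖c τ‖) d t ∧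
      d ^ 2 = -4 * α * √(momentum (u 0).val) * ‖c t‖
        + 4 * mass (u 0).val * momentum (u 0).val
        - (α - momentum (u 0).val - mass (u 0).val) ^ 2 := by
  refine ⟨_, (hco t).hasDerivAt_log (hc t), ?_⟩
  have hp := (hco t).norm_lt
  have hU := norm_poleVal_sq_const hco hu (hc 0) h0 t
  have hre := two_re_slope hp (hu t)
  have hsl := norm_slope_sq hp (hu t)
  rw [hU, momentum_const hco hu, mass_const hco hu] at hre
  rw [hU, momentum_const hco hu] at hsl
  set M := momentum (u 0).val
  set Q := mass (u 0).val
  have hM0 : 0 < M := momentum_pos hco hu (hc 0)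
  set β := conj (poleVal (b t) (c t) (p t)) * (c t / (1 - p t * conj (p t)))
  have hcM : √M * ‖c t‖ = M * (1 - ‖p t‖ ^ 2) := by
    have h1 : ‖c t‖ = √M * (1 - ‖p t‖ ^ 2) := by
      have h2 := norm_sq_eq_of_momentum hp (hu t)
      rw [momentum_const hco hu] at h2
      have h3 := one_sub_norm_sq_pos hp
      refine (sq_eq_sq₀ (norm_nonneg _) (by positivity)).mp ?_
      rw [h2, mul_pow, Real.sq_sqrt hM0.le]
    rw [h1, ← mul_assoc, Real.mul_self_sqrt hM0.le]
  have hX : (β * conj (p t)).re ^ 2 + (β * conj (p t)).im ^ 2 = α * M * ‖p t‖ ^ 2 := by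
    rw [← hsl, ← mul_pow, ← RCLike.norm_conj (p t), ← norm_mul, ← Complex.normSq_eq_norm_sq,
      Complex.normSq_apply]
    ring
  have e : -4 * α * √M * ‖c t‖ = -4 * α * (M * (1 - ‖p t‖ ^ 2)) := by rw [← hcM]; ring
  rw [e]
  have h4 : (2 * (β * conj (p t)).re) ^ 2 = (α + M - Q) ^ 2 := by rw [hre]
  linarith

/-- Exponential growth of the Sobolev norms on the threshold. -/
theorem hsNorm_growth (hα : 0 < α) (hco : ∀ t, CoordEq α b c p t)
    (hu : ∀ t, HasCoordinates (u t).val (b t) (c t) (p t)) (hc : ∀ t, c t ≠ 0)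
    (h0 : ‖poleVal (b 0) (c 0) (p 0)‖ ^ 2 = α) {s : ℝ} (hs : 1 / 2 < s) :
    0 < (s - 1 / 2) * √(4 * mass (u 0).val * momentum (u 0).val
      - (α - momentum (u 0).val - mass (u 0).val) ^ 2) ∧
    (fun t => hsNorm s (u t).val) =Θ[cocompact ℝ] fun t =>
      Real.exp ((s - 1 / 2) * √(4 * mass (u 0).val * momentum (u 0).val
        - (α - momentum (u 0).val - mass (u 0).val) ^ 2) * |t|) := by
  have hU := norm_poleVal_sq_const hco hu (hc 0) h0
  have hUc : ∀ t, poleVal (b t) (c t) (p t) * conj (poleVal (b t) (c t) (p t)) = α := fun t => by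
    rw [mul_conj_eq, hU]
  have hβc := fun t => is_const_of_deriv_eq_zero
    (fun t => ((hco t).hasDerivAt_slope (hUc t)).differentiableAt)
    (fun t => ((hco t).hasDerivAt_slope (hUc t)).deriv) t 0
  have hre := two_re_slope (hco 0).norm_lt (hu 0)
  have hsl := norm_slope_sq (hco 0).norm_lt (hu 0)
  rw [h0] at hre hsl
  set β := conj (poleVal (b 0) (c 0) (p 0)) * (c 0 / (1 - p 0 * conj (p 0))) with hβ
  set M := momentum (u 0).val with hM
  set Q := mass (u 0).val with hQ
  have hM0 : 0 < M := momentum_pos hco hu (hc 0)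
  have hβ0 : β ≠ 0 := by
    intro h
    rw [h] at hsl
    have := mul_pos hα hM0
    simp at hsl
    rcases hsl with h | h <;> linarith
  obtain ⟨hpos, m₁, m₂, hm₁, hm₂, hbd⟩ := gap_bounds hβ0 (fun t => (hco t).norm_lt) (fun t => by
    refine (hco t).derivP.congr_deriv ?_
    rw [fieldP_eq (hco t).norm_lt, hβc t])
  have hκ : √(4 * Q * M - (α - M - Q) ^ 2) = 2 * √(‖β‖ ^ 2 - (β * conj (p 0)).re ^ 2) := by
    have e : 4 * Q * M - (α - M - Q) ^ 2 = 2 ^ 2 * (‖β‖ ^ 2 - (β * conj (p 0)).re ^ 2) := by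
      have h4 : (2 * (β * conj (p 0)).re) ^ 2 = (α + M - Q) ^ 2 := by rw [hre]
      rw [hsl]
      linarith
    rw [e, Real.sqrt_mul (by norm_num), Real.sqrt_sq (by norm_num)]
  have hκ0 : 0 < √(4 * Q * M - (α - M - Q) ^ 2) := by
    rw [hκ]
    have := Real.sqrt_pos.mpr hpos
    positivity
  rw [← hκ] at hbd
  refine ⟨mul_pos (by linarith) hκ0, hsNorm_isTheta hs hM0 hκ0 hm₁ hm₂ (fun t => (hco t).norm_lt) hu
    (fun t => ?_) (fun t => ?_) (fun t => (hbd t).1) (fun t => (hbd t).2) (Q := Q)⟩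
  · rw [norm_sq_eq_of_momentum (hco t).norm_lt (hu t), momentum_const hco hu]
  · rw [hQ, ← mass_const hco hu t, (hu t).mass_eq (hco t).norm_lt]
    have := one_sub_norm_sq_pos (hco t).norm_lt
    have : 0 ≤ ‖c t‖ ^ 2 / (1 - ‖p t‖ ^ 2) := by positivity
    linarith

end Global

end Szego

end

theorem mainTheorem2 :
    ∃ C : ℝ → ℝ → ℝ → ℝ → ℝ,
      ∀ (α : ℝ), 0 < α →
      ∀ u₀ ∈ Szego.manifoldL 1,
      ∀ u : ℝ → Szego.HPlus (1 / 2), Szego.IsSolution α u₀ u →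
      ∃ b c p : ℝ → ℂ,
        (∀ t, c t ≠ 0 ∧ ‖p t‖ < 1 ∧ Szego.HasCoordinates (u t).val (b t) (c t) (p t)) ∧
        (¬ Szego.RelativelyCompactIn (Szego.manifoldL 1) u →
          ‖b 0 + conj (p 0) * c 0 / (1 - (‖p 0‖ : ℂ) ^ 2)‖ = √α) ∧
        (‖b 0 + conj (p 0) * c 0 / (1 - (‖p 0‖ : ℂ) ^ 2)‖ = √α ↔
          Szego.energy α u₀.val
            = 1 / 4 * Szego.mass u₀.val ^ 2 + α / 2 * Szego.mass u₀.val) ∧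
        (‖b 0 + conj (p 0) * c 0 / (1 - (‖p 0‖ : ℂ) ^ 2)‖ = √α →
          (∀ t, ∃ d : ℝ, HasDerivAt (fun τ => Real.log ‖c τ‖) d t ∧
            d ^ 2 = -4 * α * √(Szego.momentum u₀.val) * ‖c t‖
              + 4 * Szego.mass u₀.val * Szego.momentum u₀.val
              - (α - Szego.momentum u₀.val - Szego.mass u₀.val) ^ 2) ∧
          ∀ s : ℝ, 1 / 2 < s →
            0 < C α s (Szego.mass u₀.val) (Szego.momentum u₀.val) ∧
            (∀ t, Szego.MemHs s (u t).val) ∧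
            (fun t => Szego.hsNorm s (u t).val) =Θ[cocompact ℝ]
              fun t => Real.exp
                (C α s (Szego.mass u₀.val) (Szego.momentum u₀.val) * |t|)) := by
  refine ⟨fun α s Q M => (s - 1 / 2) * √(4 * Q * M - (α - M - Q) ^ 2), ?_⟩
  intro α hα u₀ hu₀ u hu
  have hmode : ∀ t, Szego.ModeEq α u t := hu.equation
  have hinit : u 0 = u₀ := hu.initial
  subst hinit
  choose b c p hc hp hcoord using Szego.exists_coordinates_of_modeEq hu.continuous hmode hu₀
  have hall : ∀ t, c t ≠ 0 ∧ ‖p t‖ < 1 ∧ Szego.HasCoordinates (u t).val (b t) (c t) (p t) :=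
    fun t => ⟨hc t, hp t, hcoord t⟩
  have hco : ∀ t, Szego.CoordEq α b c p t := fun t => (hmode t).coordEq hall
  have hpole : b 0 + conj (p 0) * c 0 / (1 - (‖p 0‖ : ℂ) ^ 2)
      = Szego.poleVal (b 0) (c 0) (p 0) := by
    rw [Szego.poleVal, Szego.one_sub_mul_conj_eq]
    push_cast
    ring
  refine ⟨b, c, p, hall, ?_, ?_, ?_⟩
  · intro hnc
    rw [hpole, Szego.norm_eq_sqrt_iff_sq hα]
    by_contra hne
    exact hnc (Szego.relativelyCompactIn_of_ne hα hco hcoord (hc 0) hne)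
  · rw [hpole, Szego.norm_eq_sqrt_iff_sq hα]
    exact Szego.norm_poleVal_sq_eq_iff_energy (hc 0) (hp 0) (hcoord 0) α
  · intro hthr
    rw [hpole, Szego.norm_eq_sqrt_iff_sq hα] at hthr
    refine ⟨Szego.exists_hasDerivAt_log hco hcoord hc hthr, fun s hs => ?_⟩
    obtain ⟨h1, h2⟩ := Szego.hsNorm_growth hα hco hcoord hc hthr hs
    exact ⟨h1, fun t => (hcoord t).memHs (hp t) (by linarith), h2⟩
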